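/- Let $q\in\mathbb{C}$ with $0<|q|<1$, and write $(a)_\infty=\prod_{i\ge 0}(1-aq^i)$, $(a)_l=\prod_{0\le i<l}(1-aq^i)$ for $l\in\mathbb{Z}_{\ge 0}$ (so $(a)_l=(a)_\infty/(aq^l)_\infty$ when $(aq^l)_\infty\neq 0$). For $l\in\mathbb{Z}_{\ge0}^M$ put $|l|=l_1+\cdots+l_M$, and let $\Delta(y)=\prod_{1\le i<j\le M}(y_i-y_j)$. Let $${}_{M+1}\varphi_M\left(\begin{array}{c}\{a_i\}_{1\le i\le M+1}\\ \{b_i\}_{1\le i\le M}\end{array};x\right)=\sum_{l=0}^\infty\frac{(a_1)_l\cdots(a_{M+1})_l}{(q)_l(b_1)_l\cdots(b_M)_l}x^l .$$ Let $M\ge 1$, let $a_1,\dots,a_{M+1},b_1,\dots,b_M$ be nonzero complex numbers, let $x\in\mathbb{C}$ with $|x|<1$, and put $A=a_1\cdots a_{M+1}$, $B=b_1\cdots b_M$. Assume that $b_iq^k\neq 1$ for all $i$ and $k\in\mathbb{Z}_{\ge0}$, and that $b_iq^k\ne b_j$ for all $i\neq j$ and $k\in\mathbb{Z}_{\ge0}$.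 Then the series ${}_{M+1}\varphi_M$ above converges absolutely, and the following hold, all multiple series being absolutely convergent. (1) If $a_ixq^k\ne1$ $(1\le i\le M+1)$, $b_ixq^k\neq 1$ and $b_ix\ne q$ $(1\le i\le M)$ for all $k\in\mathbb{Z}_{\ge0}$, then $$\frac{1}{(x)_\infty}\prod_{i=1}^{M+1}(a_ix)_\infty\prod_{i=1}^M\frac{1}{(b_ix)_\infty}\sum_{l\in\mathbb{Z}_{\ge0}^M}q^{\binom{|l|}{2}}\frac{\Delta(\{b_iq^{l_i}\}_{1\le i\le M})}{\Delta(\{b_i\}_{1\le i\le M})}\frac{(x)_{|l|}}{(a_{M+1}x)_{|l|}}\prod_{i=1}^M\left(\frac{1-b_ixq^{|l|+l_i}/q}{1-b_ix/q}\cdot\frac{(b_ix/q)_{|l|}\prod_{j=1}^{M+1}(b_i/a_j)_{l_i}\cdot(Ab_ix/B)^{l_i}q^{\binom{l_i}{2}}}{(a_ix)_{|l|}\prod_{j=1}^M(qb_i/b_j)_{l_i}\cdot(b_i)_{l_i}}\right)={}_{M+1}\varphi_M\left(\begin{array}{c}\{a_i\}_{1\le i\le M+1}\\ \{b_i\}_{1\le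 i\le M}\end{array};x\right).$$ (2) If $|Ax/B|<1$, then $$\frac{(Ax/B)_\infty}{(x)_\infty}\sum_{l\in\mathbb{Z}_{\ge0}^M}\left(\frac{Ax}{B}\right)^{|l|}\frac{\Delta(\{b_iq^{l_i}\}_{1\le i\le M})}{\Delta(\{b_i\}_{1\le i\le M})}\prod_{i=1}^M\frac{\prod_{j=1}^{M+1}(b_i/a_j)_{l_i}}{\prod_{j=1}^M(qb_i/b_j)_{l_i}\cdot(b_i)_{l_i}}={}_{M+1}\varphi_M\left(\begin{array}{c}\{a_i\}_{1\le i\le M+1}\\ \{b_i\}_{1\le i\le M}\end{array};x\right).$$ (3) If $a_{M+1}xq^k\neq1$ for all $k\in\mathbb{Z}_{\ge0}$, then $$\frac{(a_{M+1}x)_\infty}{(x)_\infty}\sum_{l\in\mathbb{Z}_{\ge0}^M}\left(-\frac{Ax}{a_{M+1}B}\right)^{|l|}\frac{\Delta(\{b_iq^{l_i}\}_{1\le i\le M})}{\Delta(\{b_i\}_{1\le i\le M})}\frac{(a_{M+1})_{|l|}}{(a_{M+1}x)_{|l|}}\prod_{i=1}^M\frac{\prod_{j=1}^{M}(b_i/a_j)_{l_i}\cdot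 b_i^{l_i}q^{\binom{l_i}{2}}}{\prod_{j=1}^M(qb_i/b_j)_{l_i}\cdot(b_i)_{l_i}}={}_{M+1}\varphi_M\left(\begin{array}{c}\{a_i\}_{1\le i\le M+1}\\ \{b_i\}_{1\le i\le M}\end{array};x\right).$$ For $M=1$, (2) and (3) are the $q$-Euler transformation and Jackson's transformation. -/

import Mathlib

/-- The infinite `q`-shifted factorial `(a)_∞ = ∏_{i ≥ 0} (1 - a q^i)`. -/
noncomputable def qPochInf (q a : ℂ) : ℂ := ∏' i : ℕ, (1 - a * q ^ i)

/-- The finite `q`-shifted factorial `(a)_l = ∏_{0 ≤ i < l} (1 - a q^i)`, for `l ≥ 0`. -/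
noncomputable def qPoch (q a : ℂ) (l : ℕ) : ℂ := ∏ i ∈ Finset.range l, (1 - a * q ^ i)

/-- The finite factorial is the quotient `(a)_∞ / (a q^l)_∞` wherever that quotient makes sense. -/
theorem qPoch_eq_div {q : ℂ} (hq : ‖q‖ < 1) (a : ℂ) (l : ℕ) (h : qPochInf q (a * q ^ l) ≠ 0) :
    qPoch q a l = qPochInf q a / qPochInf q (a * q ^ l) := by
  have hm : ∀ c : ℂ, Multipliable (fun i : ℕ => 1 - c * q ^ i) := by
    intro c
    have hs : Summable (fun i : ℕ => ‖-(c * q ^ i)‖) := by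
      simp only [norm_neg, norm_mul, norm_pow]
      exact (summable_geometric_of_lt_one (norm_nonneg q) hq).mul_left _
    simpa [sub_eq_add_neg] using multipliable_one_add_of_summable hs
  have hshift : ∀ i : ℕ, 1 - a * q ^ (i + l) = 1 - a * q ^ l * q ^ i := by
    intro i
    ring
  have hm' : Multipliable (fun i : ℕ => 1 - a * q ^ (i + l)) :=
    (hm (a * q ^ l)).congr fun i => (hshift i).symm
  have key := Multipliable.prod_mul_tprod_nat_mul' (f := fun i : ℕ => 1 - a * q ^ i) hm'
  have ht : qPochInf q (a * q ^ l) = ∏' i : ℕ, (1 - a * q ^ (i + l)) :=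
    tprod_congr fun i => (hshift i).symm
  rw [eq_div_iff h, ht]
  exact key

/-- The `l`-th term of the basic hypergeometric series `_rφ_s(a_1,…,a_r; b_1,…,b_s; z)`. -/
noncomputable def basicHypTerm (q : ℂ) {r s : ℕ} (a : Fin r → ℂ) (b : Fin s → ℂ) (z : ℂ)
    (l : ℕ) : ℂ :=
  (∏ i, qPoch q (a i) l) / (qPoch q q l * ∏ i, qPoch q (b i) l)
    * ((-1) ^ l * q ^ (l.choose 2)) ^ (1 + (s : ℤ) - (r : ℤ)) * z ^ l

/-- The basic hypergeometric series `_rφ_s(a_1,…,a_r; b_1,…,b_s; z)`. -/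
noncomputable def basicHyp (q : ℂ) {r s : ℕ} (a : Fin r → ℂ) (b : Fin s → ℂ) (z : ℂ) : ℂ :=
  ∑' l : ℕ, basicHypTerm q a b z l

/-- The Vandermonde product `Δ(x) = ∏_{i < j} (x_i - x_j)`. -/
def vandermondeProd {M : ℕ} (x : Fin M → ℂ) : ℂ := ∏ i, ∏ j ∈ Finset.Ioi i, (x i - x j)

/-- `|l| = l_1 + ⋯ + l_M`. -/
def multiDeg {M : ℕ} (l : Fin M → ℕ) : ℕ := ∑ i, l i

/-- The ratio `Δ({b_i q^{l_i}}) / Δ({b_i})`. -/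
noncomputable def vandermondeRatio (q : ℂ) {M : ℕ} (b : Fin M → ℂ) (l : Fin M → ℕ) : ℂ :=
  vandermondeProd (fun i => b i * q ^ l i) / vandermondeProd b

/-- The summand of the first multiple series. The parameters `a_1, …, a_{M+1}` are
`a 0, …, a (Fin.last M)`, and `a_i` for `i ≤ M` is `a i.castSucc`. -/
noncomputable def firstTerm (q : ℂ) {M : ℕ} (a : Fin (M + 1) → ℂ) (b : Fin M → ℂ) (x : ℂ)
    (l : Fin M → ℕ) : ℂ :=
  q ^ ((multiDeg l).choose 2) * vandermondeRatio q b l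
    * (qPoch q x (multiDeg l) / qPoch q (a (Fin.last M) * x) (multiDeg l))
    * ∏ i, ((1 - b i * x * q ^ (multiDeg l + l i) / q) / (1 - b i * x / q)
        * ((qPoch q (b i * x / q) (multiDeg l) * (∏ j : Fin (M + 1), qPoch q (b i / a j) (l i))
              * ((∏ j, a j) * b i * x / ∏ j, b j) ^ l i * q ^ ((l i).choose 2))
            / (qPoch q (a i.castSucc * x) (multiDeg l)
              * (∏ j : Fin M, qPoch q (q * b i / b j) (l i)) * qPoch q (b i) (l i))))

/-- The summand of the second multiple series. -/
noncomputable def secondTerm (q : ℂ) {M : ℕ} (a : Fin (M + 1) → ℂ) (b : Fin M → ℂ) (x : ℂ)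
    (l : Fin M → ℕ) : ℂ :=
  ((∏ j, a j) * x / ∏ j, b j) ^ multiDeg l * vandermondeRatio q b l
    * ∏ i, ((∏ j : Fin (M + 1), qPoch q (b i / a j) (l i))
        / ((∏ j : Fin M, qPoch q (q * b i / b j) (l i)) * qPoch q (b i) (l i)))

/-- The summand of the third multiple series. -/
noncomputable def thirdTerm (q : ℂ) {M : ℕ} (a : Fin (M + 1) → ℂ) (b : Fin M → ℂ) (x : ℂ)
    (l : Fin M → ℕ) : ℂ :=
  (-((∏ j, a j) * x / (a (Fin.last M) * ∏ j, b j))) ^ multiDeg l * vandermondeRatio q b l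
    * (qPoch q (a (Fin.last M)) (multiDeg l) / qPoch q (a (Fin.last M) * x) (multiDeg l))
    * ∏ i, (((∏ j : Fin M, qPoch q (b i / a j.castSucc) (l i)) * b i ^ l i
          * q ^ ((l i).choose 2))
        / ((∏ j : Fin M, qPoch q (q * b i / b j) (l i)) * qPoch q (b i) (l i)))

/-! Write c(b) = A/B, and let S_i b be b with b_i replaced by q b_i (`qShift`). With δ_i =
`lowerCoeff (hypWeight a) b i`, the function G(b, x) = `basicHyp q a b x` satisfies (1 - x) G(b, x)
- (1 - c x) G(b, q x) = c x ∑ δ_i G(S_i b, q x) (`basicHyp_relation`). Coefficientwise this is the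
partial fraction expansion of ∏ (1 - z/a_j) / (z (z - q^{-n}) ∏ (z - b_j)). The relation determines
G: if germs attached to all generic b vanish at 0 and satisfy it, and all have order at least k ≥ 1,
then comparing coefficients of x^k gives (1 - q^k) g(0) = 0 for each leading coefficient g(0), so
every order increases (`eventually_eq_zero_of_relation`). Transformations (1) and (2) follow once
their left sides are shown to satisfy the same relation with value 1 at 0; analytic continuation
removes the restriction to small x.

On the multiple-series side everything rests on `lowerCoeff_mul_multiCoeff`: the coefficient at (S_i
b, l) is an explicit rational multiple of the one at (b, l + e_i). Summing over i and over |l| = n,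
a residue sum collapses these multiples to 1 - q^{n+1} (`one_sub_mul_degSum`). For (2) this is
already the required relation.

For (1) the factors depending on |l| spoil a termwise match. The parts of degree n satisfy the
relation only up to a difference `poisedTail` (n+1) - `poisedTail` n (`poisedDegTerm_relation`), and
since the tail tends to 0, the sum satisfies it exactly. The discrepancy is computed in
`poised_recurrence`, from a partial fraction expansion with a double pole at 0 (`poised_eq_sum`).
Denominators in x are cleared by `poisedDenom`, so the continuation takes place on the whole unit
disc.

For (3), `ratio_eq_sum_degSum` expands ∏ (a_j)_n / (b_j)_n, with j ≤ M, in a terminating multiple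
sum, by induction on n from the same lowering identity. Inserting it in the series, interchanging
the two summations and applying the q-binomial theorem gives the result. The q-binomial theorem is
itself the case M = 0 of (2), freed of |αx| < 1 by iterating the relation. -/

open Filter Topology

/-! ### q-shifted factorials: bounds, nonvanishing and analyticity. -/

section QPochhammer

variable {q : ℂ}

theorem qPoch_zero (q a : ℂ) : qPoch q a 0 = 1 := by simp [qPoch]

theorem qPoch_succ (q a : ℂ) (l : ℕ) : qPoch q a (l + 1) = qPoch q a l * (1 - a * q ^ l) := by
  simp [qPoch, Finset.prod_range_succ]

theorem qPoch_succ' (q a : ℂ) (l : ℕ) : qPoch q a (l + 1) = (1 - a) * qPoch q (q * a) l := by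
  simp only [qPoch, Finset.prod_range_succ', pow_zero, mul_one]
  rw [mul_comm]
  congr 1
  exact Finset.prod_congr rfl fun i _ => by ring

theorem qPoch_ne_zero {a : ℂ} (h : ∀ k : ℕ, a * q ^ k ≠ 1) (l : ℕ) : qPoch q a l ≠ 0 :=
  Finset.prod_ne_zero_iff.mpr fun i _ => sub_ne_zero.mpr (h i).symm

theorem summable_norm_mul_pow (hq : ‖q‖ < 1) (a : ℂ) : Summable fun i : ℕ => ‖-(a * q ^ i)‖ := by
  simp only [norm_neg, norm_mul, norm_pow]
  exact (summable_geometric_of_lt_one (norm_nonneg q) hq).mul_left _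

theorem multipliable_one_sub_mul_pow (hq : ‖q‖ < 1) (a : ℂ) :
    Multipliable fun i : ℕ => 1 - a * q ^ i := by
  simpa [sub_eq_add_neg] using multipliable_one_add_of_summable (summable_norm_mul_pow hq a)

theorem tendsto_qPoch (hq : ‖q‖ < 1) (a : ℂ) :
    Tendsto (qPoch q a) atTop (𝓝 (qPochInf q a)) :=
  (multipliable_one_sub_mul_pow hq a).hasProd.tendsto_prod_nat

theorem qPoch_mul_qPochInf (hq : ‖q‖ < 1) (a : ℂ) (l : ℕ) :
    qPoch q a l * qPochInf q (a * q ^ l) = qPochInf q a := by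
  have hm : Multipliable (fun i : ℕ => 1 - a * q ^ (i + l)) :=
    (multipliable_one_sub_mul_pow hq (a * q ^ l)).congr fun i => by ring
  have key := Multipliable.prod_mul_tprod_nat_mul' (f := fun i : ℕ => 1 - a * q ^ i) hm
  refine Eq.trans ?_ key
  simp only [qPoch, qPochInf]
  congr 1
  exact tprod_congr fun i => by ring

theorem qPochInf_eq_one_sub_mul (hq : ‖q‖ < 1) (a : ℂ) :
    qPochInf q a = (1 - a) * qPochInf q (q * a) := by
  simpa [qPoch, mul_comm a q] using (qPoch_mul_qPochInf hq a 1).symm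

theorem qPochInf_ne_zero (hq : ‖q‖ < 1) {a : ℂ} (h : ∀ k : ℕ, a * q ^ k ≠ 1) :
    qPochInf q a ≠ 0 := by
  have := tprod_one_add_ne_zero_of_summable (f := fun i : ℕ => -(a * q ^ i))
    (fun i => by simpa [← sub_eq_add_neg] using sub_ne_zero.mpr (h i).symm)
    (summable_norm_mul_pow hq a)
  simpa [qPochInf, sub_eq_add_neg] using this

theorem qPochInf_zero (q : ℂ) : qPochInf q 0 = 1 := by simp [qPochInf]

theorem mul_pow_ne_one (hq : ‖q‖ < 1) {x : ℂ} (hx : ‖x‖ < 1) (k : ℕ) : x * q ^ k ≠ 1 := by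
  intro h
  have h1 : ‖x * q ^ k‖ < 1 := by
    rw [norm_mul, norm_pow]
    calc ‖x‖ * ‖q‖ ^ k ≤ ‖x‖ * 1 := by
          gcongr
          exact pow_le_one₀ (norm_nonneg q) hq.le
      _ < 1 := by simpa using hx
  rw [h, norm_one] at h1
  exact lt_irrefl _ h1

/-- `|(a)_l|` is bounded uniformly for `a` in a disc and all `l`. -/
theorem exists_norm_qPoch_le (hq : ‖q‖ < 1) (R : ℝ) :
    ∃ K : ℝ, 0 < K ∧ ∀ a : ℂ, ‖a‖ ≤ R → ∀ l, ‖qPoch q a l‖ ≤ K := by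
  refine ⟨Real.exp (∑' i : ℕ, R * ‖q‖ ^ i), Real.exp_pos _, fun a ha l => ?_⟩
  have hR : 0 ≤ R := (norm_nonneg a).trans ha
  have hs : Summable fun i : ℕ => R * ‖q‖ ^ i :=
    (summable_geometric_of_lt_one (norm_nonneg q) hq).mul_left _
  calc ‖qPoch q a l‖ = ∏ i ∈ Finset.range l, ‖1 - a * q ^ i‖ := by rw [qPoch, norm_prod]
    _ ≤ ∏ i ∈ Finset.range l, (1 + R * ‖q‖ ^ i) := by
        refine Finset.prod_le_prod (fun _ _ => norm_nonneg _) fun i _ => ?_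
        refine (norm_sub_le _ _).trans ?_
        rw [norm_one, norm_mul, norm_pow]
        gcongr
    _ ≤ Real.exp (∑ i ∈ Finset.range l, R * ‖q‖ ^ i) :=
        Real.prod_one_add_le_exp_sum _ fun i => by positivity
    _ ≤ _ := Real.exp_le_exp.mpr (hs.sum_le_tsum _ fun i _ => by positivity)

theorem exists_norm_qPochInf_le (hq : ‖q‖ < 1) (R : ℝ) :
    ∃ K : ℝ, 0 < K ∧ ∀ a : ℂ, ‖a‖ ≤ R → ‖qPochInf q a‖ ≤ K := by
  obtain ⟨K, hK, h⟩ := exists_norm_qPoch_le hq R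
  exact ⟨K, hK, fun a ha => le_of_tendsto (tendsto_qPoch hq a).norm (.of_forall (h a ha))⟩

/-- If no factor of `(a)_∞` vanishes then `1 / (a)_l` is bounded. -/
theorem exists_norm_inv_qPoch_le (hq : ‖q‖ < 1) {a : ℂ} (h : ∀ k : ℕ, a * q ^ k ≠ 1) :
    ∃ K : ℝ, 0 < K ∧ ∀ l, ‖(qPoch q a l)⁻¹‖ ≤ K := by
  have ht := ((tendsto_qPoch hq a).inv₀ (qPochInf_ne_zero hq h)).norm
  obtain ⟨K, hK⟩ := ht.bddAbove_range
  exact ⟨max K 1, by positivity, fun l => (hK ⟨l, rfl⟩).trans (le_max_left _ _)⟩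

/-- The product converges locally uniformly, so it is entire in its argument; this is what makes
both sides of the identities analytic in x. -/
theorem differentiable_qPochInf (hq : ‖q‖ < 1) : Differentiable ℂ (qPochInf q) := by
  intro z
  have hU : IsOpen (Metric.ball (0 : ℂ) (‖z‖ + 1)) := Metric.isOpen_ball
  have hs : Summable fun i : ℕ => (‖z‖ + 1) * ‖q‖ ^ i :=
    (summable_geometric_of_lt_one (norm_nonneg q) hq).mul_left _
  have key := Summable.hasProdLocallyUniformlyOn_nat_one_add
    (f := fun (i : ℕ) (x : ℂ) => -(x * q ^ i)) hU hs
    (.of_forall fun n x hx => by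
      rw [norm_neg, norm_mul, norm_pow]
      gcongr
      exact (by simpa using hx : ‖x‖ < ‖z‖ + 1).le)
    (fun n => by fun_prop)
  have hd : DifferentiableOn ℂ (fun x : ℂ => ∏' i : ℕ, (1 + -(x * q ^ i)))
      (Metric.ball (0 : ℂ) (‖z‖ + 1)) :=
    key.differentiableOn
      (.of_forall fun _ => by
        simpa [Finset.prod_fn] using DifferentiableOn.finsetProd (fun _ _ ↦ by fun_prop)) hU
  have hz : z ∈ Metric.ball (0 : ℂ) (‖z‖ + 1) := by simp
  have := hd.differentiableAt (hU.mem_nhds hz)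
  simpa only [← sub_eq_add_neg, qPochInf, funext_iff] using! this

end QPochhammer

/-! ### Residue sums of rational functions via Lagrange interpolation. -/

section Lagrange

open Polynomial

variable {ι : Type*} [Fintype ι]

theorem coeff_zero_prod_X_sub (v : ι → ℂ) :
    (∏ i, (X - C (v i))).coeff 0 = ∏ i, (-v i) := by
  simp [coeff_zero_eq_eval_zero, eval_prod]

variable [DecidableEq ι]

theorem prod_erase_some (f : Option ι → ℂ) (i : ι) :
    ∏ o ∈ Finset.univ.erase (some i), f o = f none * ∏ j ∈ Finset.univ.erase i, f (some j) := by
  have : (Finset.univ : Finset (Option ι)).erase (some i)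
      = insert none ((Finset.univ.erase i).map Function.Embedding.some) := by
    ext o
    cases o <;> simp
  rw [this, Finset.prod_insert (by simp), Finset.prod_map]
  rfl

theorem prod_erase_none (f : Option ι → ℂ) :
    ∏ o ∈ Finset.univ.erase none, f o = ∏ j, f (some j) := by
  have : (Finset.univ : Finset (Option ι)).erase none
      = Finset.univ.map Function.Embedding.some := by
    ext o
    cases o <;> simp
  rw [this, Finset.prod_map]
  rfl

/-- Sum of the residues of `P(z) / ((z - c) ∏ (z - v j))`. -/
theorem sum_residues (v : ι → ℂ) (hv : Function.Injective v) {c : ℂ} (hc : ∀ i, v i ≠ c)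
    {P : ℂ[X]} (hP : P.natDegree ≤ Fintype.card ι) :
    ∑ i, P.eval (v i) / ((v i - c) * ∏ j ∈ Finset.univ.erase i, (v i - v j))
      + P.eval c / ∏ j, (c - v j) = P.coeff (Fintype.card ι) := by
  have hinj : Function.Injective (fun o : Option ι => o.elim c v) := by
    rintro (_ | i) (_ | j) h
    · rfl
    · exact absurd h.symm (hc j)
    · exact absurd h (hc i)
    · exact congrArg some (hv h)
  -- With c adjoined there is one node more than the degree bound, so interpolation reproduces P,
  -- and its top coefficient is the divided difference. That coefficient plays the part of the
  -- residue at infinity.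
  have key := Lagrange.coeff_eq_sum (s := (Finset.univ : Finset (Option ι)))
    (v := fun o : Option ι => o.elim c v) (P := P) hinj.injOn (by
      rw [Finset.card_univ, Fintype.card_option]
      exact lt_of_le_of_lt degree_le_natDegree (by exact_mod_cast Nat.lt_succ_of_le hP))
  rw [Finset.card_univ, Fintype.card_option, Nat.add_sub_cancel, Fintype.sum_option,
    prod_erase_none] at key
  simp only [prod_erase_some, Option.elim] at key
  rw [key, add_comm]

/-- Sum of the residues of `P(z) / ((z - c) (z - d) ∏ (z - v j))`. -/
theorem sum_residues_two (v : ι → ℂ) (hv : Function.Injective v) {c d : ℂ} (hc : ∀ i, v i ≠ c)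
    (hd : ∀ i, v i ≠ d) (hcd : c ≠ d) {P : ℂ[X]} (hP : P.natDegree ≤ Fintype.card ι + 1) :
    ∑ i, P.eval (v i) / ((v i - c) * (v i - d) * ∏ j ∈ Finset.univ.erase i, (v i - v j))
      + P.eval c / ((c - d) * ∏ j, (c - v j)) + P.eval d / ((d - c) * ∏ j, (d - v j))
      = P.coeff (Fintype.card ι + 1) := by
  have hinj : Function.Injective (fun o : Option ι => o.elim d v) := by
    rintro (_ | i) (_ | j) h
    · rfl
    · exact absurd h.symm (hd j)
    · exact absurd h (hd i)
    · exact congrArg some (hv h)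
  -- The second extra pole d is treated as one more node.
  have key := sum_residues (fun o : Option ι => o.elim d v) hinj (c := c)
    (by rintro (_ | i); exacts [hcd.symm, hc i]) (P := P) (by simpa using hP)
  rw [Fintype.sum_option, prod_erase_none, Fintype.prod_option, Fintype.card_option] at key
  simp only [prod_erase_some, Option.elim] at key
  rw [← key]
  simp only [mul_assoc]
  ring

theorem coeff_one_eq_eval_derivative (P : ℂ[X]) : P.coeff 1 = P.derivative.eval 0 := by
  rw [← coeff_zero_eq_eval_zero, coeff_derivative]
  simp

theorem coeff_one_prod_X_sub (v : ι → ℂ) (hv : ∀ i, v i ≠ 0) :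
    (∏ i, (X - C (v i))).coeff 1 = -(∏ i, (-v i)) * ∑ i, (v i)⁻¹ := by
  rw [coeff_one_eq_eval_derivative, derivative_prod_finset, eval_finsetSum, Finset.mul_sum]
  refine Finset.sum_congr rfl fun i _ => ?_
  rw [← Finset.mul_prod_erase Finset.univ (fun i => -v i) (Finset.mem_univ i)]
  simp [eval_prod]
  field_simp [hv i]

/-- Sum of the residues of `P(z) / (z² ∏ (z - v j))`. -/
theorem sum_residues_double (v : ι → ℂ) (hv : Function.Injective v) (h0 : ∀ i, v i ≠ 0)
    {P : ℂ[X]} (hP : P.natDegree ≤ Fintype.card ι) :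
    ∑ i, P.eval (v i) / (v i ^ 2 * ∏ j ∈ Finset.univ.erase i, (v i - v j))
      + (P.coeff 1 + P.coeff 0 * ∑ i, (v i)⁻¹) / ∏ j, (-v j) = 0 := by
  have hpr : ∏ j, (-v j) ≠ 0 := Finset.prod_ne_zero_iff.mpr fun j _ => neg_ne_zero.mpr (h0 j)
  set N : ℂ[X] := ∏ i, (X - C (v i)) with hN
  -- Subtracting a multiple of N kills the constant term without changing the values at the nodes.
  -- Hence R is divisible by z, and the double pole becomes a simple pole for R / z.
  set R : ℂ[X] := P - C (P.coeff 0 / ∏ j, (-v j)) * N with hR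
  have hR0 : R.coeff 0 = 0 := by
    rw [hR, coeff_sub, coeff_C_mul, hN, coeff_zero_prod_X_sub]
    field_simp
    ring
  have hNd : N.natDegree = Fintype.card ι := by
    rw [hN, natDegree_prod_of_monic _ _ fun i _ => monic_X_sub_C _]
    simp
  have hRd : R.natDegree ≤ Fintype.card ι :=
    (natDegree_sub_le _ _).trans (max_le hP ((natDegree_C_mul_le _ _).trans hNd.le))
  have hRX : R = R.divX * X := by
    conv_lhs => rw [← divX_mul_X_add R, hR0]
    simp
  have hRe : ∀ i, R.divX.eval (v i) = P.eval (v i) / v i := by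
    intro i
    have h1 : R.eval (v i) = P.eval (v i) := by
      have : N.eval (v i) = 0 := by
        rw [hN, eval_prod]
        exact Finset.prod_eq_zero (Finset.mem_univ i) (by simp)
      simp [hR, this]
    rw [← h1, eq_div_iff (h0 i)]
    conv_rhs => rw [hRX]
    simp
  have hlt : (R.divX).coeff (Fintype.card ι) = 0 := by
    rw [coeff_divX]
    exact coeff_eq_zero_of_natDegree_lt (by omega)
  have key := sum_residues v hv (c := 0) h0 (P := R.divX)
    (by rw [natDegree_divX_eq_natDegree_tsub_one]; omega)
  rw [hlt] at key
  rw [← key]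
  congr 1
  · refine Finset.sum_congr rfl fun i _ => ?_
    rw [hRe, sub_zero, div_div, pow_two]
    ring_nf
  · rw [← coeff_zero_eq_eval_zero, coeff_divX, hR, coeff_sub, coeff_C_mul, hN,
      zero_add, coeff_one_prod_X_sub v h0]
    simp only [zero_sub]
    field_simp
    ring

end Lagrange

/-! ### Generic lower parameters, their shifts, and Vandermonde products. -/

section Shift

/-- The parameters obtained from `b` by replacing `b_i` with `q b_i`. -/
noncomputable def qShift (q : ℂ) {M : ℕ} (b : Fin M → ℂ) (i : Fin M) : Fin M → ℂ :=
  Function.update b i (q * b i)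

/-- The genericity conditions on the lower parameters. -/
structure QGeneric (q : ℂ) {M : ℕ} (b : Fin M → ℂ) : Prop where
  ne_zero : ∀ i, b i ≠ 0
  mul_pow_ne_one : ∀ i, ∀ k : ℕ, b i * q ^ k ≠ 1
  mul_pow_ne : ∀ i j, i ≠ j → ∀ k : ℕ, b i * q ^ k ≠ b j

/-- `∏_{0 ≤ s < n} κ(z q^s)`. -/
noncomputable def shiftProd (q : ℂ) (κ : ℂ → ℂ) (z : ℂ) (n : ℕ) : ℂ :=
  ∏ s ∈ Finset.range n, κ (z * q ^ s)

/-- The coefficient of a multiple basic hypergeometric series of type `A` whose one-variable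
factors are the products `∏_s κ(b_i q^s)`. -/
noncomputable def multiCoeff (q : ℂ) (κ : ℂ → ℂ) {M : ℕ} (b : Fin M → ℂ) (l : Fin M → ℕ) : ℂ :=
  vandermondeRatio q b l * ∏ i, (shiftProd q κ (b i) (l i) / ∏ j, qPoch q (q * b i / b j) (l i))

/-- The coefficient of the `i`-th shift in the difference operator lowering `multiCoeff`. -/
noncomputable def lowerCoeff (κ : ℂ → ℂ) {M : ℕ} (b : Fin M → ℂ) (i : Fin M) : ℂ :=
  κ (b i) * ∏ j ∈ Finset.univ.erase i, b j / (b j - b i)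

variable {q : ℂ} {M : ℕ} {b : Fin M → ℂ}

theorem qShift_self (b : Fin M → ℂ) (i : Fin M) : qShift q b i i = q * b i := by simp [qShift]

theorem qShift_of_ne (b : Fin M → ℂ) {i j : Fin M} (h : j ≠ i) : qShift q b i j = b j := by
  simp [qShift, h]

theorem prod_qShift (b : Fin M → ℂ) (i : Fin M) : ∏ j, qShift q b i j = q * ∏ j, b j := by
  rw [← Finset.mul_prod_erase _ _ (Finset.mem_univ i), ← Finset.mul_prod_erase _ b
    (Finset.mem_univ i), qShift_self, mul_assoc]
  congr 2
  exact Finset.prod_congr rfl fun j hj => qShift_of_ne b (Finset.ne_of_mem_erase hj)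

theorem qShift_mul_pow (b : Fin M → ℂ) (i : Fin M) (l : Fin M → ℕ) (j : Fin M) :
    qShift q b i j * q ^ l j = b j * q ^ (l + Pi.single i 1 : Fin M → ℕ) j := by
  rcases eq_or_ne j i with rfl | h
  · simp [qShift_self, pow_succ]; ring
  · simp [qShift_of_ne b h, h]

/-- Stability under shifts is essential: recurrences and uniqueness are statements about all generic
parameters at once. -/
theorem QGeneric.shift (hb : QGeneric q b) (hq : q ≠ 0) (i : Fin M) :
    QGeneric q (qShift q b i) where
  ne_zero j := by
    rcases eq_or_ne j i with rfl | h
    · simpa [qShift_self] using ⟨hq, hb.ne_zero j⟩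
    · simpa [qShift_of_ne b h] using hb.ne_zero j
  mul_pow_ne_one j k := by
    rcases eq_or_ne j i with rfl | h
    · have := hb.mul_pow_ne_one j (k + 1)
      rw [qShift_self]
      convert this using 1
      ring
    · simpa [qShift_of_ne b h] using hb.mul_pow_ne_one j k
  mul_pow_ne j m hjm k := by
    rcases eq_or_ne j i with rfl | h
    · have := hb.mul_pow_ne j m hjm (k + 1)
      rw [qShift_self, qShift_of_ne b hjm.symm]
      convert this using 1
      ring
    · rw [qShift_of_ne b h]
      rcases eq_or_ne m i with rfl | h'
      · rw [qShift_self]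
        -- Here the shifted parameter is on the right. For k = 0 the hypothesis is used with the two
        -- indices exchanged; for larger k one factor q cancels.
        rcases k with _ | k
        · have := hb.mul_pow_ne m j hjm.symm 1
          simpa [mul_comm, eq_comm] using this
        · intro hk
          refine hb.mul_pow_ne j m hjm k (mul_left_cancel₀ hq ?_)
          rw [← hk]
          ring
      · rw [qShift_of_ne b h']
        exact hb.mul_pow_ne j m hjm k

theorem QGeneric.mul_pow_injective (hb : QGeneric q b) (hq : q ≠ 0) (l : Fin M → ℕ) :
    Function.Injective fun i => b i * q ^ l i := by
  have aux : ∀ i j, i ≠ j → l j ≤ l i → b i * q ^ l i ≠ b j * q ^ l j := by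
    intro i j hij hl h
    refine hb.mul_pow_ne i j hij (l i - l j) (mul_right_cancel₀ (pow_ne_zero (l j) hq) ?_)
    rw [mul_assoc, ← pow_add, Nat.sub_add_cancel hl, h]
  intro i j h
  by_contra hij
  rcases le_total (l j) (l i) with hl | hl
  · exact aux i j hij hl h
  · exact aux j i (Ne.symm hij) hl h.symm

theorem QGeneric.injective (hb : QGeneric q b) : Function.Injective b := fun i j h => by
  by_contra hij
  exact hb.mul_pow_ne i j hij 0 (by simpa using h)

theorem vandermondeProd_split (x : Fin M → ℂ) (i : Fin M) :
    vandermondeProd x = (∏ j ∈ Finset.Iio i, (x j - x i)) * (∏ j ∈ Finset.Ioi i, (x i - x j))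
      * ∏ k ∈ Finset.univ.erase i, ∏ j ∈ (Finset.Ioi k).erase i, (x k - x j) := by
  have h1 : ∀ k ∈ Finset.univ.erase i, ∏ j ∈ Finset.Ioi k, (x k - x j)
      = (if k < i then x k - x i else 1) * ∏ j ∈ (Finset.Ioi k).erase i, (x k - x j) := by
    intro k _
    split_ifs with h
    · rw [Finset.mul_prod_erase _ (fun j => x k - x j) (Finset.mem_Ioi.mpr h)]
    · rw [Finset.erase_eq_of_notMem (by simpa using h), one_mul]
  rw [vandermondeProd, ← Finset.mul_prod_erase _ _ (Finset.mem_univ i),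
    Finset.prod_congr rfl h1, Finset.prod_mul_distrib, ← Finset.prod_filter]
  have h2 : (Finset.univ.erase i).filter (· < i) = Finset.Iio i := by
    ext k
    simp only [Finset.mem_filter, Finset.mem_erase, Finset.mem_univ, and_true, Finset.mem_Iio]
    exact ⟨fun h => h.2, fun h => ⟨h.ne, h⟩⟩
  rw [h2]
  ring

theorem prod_erase_eq_Iio_mul_Ioi (f : Fin M → ℂ) (i : Fin M) :
    ∏ j ∈ Finset.univ.erase i, f j = (∏ j ∈ Finset.Iio i, f j) * ∏ j ∈ Finset.Ioi i, f j := by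
  rw [← Finset.prod_union (Finset.disjoint_left.mpr fun j h h' =>
    lt_asymm (Finset.mem_Iio.mp h) (Finset.mem_Ioi.mp h'))]
  congr 1
  ext j
  simp [lt_or_lt_iff_ne]

/-- Only the factors containing the i-th coordinate change. The signs forced by the ordering of the
indices are the same on both sides, and the cross-multiplied form needs no distinctness. -/
theorem vandermondeProd_update (x : Fin M → ℂ) (i : Fin M) (z : ℂ) :
    vandermondeProd (Function.update x i z) * ∏ j ∈ Finset.univ.erase i, (x i - x j)
      = vandermondeProd x * ∏ j ∈ Finset.univ.erase i, (z - x j) := by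
  have hE : ∀ k ∈ Finset.univ.erase i, ∏ j ∈ (Finset.Ioi k).erase i,
      (Function.update x i z k - Function.update x i z j)
      = ∏ j ∈ (Finset.Ioi k).erase i, (x k - x j) := by
    intro k hk
    refine Finset.prod_congr rfl fun j hj => ?_
    rw [Function.update_of_ne (Finset.ne_of_mem_erase hk),
      Function.update_of_ne (Finset.ne_of_mem_erase hj)]
  have hI : ∏ j ∈ Finset.Iio i, (Function.update x i z j - Function.update x i z i)
      = ∏ j ∈ Finset.Iio i, (x j - z) := by
    refine Finset.prod_congr rfl fun j hj => ?_
    rw [Function.update_self, Function.update_of_ne (Finset.mem_Iio.mp hj).ne]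
  have hJ : ∏ j ∈ Finset.Ioi i, (Function.update x i z i - Function.update x i z j)
      = ∏ j ∈ Finset.Ioi i, (z - x j) := by
    refine Finset.prod_congr rfl fun j hj => ?_
    rw [Function.update_self, Function.update_of_ne (Finset.mem_Ioi.mp hj).ne']
  have hsw : (∏ j ∈ Finset.Iio i, (x j - z)) * ∏ j ∈ Finset.Iio i, (x i - x j)
      = (∏ j ∈ Finset.Iio i, (x j - x i)) * ∏ j ∈ Finset.Iio i, (z - x j) := by
    rw [← Finset.prod_mul_distrib, ← Finset.prod_mul_distrib]
    exact Finset.prod_congr rfl fun j _ => by ring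
  rw [vandermondeProd_split _ i, vandermondeProd_split x i, hI, hJ, Finset.prod_congr rfl hE,
    prod_erase_eq_Iio_mul_Ioi (fun j => x i - x j),
    prod_erase_eq_Iio_mul_Ioi (fun j => z - x j)]
  linear_combination (∏ j ∈ Finset.Ioi i, (z - x j)) * (∏ j ∈ Finset.Ioi i, (x i - x j))
    * (∏ k ∈ Finset.univ.erase i, ∏ j ∈ (Finset.Ioi k).erase i, (x k - x j)) * hsw

theorem vandermondeProd_ne_zero {x : Fin M → ℂ} (hx : Function.Injective x) :
    vandermondeProd x ≠ 0 :=
  Finset.prod_ne_zero_iff.mpr fun _ _ => Finset.prod_ne_zero_iff.mpr fun _ hj =>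
    sub_ne_zero.mpr (hx.ne (Finset.mem_Ioi.mp hj).ne)

end Shift

/-! ### How the multiple-series coefficients change under shifts of b and of l. -/

section MultiCoeff

variable {q : ℂ} {M : ℕ} {b : Fin M → ℂ}

theorem shiftProd_succ (κ : ℂ → ℂ) (z : ℂ) (n : ℕ) :
    shiftProd q κ z (n + 1) = shiftProd q κ z n * κ (z * q ^ n) := Finset.prod_range_succ _ _

theorem shiftProd_succ' (κ : ℂ → ℂ) (z : ℂ) (n : ℕ) :
    shiftProd q κ z (n + 1) = κ z * shiftProd q κ (q * z) n := by
  simp only [shiftProd, Finset.prod_range_succ', pow_zero, mul_one]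
  rw [mul_comm]
  congr 1
  exact Finset.prod_congr rfl fun i _ => by ring_nf

theorem pow_succ_ne_one (hq1 : ‖q‖ < 1) (k : ℕ) : q * q ^ k ≠ 1 := mul_pow_ne_one hq1 hq1 k

theorem QGeneric.div_mul_pow_ne_one (hb : QGeneric q b) (hq1 : ‖q‖ < 1) (i j : Fin M) (k : ℕ) :
    q * b i / b j * q ^ k ≠ 1 := by
  rcases eq_or_ne i j with rfl | h
  · rw [mul_div_assoc, div_self (hb.ne_zero i), mul_one]
    exact pow_succ_ne_one hq1 k
  · intro h1
    refine hb.mul_pow_ne i j h (k + 1) ?_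
    rw [div_mul_eq_mul_div, div_eq_one_iff_eq (hb.ne_zero j)] at h1
    rw [← h1]
    ring

theorem QGeneric.denom_ne_zero (hb : QGeneric q b) (hq1 : ‖q‖ < 1) (i : Fin M) (n : ℕ) :
    ∏ j, qPoch q (q * b i / b j) n ≠ 0 :=
  Finset.prod_ne_zero_iff.mpr fun j _ => qPoch_ne_zero (hb.div_mul_pow_ne_one hq1 i j) n

theorem QGeneric.denom_shift_self (hb : QGeneric q b) (hq : q ≠ 0) (i : Fin M) (n : ℕ) :
    ∏ j, qPoch q (q * b i / b j) (n + 1)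
      = (∏ j, qPoch q (q * qShift q b i i / qShift q b i j) n) * (1 - q ^ (n + 1))
        * ∏ j ∈ Finset.univ.erase i, (1 - q * b i / b j) := by
  rw [← Finset.mul_prod_erase _ _ (Finset.mem_univ i), ← Finset.mul_prod_erase _
    (fun j => qPoch q (q * qShift q b i i / qShift q b i j) n) (Finset.mem_univ i)]
  have h1 : ∏ j ∈ Finset.univ.erase i, qPoch q (q * b i / b j) (n + 1)
      = (∏ j ∈ Finset.univ.erase i, qPoch q (q * qShift q b i i / qShift q b i j) n)
        * ∏ j ∈ Finset.univ.erase i, (1 - q * b i / b j) := by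
    rw [← Finset.prod_mul_distrib]
    refine Finset.prod_congr rfl fun j hj => ?_
    rw [qPoch_succ', qShift_self, qShift_of_ne b (Finset.ne_of_mem_erase hj), mul_comm,
      mul_div_assoc q (q * b i)]
  rw [h1, mul_div_assoc, div_self (hb.ne_zero i), qPoch_succ, qShift_self, mul_div_assoc,
    div_self (mul_ne_zero hq (hb.ne_zero i)), mul_one]
  ring

/-- Only the factor j = i is affected, and (b_m/b_i)_{n+1} can be split at its first or at its last
factor. -/
theorem denom_shift_of_ne (b : Fin M → ℂ) (hq : q ≠ 0) {i m : Fin M} (hm : m ≠ i)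
    (n : ℕ) :
    (∏ j, qPoch q (q * qShift q b i m / qShift q b i j) n) * (1 - b m / b i * q ^ n)
      = (∏ j, qPoch q (q * b m / b j) n) * (1 - b m / b i) := by
  rw [← Finset.mul_prod_erase _ _ (Finset.mem_univ i), ← Finset.mul_prod_erase _
    (fun j => qPoch q (q * b m / b j) n) (Finset.mem_univ i)]
  have h1 : ∏ j ∈ Finset.univ.erase i, qPoch q (q * qShift q b i m / qShift q b i j) n
      = ∏ j ∈ Finset.univ.erase i, qPoch q (q * b m / b j) n := by
    refine Finset.prod_congr rfl fun j hj => ?_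
    rw [qShift_of_ne b hm, qShift_of_ne b (Finset.ne_of_mem_erase hj)]
  have h2 : qPoch q (q * qShift q b i m / qShift q b i i) n * (1 - b m / b i * q ^ n)
      = qPoch q (q * b m / b i) n * (1 - b m / b i) := by
    rw [qShift_self, qShift_of_ne b hm, mul_div_mul_left _ _ hq, ← qPoch_succ, qPoch_succ',
      mul_comm, mul_div_assoc]
  rw [h1]
  linear_combination (∏ j ∈ Finset.univ.erase i, qPoch q (q * b m / b j) n) * h2

theorem QGeneric.sub_ne_zero (hb : QGeneric q b) {i j : Fin M} (h : i ≠ j) : b i - b j ≠ 0 :=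
  _root_.sub_ne_zero.mpr (hb.injective.ne h)

theorem QGeneric.mul_sub_ne_zero (hb : QGeneric q b) {i j : Fin M} (h : i ≠ j) :
    q * b i - b j ≠ 0 := by
  have := hb.mul_pow_ne i j h 1
  rw [pow_one, mul_comm] at this
  exact _root_.sub_ne_zero.mpr this

/-- The points b_j q^{l_j} built from (S_i b, l) are those built from (b, l + e_i), so the two
Vandermonde numerators agree and only b-dependent factors and denominators have to be compared. The
weight κ enters only through its first factor κ(b_i), which `lowerCoeff` supplies. The remaining
rational factor does not depend on κ and has the shape of a residue at z = b_i. -/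
theorem lowerCoeff_mul_multiCoeff (hb : QGeneric q b) (hq : q ≠ 0) (hq1 : ‖q‖ < 1) (κ : ℂ → ℂ)
    (i : Fin M) (l : Fin M → ℕ) :
    lowerCoeff κ b i * multiCoeff q κ (qShift q b i) l
      = multiCoeff q κ b (l + Pi.single i 1) * ((1 - q ^ (l i + 1))
        * ∏ j ∈ Finset.univ.erase i, (b i - q ^ l j * b j) / (b i - b j)) := by
  have hb' := hb.shift hq i
  set l' : Fin M → ℕ := l + Pi.single i 1 with hl'
  set y : Fin M → ℂ := fun j => b j * q ^ l' j with hy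
  have hV : vandermondeRatio q (qShift q b i) l = vandermondeRatio q b l'
      * ∏ j ∈ Finset.univ.erase i, (b i - b j) / (q * b i - b j) := by
    have h1 := vandermondeProd_update b i (q * b i)
    have h2 : vandermondeProd (qShift q b i) ≠ 0 := vandermondeProd_ne_zero hb'.injective
    have h3 : vandermondeProd b ≠ 0 := vandermondeProd_ne_zero hb.injective
    have h4 : ∏ j ∈ Finset.univ.erase i, (q * b i - b j) ≠ 0 :=
      Finset.prod_ne_zero_iff.mpr fun j hj =>
        hb.mul_sub_ne_zero (Finset.ne_of_mem_erase hj).symm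
    rw [vandermondeRatio, vandermondeRatio, Finset.prod_div_distrib,
      funext (qShift_mul_pow b i l), div_mul_div_comm, div_eq_div_iff h2 (mul_ne_zero h3 h4)]
    change vandermondeProd (qShift q b i) * _ = _ at h1
    linear_combination -vandermondeProd y * h1
  have hi : κ (b i) * (shiftProd q κ (qShift q b i i) (l i)
        / ∏ j, qPoch q (q * qShift q b i i / qShift q b i j) (l i))
      = shiftProd q κ (b i) (l i + 1) / (∏ j, qPoch q (q * b i / b j) (l i + 1))
        * (1 - q ^ (l i + 1)) * ∏ j ∈ Finset.univ.erase i, (1 - q * b i / b j) := by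
    have h1 := hb.denom_shift_self hq i (l i)
    have h2 := hb.denom_ne_zero hq1 i (l i + 1)
    have h3 := hb'.denom_ne_zero hq1 i (l i)
    rw [shiftProd_succ', show shiftProd q κ (q * b i) (l i) = shiftProd q κ (qShift q b i i) (l i) by
      rw [qShift_self], mul_div_assoc', div_mul_eq_mul_div,
      div_mul_eq_mul_div, div_eq_div_iff h3 h2, h1]
    ring
  have hm : ∀ m ∈ Finset.univ.erase i, shiftProd q κ (qShift q b i m) (l m)
        / ∏ j, qPoch q (q * qShift q b i m / qShift q b i j) (l m)
      = shiftProd q κ (b m) (l' m)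
        / (∏ j, qPoch q (q * b m / b j) (l' m))
        * ((1 - b m / b i * q ^ l m) / (1 - b m / b i)) := by
    intro m hm
    have hmi := Finset.ne_of_mem_erase hm
    have h1 := denom_shift_of_ne b hq hmi (l m)
    have h2 := hb.denom_ne_zero hq1 m (l m)
    have h3 := hb'.denom_ne_zero hq1 m (l m)
    have h4 : 1 - b m / b i ≠ 0 := by
      rw [one_sub_div (hb.ne_zero i)]
      exact div_ne_zero (hb.sub_ne_zero hmi.symm) (hb.ne_zero i)
    have h5 : l' m = l m := by simp [hl', hmi]
    rw [h5, qShift_of_ne b hmi, div_mul_div_comm, div_eq_div_iff (by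
      rwa [qShift_of_ne b hmi] at h3) (mul_ne_zero h2 h4)]
    rw [qShift_of_ne b hmi] at h1
    linear_combination -shiftProd q κ (b m) (l m) * h1
  have hfac : (∏ j ∈ Finset.univ.erase i, b j / (b j - b i))
      * (∏ j ∈ Finset.univ.erase i, (b i - b j) / (q * b i - b j))
      * (∏ j ∈ Finset.univ.erase i, (1 - q * b i / b j))
      * (∏ j ∈ Finset.univ.erase i, (1 - b j / b i * q ^ l j) / (1 - b j / b i))
      = ∏ j ∈ Finset.univ.erase i, (b i - q ^ l j * b j) / (b i - b j) := by
    rw [← Finset.prod_mul_distrib, ← Finset.prod_mul_distrib, ← Finset.prod_mul_distrib]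
    refine Finset.prod_congr rfl fun j hj => ?_
    have hij := Finset.ne_of_mem_erase hj
    have h1 := hb.sub_ne_zero hij
    have h2 := hb.sub_ne_zero hij.symm
    have h3 := hb.mul_sub_ne_zero hij.symm
    have h4 := hb.ne_zero i
    have h5 := hb.ne_zero j
    have h6 : b i * q - b j ≠ 0 := by rwa [mul_comm]
    rw [one_sub_div h4, one_sub_div h5]
    field_simp
    ring
  have hli : l' i = l i + 1 := by simp [hl']
  rw [multiCoeff, multiCoeff, lowerCoeff, hV, ← Finset.mul_prod_erase _ _ (Finset.mem_univ i),
    ← Finset.mul_prod_erase _ (fun m => shiftProd q κ (b m) (l' m)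
      / ∏ j, qPoch q (q * b m / b j) (l' m)) (Finset.mem_univ i),
    Finset.prod_congr rfl hm, Finset.prod_mul_distrib, ← hfac, hli]
  linear_combination vandermondeRatio q b l'
    * (∏ j ∈ Finset.univ.erase i, b j / (b j - b i))
    * (∏ j ∈ Finset.univ.erase i, (b i - b j) / (q * b i - b j))
    * (∏ m ∈ Finset.univ.erase i, shiftProd q κ (b m) (l' m)
        / (∏ j, qPoch q (q * b m / b j) (l' m)))
    * (∏ m ∈ Finset.univ.erase i, (1 - b m / b i * q ^ l m) / (1 - b m / b i)) * hi

/-- The companion step with b held fixed, expressed in the points y_j = b_j q^{l_j}; it is needed to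
compare consecutive degrees of the well-poised series. -/
theorem multiCoeff_add_single (hb : QGeneric q b) (hq : q ≠ 0) (κ : ℂ → ℂ)
    (i : Fin M) (l : Fin M → ℕ) :
    multiCoeff q κ b (l + Pi.single i 1) = multiCoeff q κ b l * κ (b i * q ^ l i)
      * (∏ j ∈ Finset.univ.erase i,
          (q * (b i * q ^ l i) - b j * q ^ l j) / (b i * q ^ l i - b j * q ^ l j))
      * ∏ j, b j / (b j - q * (b i * q ^ l i)) := by
  set y : Fin M → ℂ := fun j => b j * q ^ l j with hy
  have hyinj : Function.Injective y := hb.mul_pow_injective hq l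
  have hy' : (fun j => b j * q ^ (l + Pi.single i 1 : Fin M → ℕ) j)
      = Function.update y i (q * y i) := by
    funext j
    rcases eq_or_ne j i with rfl | h
    · simp [hy, pow_succ]; ring
    · simp [hy, h]
  have hne : ∏ j ∈ Finset.univ.erase i, (y i - y j) ≠ 0 :=
    Finset.prod_ne_zero_iff.mpr fun j hj =>
      _root_.sub_ne_zero.mpr (hyinj.ne (Finset.ne_of_mem_erase hj).symm)
  have hV : vandermondeRatio q b (l + Pi.single i 1) = vandermondeRatio q b l
      * ∏ j ∈ Finset.univ.erase i, (q * y i - y j) / (y i - y j) := by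
    rw [vandermondeRatio, vandermondeRatio, hy', Finset.prod_div_distrib, div_mul_div_comm,
      mul_comm (vandermondeProd b), ← div_div]
    congr 1
    rw [eq_div_iff hne, vandermondeProd_update]
  have hD : (∏ j, qPoch q (q * b i / b j) (l i + 1))⁻¹ = (∏ j, qPoch q (q * b i / b j) (l i))⁻¹
      * ∏ j, b j / (b j - q * y i) := by
    rw [← Finset.prod_inv_distrib, ← Finset.prod_inv_distrib, ← Finset.prod_mul_distrib]
    refine Finset.prod_congr rfl fun j _ => ?_
    have h1 := hb.ne_zero j
    rw [qPoch_succ, mul_inv, ← inv_div (b j - q * y i)]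
    congr 2
    rw [sub_div, div_self h1, hy]
    ring
  have hli : (l + Pi.single i 1 : Fin M → ℕ) i = l i + 1 := by simp
  have hm : ∏ m ∈ Finset.univ.erase i, shiftProd q κ (b m) ((l + Pi.single i 1 : Fin M → ℕ) m)
        / ∏ j, qPoch q (q * b m / b j) ((l + Pi.single i 1 : Fin M → ℕ) m)
      = ∏ m ∈ Finset.univ.erase i, shiftProd q κ (b m) (l m)
        / ∏ j, qPoch q (q * b m / b j) (l m) := by
    refine Finset.prod_congr rfl fun m hm => ?_
    have h5 : (l + Pi.single i 1 : Fin M → ℕ) m = l m := by simp [Finset.ne_of_mem_erase hm]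
    rw [h5]
  rw [multiCoeff, multiCoeff, hV, ← Finset.mul_prod_erase _ _ (Finset.mem_univ i), hm, hli,
    shiftProd_succ, div_eq_mul_inv (shiftProd q κ (b i) (l i) * _), hD,
    ← Finset.mul_prod_erase _ (fun m => shiftProd q κ (b m) (l m)
        / ∏ j, qPoch q (q * b m / b j) (l m)) (Finset.mem_univ i)]
  ring

end MultiCoeff

/-! ### Lowering identities for the sums over |l| = n. -/

section DegreeSums

open Polynomial

variable {q : ℂ} {M : ℕ} {b : Fin M → ℂ}

/-- The sum over `|l| = n` of the coefficients `multiCoeff`, weighted with a function of the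
points `b_i q^{l_i}`. -/
noncomputable def degSum (q : ℂ) (κ : ℂ → ℂ) {M : ℕ} (b : Fin M → ℂ) (Φ : (Fin M → ℂ) → ℂ)
    (n : ℕ) : ℂ :=
  ∑ l ∈ Finset.piAntidiag Finset.univ n, multiCoeff q κ b l * Φ fun j => b j * q ^ l j

theorem mem_piAntidiag_univ {l : Fin M → ℕ} {n : ℕ} :
    l ∈ Finset.piAntidiag Finset.univ n ↔ multiDeg l = n := by
  simp [multiDeg]

/-- For fixed i, the map l ↦ l + e_i hits exactly the indices with l_i > 0; the hypothesis on g
discards the others. -/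
theorem sum_piAntidiag_succ (g : (Fin M → ℕ) → Fin M → ℂ) (hg : ∀ l i, l i = 0 → g l i = 0)
    (n : ℕ) :
    ∑ l ∈ Finset.piAntidiag Finset.univ (n + 1), ∑ i, g l i
      = ∑ l ∈ Finset.piAntidiag Finset.univ n, ∑ i, g (l + Pi.single i 1) i := by
  rw [Finset.sum_comm, Finset.sum_comm (s := Finset.piAntidiag Finset.univ n)]
  refine Finset.sum_congr rfl fun i _ => ?_
  refine (Eq.trans (Finset.sum_map (Finset.piAntidiag Finset.univ n)
    (addRightEmbedding (Pi.single i 1)) fun l => g l i).symm ?_).symm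
  refine Finset.sum_subset (fun l hl => ?_) fun l hl hl' => hg l i ?_
  · obtain ⟨l', hl', rfl⟩ := Finset.mem_map.mp hl
    rw [mem_piAntidiag_univ] at hl' ⊢
    simp [multiDeg, Finset.sum_add_distrib, ← hl']
  · by_contra h0
    refine hl' (Finset.mem_map.mpr ⟨l - Pi.single i 1, ?_, ?_⟩)
    · rw [mem_piAntidiag_univ] at hl ⊢
      have h1 : l - Pi.single i 1 + Pi.single i 1 = l := by
        funext j
        rcases eq_or_ne j i with rfl | h
        · simp; omega
        · simp [h]
      have h2 : multiDeg (l - Pi.single i 1 + Pi.single i 1)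
          = multiDeg (l - Pi.single i 1) + 1 := by
        simp [multiDeg, Finset.sum_add_distrib]
      rw [h1, hl] at h2
      omega
    · funext j
      rcases eq_or_ne j i with rfl | h
      · simp [addRightEmbedding]; omega
      · simp [addRightEmbedding, h]

theorem eval_prod_X_sub_at_node (y b : Fin M → ℂ) (i : Fin M) :
    (∏ j, (X - C (y j))).eval (b i) = (b i - y i) * ∏ j ∈ Finset.univ.erase i, (b i - y j) := by
  rw [Finset.mul_prod_erase Finset.univ (fun j => b i - y j) (Finset.mem_univ i)]
  simp [eval_prod]

theorem natDegree_prod_X_sub (y : Fin M → ℂ) : (∏ j, (X - C (y j))).natDegree = M := by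
  rw [natDegree_prod_of_monic _ _ fun i _ => monic_X_sub_C _]
  simp

theorem prod_neg_div (y b : Fin M → ℂ) : (∏ j, (-y j)) / ∏ j, (-b j) = (∏ j, y j) / ∏ j, b j := by
  rw [← Finset.prod_div_distrib, ← Finset.prod_div_distrib]
  simp only [neg_div_neg_eq]

/-- Residues of ∏ (z - y_j) / (z ∏ (z - b_j)): the pole at 0 gives the ratio of products, the
behaviour at infinity gives 1. -/
theorem sum_sub_div_prod (hinj : Function.Injective b) (h0 : ∀ i, b i ≠ 0) (y : Fin M → ℂ) :
    ∑ i, (1 - y i / b i) * ∏ j ∈ Finset.univ.erase i, (b i - y j) / (b i - b j)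
      = 1 - (∏ j, y j) / ∏ j, b j := by
  have key := sum_residues b hinj (c := 0) h0 (P := ∏ j, (X - C (y j)))
    (by rw [natDegree_prod_X_sub, Fintype.card_fin])
  have hlead : (∏ j, (X - C (y j))).coeff (Fintype.card (Fin M)) = 1 := by
    have := (monic_prod_of_monic Finset.univ (fun j => X - C (y j))
      fun i _ => monic_X_sub_C _).coeff_natDegree
    rw [natDegree_prod_X_sub] at this
    rwa [Fintype.card_fin]
  rw [hlead, ← coeff_zero_eq_eval_zero, coeff_zero_prod_X_sub] at key
  simp only [zero_sub] at key
  rw [prod_neg_div] at key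
  rw [← eq_sub_iff_add_eq] at key
  rw [← key]
  refine Finset.sum_congr rfl fun i _ => ?_
  rw [eval_prod_X_sub_at_node, Finset.prod_div_distrib, sub_zero, one_sub_div (h0 i),
    div_mul_div_comm]

/-- The extra division by b_i makes the pole at 0 double. Its residue is a logarithmic derivative,
whence the reciprocal sums, and there is no contribution from infinity. -/
theorem sum_sub_div_prod_div (hinj : Function.Injective b) (h0 : ∀ i, b i ≠ 0) (y : Fin M → ℂ)
    (hy : ∀ i, y i ≠ 0) :
    ∑ i, (1 - y i / b i) * (∏ j ∈ Finset.univ.erase i, (b i - y j) / (b i - b j)) / b i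
      = (∏ j, y j) / (∏ j, b j) * (∑ j, (y j)⁻¹ - ∑ j, (b j)⁻¹) := by
  have key := sum_residues_double b hinj h0 (P := ∏ j, (X - C (y j)))
    (by rw [natDegree_prod_X_sub, Fintype.card_fin])
  rw [coeff_one_prod_X_sub y hy, coeff_zero_prod_X_sub] at key
  have h1 : (-(∏ j, (-y j)) * ∑ j, (y j)⁻¹ + (∏ j, (-y j)) * ∑ j, (b j)⁻¹) / ∏ j, (-b j)
      = -((∏ j, y j) / (∏ j, b j) * (∑ j, (y j)⁻¹ - ∑ j, (b j)⁻¹)) := by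
    rw [← prod_neg_div]
    ring
  rw [h1, ← sub_eq_add_neg, sub_eq_zero] at key
  rw [← key]
  refine Finset.sum_congr rfl fun i _ => ?_
  have hi := h0 i
  rw [eval_prod_X_sub_at_node, Finset.prod_div_distrib, one_sub_div hi]
  field_simp

theorem prod_mul_pow_div (hb : QGeneric q b) (l : Fin M → ℕ) :
    (∏ j, b j * q ^ l j) / ∏ j, b j = q ^ multiDeg l := by
  have : ∏ j, b j ≠ 0 := Finset.prod_ne_zero_iff.mpr fun j _ => hb.ne_zero j
  rw [Finset.prod_mul_distrib, mul_div_cancel_left₀ _ this, Finset.prod_pow_eq_pow_sum, multiDeg]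

/-- Since the points are unchanged when (S_i b, l) is replaced by (b, l + e_i), an arbitrary
function Φ of them can be carried along. -/
theorem lowerCoeff_mul_weighted (hb : QGeneric q b) (hq : q ≠ 0) (hq1 : ‖q‖ < 1) (κ : ℂ → ℂ)
    (i : Fin M) (l : Fin M → ℕ) (Φ : (Fin M → ℂ) → ℂ) :
    lowerCoeff κ b i * (multiCoeff q κ (qShift q b i) l * Φ fun j => qShift q b i j * q ^ l j)
      = (fun l : Fin M → ℕ => fun i => multiCoeff q κ b l * (Φ fun j => b j * q ^ l j)
        * ((1 - b i * q ^ l i / b i) * ∏ j ∈ Finset.univ.erase i,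
          (b i - b j * q ^ l j) / (b i - b j))) (l + Pi.single i 1) i := by
  have h := lowerCoeff_mul_multiCoeff hb hq hq1 κ i l
  have h1 : ∏ j ∈ Finset.univ.erase i,
        (b i - b j * q ^ (l + Pi.single i 1 : Fin M → ℕ) j) / (b i - b j)
      = ∏ j ∈ Finset.univ.erase i, (b i - q ^ l j * b j) / (b i - b j) := by
    refine Finset.prod_congr rfl fun j hj => ?_
    simp [Finset.ne_of_mem_erase hj, mul_comm]
  have h2 : b i * q ^ (l + Pi.single i 1 : Fin M → ℕ) i / b i = q ^ (l i + 1) := by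
    rw [mul_div_cancel_left₀ _ (hb.ne_zero i)]
    simp
  simp only [h1, h2]
  rw [funext (qShift_mul_pow b i l)]
  linear_combination (Φ fun j => b j * q ^ (l + Pi.single i 1 : Fin M → ℕ) j) * h

/-- Summing the lowering identity over i leaves the factor 1 - ∏ y_j / ∏ b_j, and with y_j = b_j
q^{l_j} this depends on l only through |l|. -/
theorem one_sub_mul_degSum (hb : QGeneric q b) (hq : q ≠ 0) (hq1 : ‖q‖ < 1) (κ : ℂ → ℂ)
    (Φ : (Fin M → ℂ) → ℂ) (n : ℕ) :
    (1 - q ^ (n + 1)) * degSum q κ b Φ (n + 1)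
      = ∑ i, lowerCoeff κ b i * degSum q κ (qShift q b i) Φ n := by
  simp only [degSum, Finset.mul_sum]
  rw [Finset.sum_comm]
  simp only [lowerCoeff_mul_weighted hb hq hq1]
  rw [← sum_piAntidiag_succ (fun l i => multiCoeff q κ b l * (Φ fun j => b j * q ^ l j)
        * ((1 - b i * q ^ l i / b i) * ∏ j ∈ Finset.univ.erase i,
          (b i - b j * q ^ l j) / (b i - b j)))]
  · refine Finset.sum_congr rfl fun l hl => ?_
    rw [← Finset.mul_sum, sum_sub_div_prod hb.injective hb.ne_zero (fun j => b j * q ^ l j),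
      prod_mul_pow_div hb, mem_piAntidiag_univ.mp hl]
    ring
  · intro l i h
    simp [h, div_self (hb.ne_zero i)]

/-- The double-pole version. It is needed because a shift of b_i in the well-poised series
contributes a further factor linear in b_i. -/
theorem sum_lowerCoeff_div_mul_degSum (hb : QGeneric q b) (hq : q ≠ 0) (hq1 : ‖q‖ < 1)
    (κ : ℂ → ℂ) (Φ : (Fin M → ℂ) → ℂ) (n : ℕ) :
    ∑ i, lowerCoeff κ b i / b i * degSum q κ (qShift q b i) Φ n
      = q ^ (n + 1) * degSum q κ b (fun y => (∑ j, (y j)⁻¹ - ∑ j, (b j)⁻¹) * Φ y) (n + 1) := by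
  simp only [degSum, Finset.mul_sum, div_mul_eq_mul_div]
  rw [Finset.sum_comm]
  simp only [lowerCoeff_mul_weighted hb hq hq1]
  rw [← sum_piAntidiag_succ (fun l i => multiCoeff q κ b l * (Φ fun j => b j * q ^ l j)
        * ((1 - b i * q ^ l i / b i) * ∏ j ∈ Finset.univ.erase i,
          (b i - b j * q ^ l j) / (b i - b j)) / b i)]
  · refine Finset.sum_congr rfl fun l hl => ?_
    simp only [mul_div_assoc (multiCoeff q κ b l * (Φ fun j => b j * q ^ l j))]
    rw [← Finset.mul_sum, sum_sub_div_prod_div hb.injective hb.ne_zero (fun j => b j * q ^ l j)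
      (fun j => mul_ne_zero (hb.ne_zero j) (pow_ne_zero _ hq)), prod_mul_pow_div hb,
      mem_piAntidiag_univ.mp hl]
    ring
  · intro l i h
    simp [h, div_self (hb.ne_zero i)]

end DegreeSums

/-! ### Partial fractions involving the upper parameters. -/

section UpperParameters

open Polynomial

variable {q : ℂ} {M r : ℕ} {b : Fin M → ℂ} {a : Fin r → ℂ}

/-- The polynomial `∏_j (1 - z / a_j)`. -/
noncomputable def upperPoly {r : ℕ} (a : Fin r → ℂ) : ℂ[X] := ∏ j, (1 - C (a j)⁻¹ * X)

theorem eval_upperPoly (a : Fin r → ℂ) (z : ℂ) : (upperPoly a).eval z = ∏ j, (1 - z / a j) := by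
  simp only [upperPoly, eval_prod, eval_sub, eval_one, eval_mul, eval_C, eval_X]
  exact Finset.prod_congr rfl fun j _ => by rw [div_eq_inv_mul]

theorem natDegree_upperPoly_le (a : Fin r → ℂ) : (upperPoly a).natDegree ≤ r := by
  refine (natDegree_prod_le _ _).trans ?_
  calc ∑ j, (1 - C (a j)⁻¹ * X).natDegree ≤ ∑ _j : Fin r, 1 := by
        refine Finset.sum_le_sum fun j _ => ?_
        refine (natDegree_sub_le _ _).trans (max_le (by simp) ?_)
        exact (natDegree_C_mul_le _ _).trans natDegree_X_le
    _ = r := by simp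

theorem coeff_upperPoly (a : Fin r → ℂ) : (upperPoly a).coeff r = ∏ j, (-(a j)⁻¹) := by
  have h := coeff_prod_of_natDegree_le (s := Finset.univ) (fun j => 1 - C (a j)⁻¹ * X) 1
    (fun j _ => (natDegree_sub_le _ _).trans
      (max_le (by simp) ((natDegree_C_mul_le _ _).trans natDegree_X_le)))
  simp only [Finset.card_univ, Fintype.card_fin, mul_one] at h
  rw [upperPoly, h]
  exact Finset.prod_congr rfl fun j _ => by simp [coeff_one]

theorem upperPoly_eval_inv (ha : ∀ j, a j ≠ 0) {Q : ℂ} (hQ : Q ≠ 0) :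
    (upperPoly a).eval Q⁻¹ = (∏ j, (-(a j)⁻¹)) * (Q⁻¹) ^ r * ∏ j, (1 - a j * Q) := by
  have : (Q⁻¹) ^ r = ∏ _j : Fin r, Q⁻¹ := by simp
  rw [eval_upperPoly, this, ← Finset.prod_mul_distrib, ← Finset.prod_mul_distrib]
  refine Finset.prod_congr rfl fun j _ => ?_
  have := ha j
  field_simp
  ring

theorem prod_inv_sub {Q : ℂ} (hQ : Q ≠ 0) (v : Fin M → ℂ) :
    ∏ j, (Q⁻¹ - v j) = (Q⁻¹) ^ M * ∏ j, (1 - v j * Q) := by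
  have : (Q⁻¹) ^ M = ∏ _j : Fin M, Q⁻¹ := by simp
  rw [this, ← Finset.prod_mul_distrib]
  refine Finset.prod_congr rfl fun j _ => ?_
  field_simp

theorem prod_erase_div_sub (v : Fin M → ℂ) (hv : Function.Injective v) (h0 : ∀ i, v i ≠ 0)
    (i : Fin M) :
    ∏ j ∈ Finset.univ.erase i, v j / (v j - v i)
      = -(∏ j, (-v j)) / (v i * ∏ j ∈ Finset.univ.erase i, (v i - v j)) := by
  have hne : ∏ j ∈ Finset.univ.erase i, (v i - v j) ≠ 0 :=
    Finset.prod_ne_zero_iff.mpr fun j hj =>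
      _root_.sub_ne_zero.mpr (hv.ne (Finset.ne_of_mem_erase hj).symm)
  have h1 : ∏ j ∈ Finset.univ.erase i, v j / (v j - v i)
      = (∏ j ∈ Finset.univ.erase i, (-v j)) / ∏ j ∈ Finset.univ.erase i, (v i - v j) := by
    rw [← Finset.prod_div_distrib]
    refine Finset.prod_congr rfl fun j _ => ?_
    rw [← neg_div_neg_eq, neg_sub]
  rw [h1, ← Finset.mul_prod_erase _ _ (Finset.mem_univ i)]
  have := h0 i
  field_simp

theorem prod_neg_mul_prod_neg_inv (a : Fin (M + 1) → ℂ) (v : Fin M → ℂ) :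
    (∏ j, (-v j)) * ∏ j, (-(a j)⁻¹) = -((∏ j, v j) / ∏ j, a j) := by
  simp only [Finset.prod_neg, Finset.card_univ, Fintype.card_fin, Finset.prod_inv_distrib]
  rw [pow_succ]
  have h : ((-1 : ℂ) ^ M) * (-1) ^ M = 1 := by rw [← mul_pow]; simp
  rw [div_eq_mul_inv]
  linear_combination (-(∏ j, v j) * (∏ j, a j)⁻¹) * h

theorem prod_neg_mul_prod_neg_inv' (a : Fin M → ℂ) (v : Fin M → ℂ) :
    (∏ j, (-v j)) * ∏ j, (-(a j)⁻¹) = (∏ j, v j) / ∏ j, a j := by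
  simp only [Finset.prod_neg, Finset.card_univ, Fintype.card_fin, Finset.prod_inv_distrib]
  have h : ((-1 : ℂ) ^ M) * (-1) ^ M = 1 := by rw [← mul_pow]; simp
  rw [div_eq_mul_inv]
  linear_combination ((∏ j, v j) * (∏ j, a j)⁻¹) * h

/-- Residues of ∏ (1 - z/a_j) / (z (z - 1/Q) ∏ (z - v_j)). The pole at 0 produces the term 1, the
pole at 1/Q the ratio of products, and the leading coefficient the remaining term. -/
theorem sum_upperPoly_div {a : Fin (M + 1) → ℂ} (ha : ∀ j, a j ≠ 0) {v : Fin M → ℂ}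
    (hv : Function.Injective v) (h0 : ∀ i, v i ≠ 0) {Q : ℂ} (hQ : Q ≠ 0)
    (hvQ : ∀ i, v i * Q ≠ 1) :
    ∑ i, (∏ j, (1 - v i / a j)) / (1 - v i * Q) * ∏ j ∈ Finset.univ.erase i, v j / (v j - v i)
      = 1 - (∏ j, v j) / (∏ j, a j) / Q
          * (1 - (∏ j, (1 - a j * Q)) / ∏ j, (1 - v j * Q)) := by
  have hd : ∀ i, v i ≠ Q⁻¹ := fun i h => hvQ i (by rw [h, inv_mul_cancel₀ hQ])
  have hB : ∏ j, (-v j) ≠ 0 := Finset.prod_ne_zero_iff.mpr fun j _ => neg_ne_zero.mpr (h0 j)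
  have hR : ∏ j, (1 - v j * Q) ≠ 0 :=
    Finset.prod_ne_zero_iff.mpr fun j _ => _root_.sub_ne_zero.mpr (hvQ j).symm
  have key := sum_residues_two v hv h0 hd (inv_ne_zero hQ).symm (P := upperPoly a)
    (by simpa using natDegree_upperPoly_le a)
  rw [Fintype.card_fin, coeff_upperPoly, upperPoly_eval_inv ha hQ, prod_inv_sub hQ,
    eval_upperPoly] at key
  simp only [zero_sub, sub_zero, zero_div, Finset.prod_const_one] at key
  have hAB := prod_neg_mul_prod_neg_inv a v
  have hterm : ∀ i, (∏ j, (1 - v i / a j)) / (1 - v i * Q)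
        * ∏ j ∈ Finset.univ.erase i, v j / (v j - v i)
      = (∏ j, (-v j)) / Q * ((upperPoly a).eval (v i)
        / (v i * (v i - Q⁻¹) * ∏ j ∈ Finset.univ.erase i, (v i - v j))) := by
    intro i
    have h1 : ∏ j ∈ Finset.univ.erase i, (v i - v j) ≠ 0 :=
      Finset.prod_ne_zero_iff.mpr fun j hj =>
        _root_.sub_ne_zero.mpr (hv.ne (Finset.ne_of_mem_erase hj).symm)
    have h2 : 1 - v i * Q ≠ 0 := _root_.sub_ne_zero.mpr (hvQ i).symm
    have h3 : v i - Q⁻¹ = -(1 - v i * Q) / Q := by field_simp; ring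
    have h4 := h0 i
    rw [prod_erase_div_sub v hv h0, eval_upperPoly, h3]
    field_simp
  rw [Finset.sum_congr rfl fun i _ => hterm i, ← Finset.mul_sum]
  rw [add_assoc, ← eq_sub_iff_add_eq] at key
  rw [key]
  have e1 : (∏ j, (-v j)) / Q * (1 / (-Q⁻¹ * ∏ j, (-v j))) = -1 := by
    field_simp
  have e2 : (∏ j, (-(a j)⁻¹)) * (Q⁻¹) ^ (M + 1) * (∏ j, (1 - a j * Q))
        / (Q⁻¹ * ((Q⁻¹) ^ M * ∏ j, (1 - v j * Q)))
      = (∏ j, (-(a j)⁻¹)) * ((∏ j, (1 - a j * Q)) / ∏ j, (1 - v j * Q)) := by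
    have h1 : (Q⁻¹) ^ M ≠ 0 := pow_ne_zero _ (inv_ne_zero hQ)
    have h2 := inv_ne_zero hQ
    rw [mul_div_assoc', div_eq_div_iff (mul_ne_zero h2 (mul_ne_zero h1 hR)) hR]
    ring
  rw [e2, mul_sub, mul_add, e1, div_mul_eq_mul_div, hAB, div_mul_eq_mul_div, ← mul_assoc, hAB]
  ring

/-- The additional factor v_i removes the pole at 0, so M upper parameters balance the degrees. -/
theorem sum_mul_upperPoly_div {a : Fin M → ℂ} (ha : ∀ j, a j ≠ 0) {v : Fin M → ℂ}
    (hv : Function.Injective v) (h0 : ∀ i, v i ≠ 0) {Q : ℂ} (hQ : Q ≠ 0)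
    (hvQ : ∀ i, v i * Q ≠ 1) :
    ∑ i, v i * (∏ j, (1 - v i / a j)) / (1 - v i * Q)
        * ∏ j ∈ Finset.univ.erase i, v j / (v j - v i)
      = (∏ j, v j) / (∏ j, a j) / Q * (1 - (∏ j, (1 - a j * Q)) / ∏ j, (1 - v j * Q)) := by
  have hd : ∀ i, v i ≠ Q⁻¹ := fun i h => hvQ i (by rw [h, inv_mul_cancel₀ hQ])
  have hR : ∏ j, (1 - v j * Q) ≠ 0 :=
    Finset.prod_ne_zero_iff.mpr fun j _ => _root_.sub_ne_zero.mpr (hvQ j).symm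
  have key := sum_residues v hv hd (P := upperPoly a)
    (by simpa using natDegree_upperPoly_le a)
  rw [Fintype.card_fin, coeff_upperPoly, upperPoly_eval_inv ha hQ, prod_inv_sub hQ] at key
  have hAB := prod_neg_mul_prod_neg_inv' a v
  have hterm : ∀ i, v i * (∏ j, (1 - v i / a j)) / (1 - v i * Q)
        * ∏ j ∈ Finset.univ.erase i, v j / (v j - v i)
      = (∏ j, (-v j)) / Q * ((upperPoly a).eval (v i)
        / ((v i - Q⁻¹) * ∏ j ∈ Finset.univ.erase i, (v i - v j))) := by
    intro i
    have h1 : ∏ j ∈ Finset.univ.erase i, (v i - v j) ≠ 0 :=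
      Finset.prod_ne_zero_iff.mpr fun j hj =>
        _root_.sub_ne_zero.mpr (hv.ne (Finset.ne_of_mem_erase hj).symm)
    have h2 : 1 - v i * Q ≠ 0 := _root_.sub_ne_zero.mpr (hvQ i).symm
    have h3 : v i - Q⁻¹ = -(1 - v i * Q) / Q := by field_simp; ring
    have h4 := h0 i
    rw [prod_erase_div_sub v hv h0, eval_upperPoly, h3]
    field_simp
  rw [Finset.sum_congr rfl fun i _ => hterm i, ← Finset.mul_sum]
  rw [← eq_sub_iff_add_eq] at key
  rw [key]
  have e2 : (∏ j, (-(a j)⁻¹)) * (Q⁻¹) ^ M * (∏ j, (1 - a j * Q))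
        / ((Q⁻¹) ^ M * ∏ j, (1 - v j * Q))
      = (∏ j, (-(a j)⁻¹)) * ((∏ j, (1 - a j * Q)) / ∏ j, (1 - v j * Q)) := by
    field_simp
  rw [e2, mul_sub, div_mul_eq_mul_div, hAB, div_mul_eq_mul_div, ← mul_assoc, hAB]
  ring

end UpperParameters

/-! ### The q-difference relation for the one-variable series. -/

section HypergeometricRelation

variable {q : ℂ} {M : ℕ} {b : Fin M → ℂ} {a : Fin (M + 1) → ℂ}

/-- The coefficient of `x^n` in the series `_{M+1}φ_M`. -/
noncomputable def hypCoeff (q : ℂ) {M : ℕ} (a : Fin (M + 1) → ℂ) (b : Fin M → ℂ) (n : ℕ) : ℂ :=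
  (∏ i, qPoch q (a i) n) / (qPoch q q n * ∏ i, qPoch q (b i) n)

theorem basicHypTerm_eq (a : Fin (M + 1) → ℂ) (b : Fin M → ℂ) (x : ℂ) (n : ℕ) :
    basicHypTerm q a b x n = hypCoeff q a b n * x ^ n := by
  simp [basicHypTerm, hypCoeff, add_comm]

theorem hypCoeff_zero : hypCoeff q a b 0 = 1 := by simp [hypCoeff, qPoch_zero]

theorem exists_norm_prod_qPoch_le (hq1 : ‖q‖ < 1) {ι : Type*} [Fintype ι] (c : ι → ℂ) :
    ∃ K : ℝ, 0 < K ∧ ∀ n : ι → ℕ, ‖∏ i, qPoch q (c i) (n i)‖ ≤ K := by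
  choose K hK h using fun i => exists_norm_qPoch_le hq1 ‖c i‖
  refine ⟨∏ i, K i, Finset.prod_pos fun i _ => hK i, fun n => ?_⟩
  rw [norm_prod]
  exact Finset.prod_le_prod (fun _ _ => norm_nonneg _) fun i _ => h i _ le_rfl _

theorem exists_norm_prod_qPoch_inv_le (hq1 : ‖q‖ < 1) {ι : Type*} [Fintype ι] (c : ι → ℂ)
    (hc : ∀ i, ∀ k : ℕ, c i * q ^ k ≠ 1) :
    ∃ K : ℝ, 0 < K ∧ ∀ n : ι → ℕ, ‖(∏ i, qPoch q (c i) (n i))⁻¹‖ ≤ K := by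
  choose K hK h using fun i => exists_norm_inv_qPoch_le hq1 (hc i)
  refine ⟨∏ i, K i, Finset.prod_pos fun i _ => hK i, fun n => ?_⟩
  rw [← Finset.prod_inv_distrib, norm_prod]
  exact Finset.prod_le_prod (fun _ _ => norm_nonneg _) fun i _ => h i _

theorem exists_norm_hypCoeff_le (hb : QGeneric q b) (hq1 : ‖q‖ < 1) (a : Fin (M + 1) → ℂ) :
    ∃ K : ℝ, 0 < K ∧ ∀ n, ‖hypCoeff q a b n‖ ≤ K := by
  obtain ⟨K₁, hK₁, h₁⟩ := exists_norm_prod_qPoch_le hq1 a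
  obtain ⟨K₂, hK₂, h₂⟩ := exists_norm_prod_qPoch_inv_le hq1 b hb.mul_pow_ne_one
  obtain ⟨K₃, hK₃, h₃⟩ := exists_norm_inv_qPoch_le hq1 (pow_succ_ne_one hq1)
  refine ⟨K₁ * (K₂ * K₃), by positivity, fun n => ?_⟩
  rw [hypCoeff, div_eq_mul_inv, mul_inv_rev, norm_mul, norm_mul]
  gcongr
  · exact h₁ fun _ => n
  · exact h₂ fun _ => n
  · exact h₃ n

theorem summable_of_norm_le_mul_pow {f : ℕ → ℂ} {K : ℝ} (hf : ∀ n, ‖f n‖ ≤ K) {x : ℂ}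
    (hx : ‖x‖ < 1) : Summable fun n => f n * x ^ n := by
  refine Summable.of_norm_bounded
    (g := fun n => K * ‖x‖ ^ n) ((summable_geometric_of_lt_one (norm_nonneg x) hx).mul_left K)
    fun n => ?_
  rw [norm_mul, norm_pow]
  gcongr
  exact hf n

theorem summable_hypCoeff (hb : QGeneric q b) (hq1 : ‖q‖ < 1) (a : Fin (M + 1) → ℂ) {x : ℂ}
    (hx : ‖x‖ < 1) : Summable fun n => hypCoeff q a b n * x ^ n := by
  obtain ⟨K, -, hK⟩ := exists_norm_hypCoeff_le hb hq1 a
  exact summable_of_norm_le_mul_pow hK hx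

theorem hasSum_basicHyp (hb : QGeneric q b) (hq1 : ‖q‖ < 1) (a : Fin (M + 1) → ℂ) {x : ℂ}
    (hx : ‖x‖ < 1) : HasSum (fun n => hypCoeff q a b n * x ^ n) (basicHyp q a b x) := by
  rw [basicHyp]
  simp only [basicHypTerm_eq]
  exact (summable_hypCoeff hb hq1 a hx).hasSum

theorem hypCoeff_succ (hb : QGeneric q b) (hq1 : ‖q‖ < 1) (a : Fin (M + 1) → ℂ) (n : ℕ) :
    (1 - q ^ (n + 1)) * hypCoeff q a b (n + 1)
      = hypCoeff q a b n * ((∏ j, (1 - a j * q ^ n)) / ∏ j, (1 - b j * q ^ n)) := by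
  have h1 : (∏ j, qPoch q (b j) n) ≠ 0 :=
    Finset.prod_ne_zero_iff.mpr fun j _ => qPoch_ne_zero (hb.mul_pow_ne_one j) n
  have h2 : ∏ j, (1 - b j * q ^ n) ≠ 0 :=
    Finset.prod_ne_zero_iff.mpr fun j _ => sub_ne_zero.mpr (hb.mul_pow_ne_one j n).symm
  have h3 : qPoch q q n ≠ 0 := qPoch_ne_zero (pow_succ_ne_one hq1) n
  have h4 : 1 - q ^ (n + 1) ≠ 0 := by
    rw [pow_succ']
    exact sub_ne_zero.mpr (pow_succ_ne_one hq1 n).symm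
  have h5 : q * q ^ n = q ^ (n + 1) := (pow_succ' q n).symm
  simp only [hypCoeff, qPoch_succ, Finset.prod_mul_distrib, h5]
  field_simp
  simp only [mul_comm (q ^ n)]

/-- Only (b_i)_n changes, and (b_i)_{n+1} can be split at either end. -/
theorem hypCoeff_qShift (hb : QGeneric q b) (hq : q ≠ 0) (a : Fin (M + 1) → ℂ) (i : Fin M)
    (n : ℕ) :
    (1 - b i * q ^ n) * hypCoeff q a (qShift q b i) n = (1 - b i) * hypCoeff q a b n := by
  have h1 : qPoch q (b i) n ≠ 0 := qPoch_ne_zero (hb.mul_pow_ne_one i) n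
  have h2 : qPoch q (q * b i) n ≠ 0 := by
    have := qPoch_ne_zero ((hb.shift hq i).mul_pow_ne_one i) n
    rwa [qShift_self] at this
  have h3 : qPoch q (b i) n * (1 - b i * q ^ n) = (1 - b i) * qPoch q (q * b i) n := by
    rw [← qPoch_succ, qPoch_succ']
  have h4 : ∏ j ∈ Finset.univ.erase i, qPoch q (qShift q b i j) n
      = ∏ j ∈ Finset.univ.erase i, qPoch q (b j) n :=
    Finset.prod_congr rfl fun j hj => by rw [qShift_of_ne b (Finset.ne_of_mem_erase hj)]
  have h5 : (1 - b i * q ^ n) / qPoch q (q * b i) n = (1 - b i) / qPoch q (b i) n := by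
    rw [div_eq_div_iff h2 h1, ← h3, mul_comm]
  rw [hypCoeff, hypCoeff, ← Finset.mul_prod_erase _ (fun j => qPoch q (qShift q b i j) n)
    (Finset.mem_univ i), ← Finset.mul_prod_erase _ (fun j => qPoch q (b j) n)
    (Finset.mem_univ i), h4, qShift_self]
  linear_combination (∏ i, qPoch q (a i) n) * (qPoch q q n)⁻¹
    * (∏ j ∈ Finset.univ.erase i, qPoch q (b j) n)⁻¹ * h5

/-- The one-variable weight `∏_j (1 - z / a_j) / (1 - z)`. -/
noncomputable def hypWeight {r : ℕ} (a : Fin r → ℂ) (z : ℂ) : ℂ :=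
  (∏ j, (1 - z / a j)) / (1 - z)

/-- After `hypCoeff_qShift` the sum is the partial fraction identity with Q = q^n, whose ratio of
products is the ratio of consecutive coefficients. -/
theorem sum_lowerCoeff_mul_hypCoeff (hb : QGeneric q b) (hq : q ≠ 0) (hq1 : ‖q‖ < 1)
    (ha : ∀ j, a j ≠ 0) (n : ℕ) :
    ∑ i, lowerCoeff (hypWeight a) b i * hypCoeff q a (qShift q b i) n
      = hypCoeff q a b n - (∏ j, b j) / (∏ j, a j) / q ^ n
        * (hypCoeff q a b n - (1 - q ^ (n + 1)) * hypCoeff q a b (n + 1)) := by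
  have hS := sum_upperPoly_div ha hb.injective hb.ne_zero (pow_ne_zero n hq)
    (fun i => hb.mul_pow_ne_one i n)
  rw [hypCoeff_succ hb hq1]
  have : ∀ i, lowerCoeff (hypWeight a) b i * hypCoeff q a (qShift q b i) n
      = hypCoeff q a b n * ((∏ j, (1 - b i / a j)) / (1 - b i * q ^ n)
        * ∏ j ∈ Finset.univ.erase i, b j / (b j - b i)) := by
    intro i
    have h1 : 1 - b i * q ^ n ≠ 0 := sub_ne_zero.mpr (hb.mul_pow_ne_one i n).symm
    have h2 : 1 - b i ≠ 0 := by simpa using sub_ne_zero.mpr (hb.mul_pow_ne_one i 0).symm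
    have h3 := hypCoeff_qShift hb hq a i n
    have h4 : hypCoeff q a (qShift q b i) n
        = (1 - b i) * hypCoeff q a b n / (1 - b i * q ^ n) := by
      rw [eq_div_iff h1, ← h3, mul_comm]
    rw [h4, lowerCoeff, hypWeight]
    field_simp
  rw [Finset.sum_congr rfl fun i _ => this i, ← Finset.mul_sum, hS]
  ring

/-- The `q`-difference relation satisfied by `_{M+1}φ_M` in its argument and lower parameters. -/
theorem basicHyp_relation (hb : QGeneric q b) (hq : q ≠ 0) (hq1 : ‖q‖ < 1)
    (ha : ∀ j, a j ≠ 0) {x : ℂ} (hx : ‖x‖ < 1) :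
    (1 - x) * basicHyp q a b x
        - (1 - (∏ j, a j) * x / ∏ j, b j) * basicHyp q a b (q * x)
      = (∏ j, a j) * x / (∏ j, b j)
        * ∑ i, lowerCoeff (hypWeight a) b i * basicHyp q a (qShift q b i) (q * x) := by
  have hA : ∏ j, a j ≠ 0 := Finset.prod_ne_zero_iff.mpr fun j _ => ha j
  have hB : ∏ j, b j ≠ 0 := Finset.prod_ne_zero_iff.mpr fun j _ => hb.ne_zero j
  have hqx : ‖q * x‖ < 1 := by
    rw [norm_mul]
    exact mul_lt_one_of_nonneg_of_lt_one_left (norm_nonneg q) hq1 hx.le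
  have s1 := hasSum_basicHyp hb hq1 a hx
  have s2 := hasSum_basicHyp hb hq1 a hqx
  have s3 := (hasSum_sum fun i (_ : i ∈ Finset.univ) =>
    (hasSum_basicHyp (hb.shift hq i) hq1 a hqx).mul_left
      (lowerCoeff (hypWeight a) b i)).mul_left ((∏ j, a j) * x / (∏ j, b j))
  -- The constant terms of G(x) and G(qx) cancel, so the difference may be indexed from n + 1.
  have s4 : HasSum (fun n => (1 - q ^ (n + 1)) * hypCoeff q a b (n + 1) * x ^ (n + 1))
      (basicHyp q a b x - basicHyp q a b (q * x)) := by
    have := (hasSum_nat_add_iff' 1).mpr (s1.sub s2)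
    simp only [Finset.sum_range_one, pow_zero, sub_self, sub_zero] at this
    refine this.congr_fun fun n => ?_
    ring
  have s5 := ((s2.mul_left ((∏ j, a j) * x / ∏ j, b j)).sub (s1.mul_left x)).add s4
  have : (fun n => (∏ j, a j) * x / (∏ j, b j)
      * ∑ i, lowerCoeff (hypWeight a) b i * (hypCoeff q a (qShift q b i) n * (q * x) ^ n))
      = fun n => (∏ j, a j) * x / (∏ j, b j) * (hypCoeff q a b n * (q * x) ^ n)
        - x * (hypCoeff q a b n * x ^ n)
        + (1 - q ^ (n + 1)) * hypCoeff q a b (n + 1) * x ^ (n + 1) := by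
    funext n
    have h1 := sum_lowerCoeff_mul_hypCoeff hb hq hq1 ha n
    have h2 : ∑ i, lowerCoeff (hypWeight a) b i * (hypCoeff q a (qShift q b i) n * (q * x) ^ n)
        = (∑ i, lowerCoeff (hypWeight a) b i * hypCoeff q a (qShift q b i) n) * (q * x) ^ n := by
      rw [Finset.sum_mul]
      exact Finset.sum_congr rfl fun i _ => by ring
    have hqn := pow_ne_zero n hq
    rw [h2, h1, mul_pow]
    field_simp
    ring
  rw [this] at s3
  have := s3.unique s5
  rw [this]
  ring

end HypergeometricRelation

/-! ### Convergence of the multiple series. -/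

section Summability

variable {q : ℂ} {M r : ℕ} {b : Fin M → ℂ}

/-- A finite set of multi-indices lies in a box, over which the sum of products factors. -/
theorem summable_prod_pi {f : Fin M → ℕ → ℝ} (h0 : ∀ i n, 0 ≤ f i n) (hf : ∀ i, Summable (f i)) :
    Summable fun l : Fin M → ℕ => ∏ i, f i (l i) := by
  refine summable_of_sum_le (c := ∏ i, ∑' n, f i n)
    (fun l => Finset.prod_nonneg fun i _ => h0 i _) fun s => ?_
  classical
  calc ∑ l ∈ s, ∏ i, f i (l i)
      ≤ ∑ l ∈ Fintype.piFinset fun i => s.image fun l => l i, ∏ i, f i (l i) := by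
        refine Finset.sum_le_sum_of_subset_of_nonneg (fun l hl => ?_)
          fun l _ _ => Finset.prod_nonneg fun i _ => h0 i _
        exact Fintype.mem_piFinset.mpr fun i => Finset.mem_image_of_mem _ hl
    _ = ∏ i, ∑ n ∈ s.image fun l => l i, f i n := (Finset.prod_univ_sum _ _).symm
    _ ≤ _ := Finset.prod_le_prod (fun i _ => Finset.sum_nonneg fun n _ => h0 i n)
        fun i _ => (hf i).sum_le_tsum _ fun n _ => h0 i n

/-- The passage from multiple series to `degSum`: an unconditionally convergent family is grouped by
total degree. -/
theorem hasSum_piAntidiag {f : (Fin M → ℕ) → ℂ} {s : ℂ} (hf : HasSum f s) :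
    HasSum (fun n => ∑ l ∈ Finset.piAntidiag Finset.univ n, f l) s := by
  have h := hf.tsum_fiberwise (multiDeg (M := M))
  refine h.congr_fun fun n => ?_
  have : multiDeg (M := M) ⁻¹' {n} = ↑(Finset.piAntidiag (Finset.univ : Finset (Fin M)) n) := by
    ext l
    simp only [Set.mem_preimage, Set.mem_singleton_iff, Finset.mem_coe, mem_piAntidiag_univ]
  rw [this]
  exact (Finset.tsum_subtype _ f).symm

theorem shiftProd_hypWeight (a : Fin r → ℂ) (z : ℂ) (n : ℕ) :
    shiftProd q (hypWeight a) z n = (∏ j, qPoch q (z / a j) n) / qPoch q z n := by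
  simp only [shiftProd, hypWeight, qPoch, Finset.prod_div_distrib]
  rw [Finset.prod_comm]
  congr 1
  refine Finset.prod_congr rfl fun j _ => Finset.prod_congr rfl fun i _ => ?_
  ring

theorem shiftProd_mul (κ₁ κ₂ : ℂ → ℂ) (z : ℂ) (n : ℕ) :
    shiftProd q (fun z => κ₁ z * κ₂ z) z n = shiftProd q κ₁ z n * shiftProd q κ₂ z n :=
  Finset.prod_mul_distrib

theorem shiftProd_id (z : ℂ) (n : ℕ) : shiftProd q (fun z => z) z n = z ^ n * q ^ n.choose 2 := by
  induction n with
  | zero => simp [shiftProd]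
  | succ n ih =>
    rw [shiftProd_succ, ih, Nat.choose_succ_succ', Nat.choose_one_right]
    ring

theorem multiCoeff_id_mul (κ : ℂ → ℂ) (b : Fin M → ℂ) (l : Fin M → ℕ) :
    multiCoeff q (fun z => z * κ z) b l
      = (∏ i, b i ^ l i * q ^ (l i).choose 2) * multiCoeff q κ b l := by
  simp only [multiCoeff, shiftProd_mul, shiftProd_id, mul_div_assoc, Finset.prod_mul_distrib]
  ring

theorem exists_norm_vandermondeRatio_le (hq1 : ‖q‖ < 1) (b : Fin M → ℂ) :
    ∃ K : ℝ, 0 < K ∧ ∀ l, ‖vandermondeRatio q b l‖ ≤ K := by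
  have hpow : ∀ k : ℕ, ‖q ^ k‖ ≤ 1 := fun k => by
    rw [norm_pow]
    exact pow_le_one₀ (norm_nonneg q) hq1.le
  -- Each point b_i q^{l_i} is no larger than b_i in norm; the summand 1 only makes the constant
  -- positive.
  refine ⟨(∏ i, ∏ j ∈ Finset.Ioi i, (‖b i‖ + ‖b j‖)) / ‖vandermondeProd b‖ + 1, by positivity,
    fun l => ?_⟩
  rw [vandermondeRatio, norm_div]
  refine (div_le_div_of_nonneg_right ?_ (norm_nonneg _)).trans (le_add_of_nonneg_right zero_le_one)
  rw [vandermondeProd, norm_prod]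
  refine Finset.prod_le_prod (fun _ _ => norm_nonneg _) fun i _ => ?_
  rw [norm_prod]
  refine Finset.prod_le_prod (fun _ _ => norm_nonneg _) fun j _ => ?_
  refine (norm_sub_le _ _).trans (add_le_add ?_ ?_)
  · rw [norm_mul]
    exact mul_le_of_le_one_right (norm_nonneg _) (hpow _)
  · rw [norm_mul]
    exact mul_le_of_le_one_right (norm_nonneg _) (hpow _)

theorem multiCoeff_hypWeight (a : Fin r → ℂ) (b : Fin M → ℂ) (l : Fin M → ℕ) :
    multiCoeff q (hypWeight a) b l = vandermondeRatio q b l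
      * ∏ i, ((∏ j, qPoch q (b i / a j) (l i))
        / ((∏ j, qPoch q (q * b i / b j) (l i)) * qPoch q (b i) (l i))) := by
  rw [multiCoeff]
  congr 1
  refine Finset.prod_congr rfl fun i _ => ?_
  rw [shiftProd_hypWeight, div_div, mul_comm (qPoch q (b i) (l i))]

theorem exists_norm_multiCoeff_le (hb : QGeneric q b) (hq1 : ‖q‖ < 1) (a : Fin r → ℂ) :
    ∃ K : ℝ, 0 < K ∧ ∀ l, ‖multiCoeff q (hypWeight a) b l‖ ≤ K := by
  obtain ⟨K₀, hK₀, h₀⟩ := exists_norm_vandermondeRatio_le hq1 b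
  choose K₁ hK₁ h₁ using fun i => exists_norm_prod_qPoch_le hq1 fun j => b i / a j
  choose K₂ hK₂ h₂ using fun i => exists_norm_prod_qPoch_inv_le hq1 (fun j => q * b i / b j)
    fun j => hb.div_mul_pow_ne_one hq1 i j
  choose K₃ hK₃ h₃ using fun i => exists_norm_inv_qPoch_le hq1 (hb.mul_pow_ne_one i)
  refine ⟨K₀ * ∏ i, (K₁ i * (K₃ i * K₂ i)), mul_pos hK₀ (Finset.prod_pos fun i _ =>
    mul_pos (hK₁ i) (mul_pos (hK₃ i) (hK₂ i))), fun l => ?_⟩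
  rw [multiCoeff_hypWeight, norm_mul, norm_prod]
  refine mul_le_mul (h₀ l) (Finset.prod_le_prod (fun _ _ => norm_nonneg _) fun i _ => ?_)
    (Finset.prod_nonneg fun _ _ => norm_nonneg _) hK₀.le
  rw [div_eq_mul_inv, mul_inv_rev, norm_mul, norm_mul]
  have := (hK₁ i).le
  have := (hK₃ i).le
  gcongr
  · exact h₁ i fun _ => l i
  · exact h₃ i (l i)
  · exact h₂ i fun _ => l i

theorem prod_pow_multiDeg (c : ℝ) (l : Fin M → ℕ) : ∏ i, c ^ l i = c ^ multiDeg l :=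
  Finset.prod_pow_eq_pow_sum _ _ _

/-- Gaussian decay beats geometric growth. -/
theorem summable_pow_mul_pow_choose {c r : ℝ} (hc : 0 ≤ c) (hr : 0 ≤ r) (hr1 : r < 1) :
    Summable fun n : ℕ => c ^ n * r ^ n.choose 2 := by
  have ht : Tendsto (fun n : ℕ => c * r ^ n) atTop (𝓝 0) := by
    simpa using (tendsto_pow_atTop_nhds_zero_of_lt_one hr hr1).const_mul c
  refine summable_of_ratio_norm_eventually_le (r := 1 / 2) (by norm_num) ?_
  filter_upwards [ht.eventually_le_const (by norm_num : (0 : ℝ) < 1 / 2)] with n hn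
  have h1 : c ^ (n + 1) * r ^ (n + 1).choose 2 = c * r ^ n * (c ^ n * r ^ n.choose 2) := by
    rw [Nat.choose_succ_succ', Nat.choose_one_right]
    ring
  have h2 : 0 ≤ c ^ n * r ^ n.choose 2 := by positivity
  rw [h1, Real.norm_of_nonneg h2, Real.norm_of_nonneg (by positivity)]
  gcongr

end Summability

/-! ### Uniqueness for the q-difference relation. -/

section Uniqueness

variable {q : ℂ} {M : ℕ}

theorem tendsto_const_mul_punctured (hq : q ≠ 0) :
    Tendsto (fun x : ℂ => q * x) (𝓝[≠] 0) (𝓝[≠] 0) := by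
  refine tendsto_nhdsWithin_iff.mpr ⟨?_, ?_⟩
  · have : Tendsto (fun x : ℂ => q * x) (𝓝 0) (𝓝 (q * 0)) := tendsto_id.const_mul q
    rw [mul_zero] at this
    exact this.mono_left nhdsWithin_le_nhds
  · filter_upwards [self_mem_nhdsWithin] with x hx
    exact mul_ne_zero hq hx

/-- A family of germs vanishing at the origin is zero if it satisfies the homogeneous
`q`-difference relation. -/
theorem eventually_eq_zero_of_relation (hq : q ≠ 0) (hq1 : ‖q‖ < 1)
    (G : (Fin M → ℂ) → ℂ → ℂ) (c : (Fin M → ℂ) → ℂ) (δ : (Fin M → ℂ) → Fin M → ℂ)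
    (hG : ∀ b, QGeneric q b → AnalyticAt ℂ (G b) 0) (h0 : ∀ b, QGeneric q b → G b 0 = 0)
    (hrel : ∀ b, QGeneric q b → ∀ᶠ x in 𝓝[≠] (0 : ℂ),
      (1 - x) * G b x - (1 - c b * x) * G b (q * x)
        = c b * x * ∑ i, δ b i * G (qShift q b i) (q * x))
    {b : Fin M → ℂ} (hb : QGeneric q b) : ∀ᶠ x in 𝓝 (0 : ℂ), G b x = 0 := by
  have claim : ∀ k : ℕ, ∀ b, QGeneric q b → (k : ℕ∞) ≤ analyticOrderAt (G b) 0 := by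
    intro k
    induction k with
    | zero => intro b _; simp
    | succ k ih =>
      intro b hb
      -- The factor 1 - q^k is useless for k = 0, so the first order of vanishing has to come from
      -- the value at 0.
      rcases Nat.eq_zero_or_pos k with rfl | hk
      · have h := analyticOrderAt_ne_zero.mpr ⟨hG b hb, h0 b hb⟩
        simpa using Order.one_le_iff_ne_zero.mpr h
      obtain ⟨g, hg, hgG⟩ := (natCast_le_analyticOrderAt (hG b hb)).mp (ih b hb)
      choose γ hγ hγG using fun i =>
        (natCast_le_analyticOrderAt (hG _ (hb.shift hq i))).mp (ih _ (hb.shift hq i))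
      have hγG' := eventually_all.mpr hγG
      -- Dividing by x^k is legitimate away from 0. In the limit x → 0 the right side vanishes
      -- because of its factor x, which leaves (1 - q^k) g(0) = 0.
      have hev : ∀ᶠ x in 𝓝[≠] (0 : ℂ), (1 - x) * g x - (1 - c b * x) * (q ^ k * g (q * x))
          = c b * x * ∑ i, δ b i * (q ^ k * γ i (q * x)) := by
        have hq' := (tendsto_const_mul_punctured hq).mono_right nhdsWithin_le_nhds
        filter_upwards [hrel b hb, hgG.filter_mono nhdsWithin_le_nhds, hq'.eventually hgG,
          hq'.eventually hγG', self_mem_nhdsWithin] with x h1 h2 h3 h4 hx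
        have hxk : x ^ k ≠ 0 := pow_ne_zero k hx
        simp only [h2, h3, h4, sub_zero, smul_eq_mul] at h1
        refine mul_left_cancel₀ hxk ?_
        have : x ^ k * (c b * x * ∑ i, δ b i * (q ^ k * γ i (q * x)))
            = c b * x * ∑ i, δ b i * ((q * x) ^ k * γ i (q * x)) := by
          rw [Finset.mul_sum, Finset.mul_sum, Finset.mul_sum]
          exact Finset.sum_congr rfl fun i _ => by ring
        rw [this, ← h1]
        ring
      have hcont : ∀ f : ℂ → ℂ, AnalyticAt ℂ f 0 →
          Tendsto (fun x => f (q * x)) (𝓝[≠] 0) (𝓝 (f 0)) := fun f hf =>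
        hf.continuousAt.tendsto.comp
          ((tendsto_const_mul_punctured hq).mono_right nhdsWithin_le_nhds)
      have hid : Tendsto (fun x : ℂ => x) (𝓝[≠] 0) (𝓝 0) := tendsto_id.mono_left nhdsWithin_le_nhds
      have hl : Tendsto (fun x => (1 - x) * g x - (1 - c b * x) * (q ^ k * g (q * x))) (𝓝[≠] 0)
          (𝓝 ((1 - 0) * g 0 - (1 - c b * 0) * (q ^ k * g 0))) :=
        ((hid.const_sub 1).mul (hg.continuousAt.tendsto.mono_left nhdsWithin_le_nhds)).sub
          (((hid.const_mul (c b)).const_sub 1).mul ((hcont g hg).const_mul _))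
      have hr : Tendsto (fun x => c b * x * ∑ i, δ b i * (q ^ k * γ i (q * x))) (𝓝[≠] 0)
          (𝓝 (c b * 0 * ∑ i, δ b i * (q ^ k * γ i 0))) :=
        (hid.const_mul (c b)).mul (tendsto_finsetSum _ fun i _ =>
          ((hcont (γ i) (hγ i)).const_mul _).const_mul _)
      have heq := tendsto_nhds_unique (hl.congr' hev) hr
      have hqk : 1 - q ^ k ≠ 0 := by
        obtain ⟨m, rfl⟩ := Nat.exists_eq_succ_of_ne_zero hk.ne'
        rw [Nat.succ_eq_add_one, pow_succ']
        exact sub_ne_zero.mpr (pow_succ_ne_one hq1 m).symm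
      have hg0 : g 0 = 0 := by
        refine (mul_eq_zero.mp ?_).resolve_left hqk
        linear_combination heq
      have hg1 : ((1 : ℕ) : ℕ∞) ≤ analyticOrderAt g 0 := by
        simpa using Order.one_le_iff_ne_zero.mpr (analyticOrderAt_ne_zero.mpr ⟨hg, hg0⟩)
      obtain ⟨h, hh, hhg⟩ := (natCast_le_analyticOrderAt hg).mp hg1
      refine (natCast_le_analyticOrderAt (hG b hb)).mpr ⟨h, hh, ?_⟩
      filter_upwards [hgG, hhg] with x h1 h2
      rw [h1, h2]
      simp only [smul_eq_mul]
      ring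
  refine analyticOrderAt_eq_top.mp ?_
  by_contra hne
  obtain ⟨n, hn⟩ := ENat.ne_top_iff_exists.mp hne
  have := claim (n + 1) b hb
  rw [← hn] at this
  exact absurd (by exact_mod_cast this : n + 1 ≤ n) (by omega)

end Uniqueness

/-! ### Analyticity of the series, and the generating function for the Euler transformation. -/

section PowerSums

variable {q : ℂ} {M : ℕ} {b : Fin M → ℂ}

theorem differentiableOn_tsum_mul_pow {ι : Type*} {w : ι → ℂ} {d : ι → ℕ} {K : ℝ}
    (hw : ∀ i, ‖w i‖ ≤ K) (hd : ∀ ρ : ℝ, 0 ≤ ρ → ρ < 1 → Summable fun i => ρ ^ d i) :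
    DifferentiableOn ℂ (fun x => ∑' i, w i * x ^ d i) (Metric.ball 0 1) := by
  intro z hz
  rw [mem_ball_zero_iff] at hz
  obtain ⟨ρ, hρ, hρ1⟩ := exists_between hz
  have hρ0 : 0 ≤ ρ := (norm_nonneg z).trans hρ.le
  have h : DifferentiableOn ℂ (fun x => ∑' i, w i * x ^ d i) (Metric.ball 0 ρ) := by
    refine Complex.differentiableOn_tsum_of_summable_norm ((hd ρ hρ0 hρ1).mul_left K)
      (fun i => by fun_prop) Metric.isOpen_ball fun i x hx => ?_
    rw [norm_mul, norm_pow]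
    have hx' : ‖x‖ ≤ ρ := (mem_ball_zero_iff.mp hx).le
    have hK : 0 ≤ K := (norm_nonneg _).trans (hw i)
    gcongr
    exact hw i
  exact (h.differentiableAt (Metric.isOpen_ball.mem_nhds
    (mem_ball_zero_iff.mpr hρ))).differentiableWithinAt

theorem differentiableOn_basicHyp (hb : QGeneric q b) (hq1 : ‖q‖ < 1) (a : Fin (M + 1) → ℂ) :
    DifferentiableOn ℂ (basicHyp q a b) (Metric.ball 0 1) := by
  obtain ⟨K, -, hK⟩ := exists_norm_hypCoeff_le hb hq1 a
  have := differentiableOn_tsum_mul_pow (d := fun n => n) hK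
    fun ρ h0 h1 => summable_geometric_of_lt_one h0 h1
  refine this.congr fun x _ => ?_
  simp only [basicHyp, basicHypTerm_eq]

theorem basicHyp_zero (a : Fin (M + 1) → ℂ) (b : Fin M → ℂ) : basicHyp q a b 0 = 1 := by
  simp only [basicHyp, basicHypTerm_eq]
  rw [tsum_eq_single 0 fun n hn => by simp [hn]]
  simp [hypCoeff_zero]

theorem summable_pow_multiDeg {ρ : ℝ} (h0 : 0 ≤ ρ) (h1 : ρ < 1) :
    Summable fun l : Fin M → ℕ => ρ ^ multiDeg l := by
  simp only [← prod_pow_multiDeg]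
  exact summable_prod_pi (fun _ _ => pow_nonneg h0 _) fun _ => summable_geometric_of_lt_one h0 h1

theorem multiDeg_eq_zero {l : Fin M → ℕ} : multiDeg l = 0 ↔ l = 0 := by
  simp [multiDeg, funext_iff]

theorem multiCoeff_zero (hb : QGeneric q b) (κ : ℂ → ℂ) : multiCoeff q κ b 0 = 1 := by
  have := vandermondeProd_ne_zero hb.injective
  simp [multiCoeff, vandermondeRatio, shiftProd, qPoch_zero, this]

theorem tsum_zero_pow_multiDeg (f : (Fin M → ℕ) → ℂ) :
    ∑' l, f l * (0 : ℂ) ^ multiDeg l = f 0 := by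
  rw [tsum_eq_single 0 fun l hl => by simp [multiDeg_eq_zero, hl]]
  simp [multiDeg]

/-- The generating function of the coefficients of the multiple `q`-Euler transformation. -/
noncomputable def eulerSum (q : ℂ) {r M : ℕ} (a : Fin r → ℂ) (b : Fin M → ℂ) (y : ℂ) : ℂ :=
  ∑' l, multiCoeff q (hypWeight a) b l * y ^ multiDeg l

theorem summable_eulerSum (hb : QGeneric q b) (hq1 : ‖q‖ < 1) {r : ℕ} (a : Fin r → ℂ) {y : ℂ}
    (hy : ‖y‖ < 1) : Summable fun l => multiCoeff q (hypWeight a) b l * y ^ multiDeg l := by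
  obtain ⟨K, -, hK⟩ := exists_norm_multiCoeff_le hb hq1 a
  refine Summable.of_norm_bounded ((summable_pow_multiDeg (norm_nonneg y) hy).mul_left K)
    fun l => ?_
  rw [norm_mul, norm_pow]
  gcongr
  exact hK l

theorem hasSum_eulerSum (hb : QGeneric q b) (hq1 : ‖q‖ < 1) {r : ℕ} (a : Fin r → ℂ) {y : ℂ}
    (hy : ‖y‖ < 1) :
    HasSum (fun n => degSum q (hypWeight a) b (fun _ => 1) n * y ^ n) (eulerSum q a b y) := by
  refine (hasSum_piAntidiag (summable_eulerSum hb hq1 a hy).hasSum).congr_fun fun n => ?_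
  rw [degSum, Finset.sum_mul]
  exact Finset.sum_congr rfl fun l hl => by rw [mem_piAntidiag_univ.mp hl, mul_one]

/-- Comparing coefficients of y^{n+1} turns this into `one_sub_mul_degSum` with constant weight. -/
theorem eulerSum_relation (hb : QGeneric q b) (hq : q ≠ 0) (hq1 : ‖q‖ < 1) {r : ℕ}
    (a : Fin r → ℂ) {y : ℂ} (hy : ‖y‖ < 1) :
    eulerSum q a b y - eulerSum q a b (q * y)
      = y * ∑ i, lowerCoeff (hypWeight a) b i * eulerSum q a (qShift q b i) y := by
  have hqy : ‖q * y‖ < 1 := by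
    rw [norm_mul]
    exact mul_lt_one_of_nonneg_of_lt_one_left (norm_nonneg q) hq1 hy.le
  have s1 := (hasSum_eulerSum hb hq1 a hy).sub (hasSum_eulerSum hb hq1 a hqy)
  rw [← hasSum_nat_add_iff' 1] at s1
  simp only [Finset.sum_range_one, pow_zero, sub_self, sub_zero] at s1
  have s2 := (hasSum_sum fun i (_ : i ∈ Finset.univ) =>
    (hasSum_eulerSum (hb.shift hq i) hq1 a hy).mul_left
      (lowerCoeff (hypWeight a) b i)).mul_left y
  refine s1.unique (s2.congr_fun fun n => ?_)
  have h := one_sub_mul_degSum hb hq hq1 (hypWeight a) (fun _ => 1) n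
  have h2 : ∑ i, lowerCoeff (hypWeight a) b i
        * (degSum q (hypWeight a) (qShift q b i) (fun _ => 1) n * y ^ n)
      = (∑ i, lowerCoeff (hypWeight a) b i
        * degSum q (hypWeight a) (qShift q b i) (fun _ => 1) n) * y ^ n := by
    rw [Finset.sum_mul]
    exact Finset.sum_congr rfl fun i _ => by ring
  rw [h2, ← h]
  ring

end PowerSums

/-! ### The multiple q-Euler transformation. -/

section EulerTransformation

variable {q : ℂ} {M : ℕ} {b : Fin M → ℂ} {a : Fin (M + 1) → ℂ}

/-- The left-hand side of the multiple `q`-Euler transformation. -/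
noncomputable def eulerSide (q : ℂ) {M : ℕ} (a : Fin (M + 1) → ℂ) (b : Fin M → ℂ) (x : ℂ) : ℂ :=
  qPochInf q ((∏ j, a j) / (∏ j, b j) * x) / qPochInf q x
    * eulerSum q a b ((∏ j, a j) / (∏ j, b j) * x)

/-- The argument y = Ax/B is unchanged under (b, x) ↦ (S_i b, qx), because B becomes qB. The first
factors of (x)_∞ and (y)_∞ then supply 1 - x and 1 - y. -/
theorem eulerSide_relation (hb : QGeneric q b) (hq : q ≠ 0) (hq1 : ‖q‖ < 1) {x : ℂ}
    (hx : ‖x‖ < 1) (hy : ‖(∏ j, a j) / (∏ j, b j) * x‖ < 1) :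
    (1 - x) * eulerSide q a b x - (1 - (∏ j, a j) / (∏ j, b j) * x) * eulerSide q a b (q * x)
      = (∏ j, a j) / (∏ j, b j) * x
        * ∑ i, lowerCoeff (hypWeight a) b i * eulerSide q a (qShift q b i) (q * x) := by
  set y := (∏ j, a j) / (∏ j, b j) * x with hydef
  have h := eulerSum_relation hb hq hq1 a hy
  have hyq : (∏ j, a j) / (∏ j, b j) * (q * x) = q * y := by rw [hydef]; ring
  have hyi : ∀ i, (∏ j, a j) / (∏ j, qShift q b i j) * (q * x) = y := fun i => by
    rw [prod_qShift, hydef]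
    field_simp
  have hx1 := qPochInf_ne_zero hq1 (mul_pow_ne_one hq1 hx)
  have e1 := qPochInf_eq_one_sub_mul hq1 x
  have e2 := qPochInf_eq_one_sub_mul hq1 y
  have hqx : qPochInf q (q * x) ≠ 0 := fun h0 => hx1 (by rw [e1, h0, mul_zero])
  have h1x : 1 - x ≠ 0 := fun h0 => hx1 (by rw [e1, h0, zero_mul])
  simp only [eulerSide, hyq, hyi, ← hydef]
  have h3 : ∑ i, lowerCoeff (hypWeight a) b i
        * (qPochInf q y / qPochInf q (q * x) * eulerSum q a (qShift q b i) y)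
      = qPochInf q y / qPochInf q (q * x)
        * ∑ i, lowerCoeff (hypWeight a) b i * eulerSum q a (qShift q b i) y := by
    rw [Finset.mul_sum]
    exact Finset.sum_congr rfl fun i _ => by ring
  rw [h3, mul_left_comm y, ← h, e1, e2]
  field_simp

theorem eulerSide_eq_basicHyp (hb : QGeneric q b) (hq : q ≠ 0) (hq1 : ‖q‖ < 1)
    (ha : ∀ j, a j ≠ 0) {x : ℂ} (hx : ‖x‖ < 1) (hy : ‖(∏ j, a j) / (∏ j, b j) * x‖ < 1) :
    eulerSide q a b x = basicHyp q a b x := by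
  have hU : ∀ b : Fin M → ℂ, IsOpen {x : ℂ | ‖x‖ < 1 ∧ ‖(∏ j, a j) / (∏ j, b j) * x‖ < 1} :=
    fun b => by
      have h1 : Continuous fun x : ℂ => ‖x‖ := by fun_prop
      have h2 : Continuous fun x : ℂ => ‖(∏ j, a j) / (∏ j, b j) * x‖ := by fun_prop
      exact (isOpen_lt h1 continuous_const).and (isOpen_lt h2 continuous_const)
  have h0U : ∀ b : Fin M → ℂ,
      (0 : ℂ) ∈ {x : ℂ | ‖x‖ < 1 ∧ ‖(∏ j, a j) / (∏ j, b j) * x‖ < 1} := fun b => by simp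
  have hdiff : ∀ b, QGeneric q b → DifferentiableOn ℂ
      (fun x => eulerSide q a b x - basicHyp q a b x)
      {x : ℂ | ‖x‖ < 1 ∧ ‖(∏ j, a j) / (∏ j, b j) * x‖ < 1} := by
    intro b hb
    have hS : DifferentiableOn ℂ (eulerSum q a b) (Metric.ball 0 1) := by
      obtain ⟨K, -, hK⟩ := exists_norm_multiCoeff_le hb hq1 a
      exact differentiableOn_tsum_mul_pow hK fun ρ h0 h1 => summable_pow_multiDeg h0 h1
    have hP := differentiable_qPochInf hq1
    have hlin : Differentiable ℂ fun x : ℂ => (∏ j, a j) / (∏ j, b j) * x := by fun_prop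
    refine DifferentiableOn.sub (DifferentiableOn.mul (DifferentiableOn.div
      (hP.comp hlin).differentiableOn hP.differentiableOn fun x hx =>
        qPochInf_ne_zero hq1 (mul_pow_ne_one hq1 hx.1))
      (hS.comp hlin.differentiableOn fun x hx => mem_ball_zero_iff.mpr hx.2))
      ((differentiableOn_basicHyp hb hq1 a).mono fun x hx => mem_ball_zero_iff.mpr hx.1)
  have hzero := eventually_eq_zero_of_relation hq hq1
    (fun b x => eulerSide q a b x - basicHyp q a b x)
    (fun b => (∏ j, a j) / ∏ j, b j) (fun b => lowerCoeff (hypWeight a) b)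
    (fun b hb => (hdiff b hb).analyticAt ((hU b).mem_nhds (h0U b)))
    (fun b hb => by
      simp [eulerSide, basicHyp_zero, qPochInf_zero, eulerSum, tsum_zero_pow_multiDeg,
        multiCoeff_zero hb])
    (fun b hb => by
      filter_upwards [mem_nhdsWithin_of_mem_nhds ((hU b).mem_nhds (h0U b))] with x hx
      have h1 := eulerSide_relation hb hq hq1 hx.1 hx.2
      have h2 := basicHyp_relation hb hq hq1 ha hx.1
      rw [mul_div_right_comm] at h2
      simp only [mul_sub, Finset.sum_sub_distrib]
      linear_combination h1 - h2) hb
  -- The domain is the intersection of the convex sets |x| < 1 and |Ax/B| < 1, so the identity of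
  -- germs at 0 extends to all of it.
  have hconn : IsPreconnected {x : ℂ | ‖x‖ < 1 ∧ ‖(∏ j, a j) / (∏ j, b j) * x‖ < 1} := by
    have h1 : Convex ℝ {x : ℂ | ‖x‖ < 1} := by
      simpa [Metric.ball] using convex_ball (0 : ℂ) 1
    have h2 : Convex ℝ {x : ℂ | ‖(∏ j, a j) / (∏ j, b j) * x‖ < 1} :=
      h1.linear_preimage (LinearMap.mulLeft ℝ ((∏ j, a j) / (∏ j, b j)))
    exact (h1.inter h2).isPreconnected
  have := ((hdiff b hb).analyticOnNhd (hU b)).eqOn_zero_of_preconnected_of_eventuallyEq_zero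
    hconn (h0U b) hzero (⟨hx, hy⟩ : x ∈ {x : ℂ | ‖x‖ < 1 ∧ _})
  exact sub_eq_zero.mp this

theorem secondTerm_eq (a : Fin (M + 1) → ℂ) (b : Fin M → ℂ) (x : ℂ) (l : Fin M → ℕ) :
    secondTerm q a b x l
      = multiCoeff q (hypWeight a) b l * ((∏ j, a j) / (∏ j, b j) * x) ^ multiDeg l := by
  rw [secondTerm, multiCoeff_hypWeight, mul_div_right_comm]
  ring

end EulerTransformation

/-! ### The q-binomial theorem as the case M = 0. -/

section QBinomial

variable {q : ℂ}

/-- For |αx| < 1 this is the Euler transformation with an empty index set, whose multiple sum is 1.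
In general it holds at q^N x for some N, and the relation, now (1 - x) G(x) = (1 - αx) G(qx),
carries it back to x. -/
theorem basicHyp_one_zero (hq : q ≠ 0) (hq1 : ‖q‖ < 1) {α x : ℂ} (hα : α ≠ 0) (hx : ‖x‖ < 1) :
    basicHyp q (fun _ : Fin 1 => α) (fun i : Fin 0 => i.elim0) x
      = qPochInf q (α * x) / qPochInf q x := by
  have hb : QGeneric q (fun i : Fin 0 => (i.elim0 : ℂ)) :=
    ⟨fun i => i.elim0, fun i => i.elim0, fun i => i.elim0⟩
  have hxN : ∀ N : ℕ, ‖q ^ N * x‖ < 1 := fun N => by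
    rw [norm_mul, norm_pow]
    exact (mul_le_of_le_one_left (norm_nonneg x) (pow_le_one₀ (norm_nonneg q) hq1.le)).trans_lt hx
  have hne : ∀ N : ℕ, qPochInf q (q ^ N * x) ≠ 0 := fun N =>
    qPochInf_ne_zero hq1 (mul_pow_ne_one hq1 (hxN N))
  have hsmall : ∃ N : ℕ, ‖α * (q ^ N * x)‖ < 1 := by
    have ht : Tendsto (fun N : ℕ => ‖α * (q ^ N * x)‖) atTop (𝓝 0) := by
      have := (((tendsto_pow_atTop_nhds_zero_of_norm_lt_one hq1).mul_const x).const_mul α).norm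
      simpa using this
    exact (ht.eventually_lt_const zero_lt_one).exists
  obtain ⟨N, hN⟩ := hsmall
  have key : ∀ n ≤ N, basicHyp q (fun _ : Fin 1 => α) (fun i : Fin 0 => i.elim0) (q ^ n * x)
      = qPochInf q (α * (q ^ n * x)) / qPochInf q (q ^ n * x) := by
    intro n hn
    induction hn using Nat.decreasingInduction with
    | self =>
      rw [← eulerSide_eq_basicHyp hb hq hq1 (fun _ => hα) (hxN N) (by simpa using hN), eulerSide]
      have h1 : ∀ y, eulerSum q (fun _ : Fin 1 => α) (fun i : Fin 0 => (i.elim0 : ℂ)) y = 1 := by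
        intro y
        rw [eulerSum, tsum_eq_single 0 fun l hl => (hl (Subsingleton.elim _ _)).elim]
        rw [multiCoeff_zero hb]
        simp [multiDeg]
      simp [h1]
    | of_succ n _ ih =>
      have h := basicHyp_relation (a := fun _ : Fin 1 => α) hb hq hq1 (fun _ => hα) (hxN n)
      have e1 := qPochInf_eq_one_sub_mul hq1 (q ^ n * x)
      have e2 := qPochInf_eq_one_sub_mul hq1 (α * (q ^ n * x))
      have e3 : q ^ (n + 1) * x = q * (q ^ n * x) := by ring
      have e4 : q * (α * (q ^ n * x)) = α * (q * (q ^ n * x)) := by ring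
      have hn0 := hne n
      have hn1 := hne (n + 1)
      rw [e3] at ih hn1
      rw [e4] at e2
      have h1 : 1 - q ^ n * x ≠ 0 := fun h0 => hn0 (by rw [e1, h0, zero_mul])
      simp only [Finset.univ_eq_empty, Finset.sum_empty, mul_zero, Finset.prod_empty, div_one,
        Finset.prod_const, Finset.card_univ, Fintype.card_fin, zero_add, pow_one, ih] at h
      rw [e1, e2, eq_div_iff (mul_ne_zero h1 hn1)]
      have hdiv := div_mul_cancel₀ (qPochInf q (α * (q * (q ^ n * x)))) hn1
      linear_combination qPochInf q (q * (q ^ n * x)) * h + (1 - α * (q ^ n * x)) * hdiv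
  simpa using key 0 (Nat.zero_le N)

theorem hasSum_qBinomial (hq : q ≠ 0) (hq1 : ‖q‖ < 1) {α x : ℂ} (hα : α ≠ 0) (hx : ‖x‖ < 1) :
    HasSum (fun n => qPoch q α n / qPoch q q n * x ^ n) (qPochInf q (α * x) / qPochInf q x) := by
  have hb : QGeneric q (fun i : Fin 0 => (i.elim0 : ℂ)) :=
    ⟨fun i => i.elim0, fun i => i.elim0, fun i => i.elim0⟩
  rw [← basicHyp_one_zero hq hq1 hα hx]
  simpa [hypCoeff] using hasSum_basicHyp hb hq1 (fun _ : Fin 1 => α) hx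

end QBinomial

/-! ### Terminating expansion of a ratio of q-factorials. -/

section ProductExpansion

variable {q : ℂ} {M : ℕ} {b : Fin M → ℂ} {a : Fin M → ℂ}

/-- The falling product `(1 - q^n)(1 - q^{n-1}) ⋯ (1 - q^{n-k+1})`. -/
noncomputable def qFalling (q : ℂ) (n k : ℕ) : ℂ := ∏ s ∈ Finset.range k, (1 - q ^ (n - s))

theorem qFalling_succ (n k : ℕ) : qFalling q n (k + 1) = qFalling q n k * (1 - q ^ (n - k)) :=
  Finset.prod_range_succ _ _

theorem qFalling_succ_succ (n k : ℕ) :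
    qFalling q (n + 1) (k + 1) = (1 - q ^ (n + 1)) * qFalling q n k := by
  simp [qFalling, Finset.prod_range_succ', mul_comm]

theorem qFalling_add (m k : ℕ) : qFalling q (m + k) k * qPoch q q m = qPoch q q (m + k) := by
  induction k with
  | zero => simp [qFalling]
  | succ k ih =>
    rw [← add_assoc, qFalling_succ_succ, qPoch_succ, ← ih, pow_succ']
    ring

theorem qFalling_self_succ (n : ℕ) : qFalling q n (n + 1) = 0 := by
  rw [qFalling_succ]
  simp

/-- The weight `z ∏_j (1 - z / a_j) / (1 - z)`. -/
noncomputable def hypWeight' {r : ℕ} (a : Fin r → ℂ) (z : ℂ) : ℂ := z * hypWeight a z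

/-- This is `sum_mul_upperPoly_div` at Q = q^n, rearranged as a recursion in n. The weight must be
`hypWeight'`, since its factor z is what that residue sum requires. -/
theorem sum_lowerCoeff_mul_ratio (hb : QGeneric q b) (hq : q ≠ 0) (ha : ∀ j, a j ≠ 0) (n : ℕ) :
    (∏ j, qPoch q (a j) (n + 1)) / ∏ j, qPoch q (b j) (n + 1)
      = (∏ j, qPoch q (a j) n) / (∏ j, qPoch q (b j) n)
        - (∏ j, a j) / (∏ j, b j) * q ^ n * ∑ i, lowerCoeff (hypWeight' a) b i
          * ((∏ j, qPoch q (a j) n) / ∏ j, qPoch q (qShift q b i j) n) := by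
  have hA : ∏ j, a j ≠ 0 := Finset.prod_ne_zero_iff.mpr fun j _ => ha j
  have hB : ∏ j, b j ≠ 0 := Finset.prod_ne_zero_iff.mpr fun j _ => hb.ne_zero j
  have hS := sum_mul_upperPoly_div ha hb.injective hb.ne_zero (pow_ne_zero n hq)
    (fun i => hb.mul_pow_ne_one i n)
  have hterm : ∀ i, lowerCoeff (hypWeight' a) b i
        * ((∏ j, qPoch q (a j) n) / ∏ j, qPoch q (qShift q b i j) n)
      = (∏ j, qPoch q (a j) n) / (∏ j, qPoch q (b j) n)
        * (b i * (∏ j, (1 - b i / a j)) / (1 - b i * q ^ n)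
          * ∏ j ∈ Finset.univ.erase i, b j / (b j - b i)) := by
    intro i
    have h1 : 1 - b i * q ^ n ≠ 0 := sub_ne_zero.mpr (hb.mul_pow_ne_one i n).symm
    have h2 : 1 - b i ≠ 0 := by simpa using sub_ne_zero.mpr (hb.mul_pow_ne_one i 0).symm
    have h3 : qPoch q (b i) n * (1 - b i * q ^ n) = (1 - b i) * qPoch q (q * b i) n := by
      rw [← qPoch_succ, qPoch_succ']
    have h4 : qPoch q (b i) n ≠ 0 := qPoch_ne_zero (hb.mul_pow_ne_one i) n
    have h5 : qPoch q (q * b i) n ≠ 0 := by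
      have := qPoch_ne_zero ((hb.shift hq i).mul_pow_ne_one i) n
      rwa [qShift_self] at this
    have h6 : ∏ j ∈ Finset.univ.erase i, qPoch q (qShift q b i j) n
        = ∏ j ∈ Finset.univ.erase i, qPoch q (b j) n :=
      Finset.prod_congr rfl fun j hj => by rw [qShift_of_ne b (Finset.ne_of_mem_erase hj)]
    have h7 : (1 - b i)⁻¹ * (qPoch q (q * b i) n)⁻¹
        = (qPoch q (b i) n)⁻¹ * (1 - b i * q ^ n)⁻¹ := by
      rw [← mul_inv, ← h3, mul_inv]
    rw [← Finset.mul_prod_erase _ (fun j => qPoch q (qShift q b i j) n) (Finset.mem_univ i),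
      ← Finset.mul_prod_erase _ (fun j => qPoch q (b j) n) (Finset.mem_univ i), h6, qShift_self,
      lowerCoeff, hypWeight', hypWeight]
    simp only [div_eq_mul_inv, mul_inv]
    linear_combination b i * (∏ j, (1 - b i * (a j)⁻¹))
      * (∏ j ∈ Finset.univ.erase i, b j * (b j - b i)⁻¹) * (∏ j, qPoch q (a j) n)
      * (∏ j ∈ Finset.univ.erase i, qPoch q (b j) n)⁻¹ * h7
  rw [Finset.sum_congr rfl fun i _ => hterm i, ← Finset.mul_sum, hS]
  simp only [qPoch_succ, Finset.prod_mul_distrib]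
  have hqn := pow_ne_zero n hq
  have e1 : (∏ j, a j) / (∏ j, b j) * q ^ n * ((∏ j, b j) / (∏ j, a j) / q ^ n) = 1 := by
    field_simp
  rw [mul_div_mul_comm]
  linear_combination ((∏ j, qPoch q (a j) n) / (∏ j, qPoch q (b j) n))
    * (1 - (∏ j, (1 - a j * q ^ n)) / ∏ j, (1 - b j * q ^ n)) * e1

/-- Expansion of `∏_i (a_i)_n / (b_i)_n` in a multiple terminating series. -/
theorem ratio_eq_sum_degSum (hq : q ≠ 0) (hq1 : ‖q‖ < 1) (ha : ∀ j, a j ≠ 0) (n : ℕ)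
    {b : Fin M → ℂ} (hb : QGeneric q b) :
    (∏ j, qPoch q (a j) n) / (∏ j, qPoch q (b j) n)
      = ∑ k ∈ Finset.range (n + 1), qFalling q n k * (-((∏ j, a j) / ∏ j, b j)) ^ k
        * degSum q (hypWeight' a) b (fun _ => 1) k := by
  induction n generalizing b with
  | zero => simp [qPoch_zero, qFalling, degSum, multiCoeff_zero hb]
  | succ n ih =>
    rw [sum_lowerCoeff_mul_ratio hb hq ha, ih hb]
    have hstep : ∑ i, lowerCoeff (hypWeight' a) b i
          * ((∏ j, qPoch q (a j) n) / ∏ j, qPoch q (qShift q b i j) n)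
        = ∑ k ∈ Finset.range (n + 1), qFalling q n k
          * (-((∏ j, a j) / (q * ∏ j, b j))) ^ k
          * ((1 - q ^ (k + 1)) * degSum q (hypWeight' a) b (fun _ => 1) (k + 1)) := by
      simp only [one_sub_mul_degSum hb hq hq1]
      simp only [fun i => ih (hb.shift hq i), Finset.mul_sum, prod_qShift]
      rw [Finset.sum_comm]
      refine Finset.sum_congr rfl fun k _ => Finset.sum_congr rfl fun i _ => ?_
      ring
    rw [hstep, Finset.sum_range_succ' _ (n + 1)]
    -- The range is extended by the term k = n + 1, which vanishes because the falling product then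
    -- contains 1 - q^0.
    have hext : ∑ k ∈ Finset.range (n + 1), qFalling q n k * (-((∏ j, a j) / ∏ j, b j)) ^ k
          * degSum q (hypWeight' a) b (fun _ => 1) k
        = ∑ k ∈ Finset.range (n + 1), qFalling q n (k + 1)
          * (-((∏ j, a j) / ∏ j, b j)) ^ (k + 1) * degSum q (hypWeight' a) b (fun _ => 1) (k + 1)
          + qFalling q n 0 * (-((∏ j, a j) / ∏ j, b j)) ^ 0
          * degSum q (hypWeight' a) b (fun _ => 1) 0 := by
      rw [← Finset.sum_range_succ' (fun k => qFalling q n k * (-((∏ j, a j) / ∏ j, b j)) ^ k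
          * degSum q (hypWeight' a) b (fun _ => 1) k), Finset.sum_range_succ _ (n + 1),
        qFalling_self_succ]
      simp
    rw [hext, Finset.mul_sum, add_sub_right_comm, ← Finset.sum_sub_distrib]
    congr 1
    refine Finset.sum_congr rfl fun k hk => ?_
    have hkn : k ≤ n := Nat.lt_succ_iff.mp (Finset.mem_range.mp hk)
    -- The coefficients match by the Pascal rule 1 - q^{n+1} = (1 - q^{n-k}) + q^{n-k} (1 -
    -- q^{k+1}).
    rw [qFalling_succ_succ, qFalling_succ]
    have hpow : q ^ n = q ^ (n - k) * q ^ k := by rw [← pow_add, Nat.sub_add_cancel hkn]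
    have hB : ∏ j, b j ≠ 0 := Finset.prod_ne_zero_iff.mpr fun j _ => hb.ne_zero j
    have hsplit : (-((∏ j, a j) / (q * ∏ j, b j))) ^ k * q ^ k
        = (-((∏ j, a j) / ∏ j, b j)) ^ k := by
      rw [← mul_pow]
      congr 1
      field_simp
    rw [hpow, pow_succ (-((∏ j, a j) / ∏ j, b j)), ← hsplit, pow_succ q n, pow_succ q k, hpow]
    ring

end ProductExpansion

/-! ### The multiple Jackson transformation. -/

section JacksonTransformation

variable {q : ℂ} {M : ℕ} {b : Fin M → ℂ}

theorem multiCoeff_hypWeight' {r : ℕ} (a : Fin r → ℂ) (b : Fin M → ℂ) (l : Fin M → ℕ) :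
    multiCoeff q (hypWeight' a) b l
      = (∏ i, b i ^ l i * q ^ (l i).choose 2) * multiCoeff q (hypWeight a) b l :=
  multiCoeff_id_mul _ _ _

/-- The factor z of `hypWeight'` contributes q^{binom(l_i, 2)} in each variable, and this decay
beats every geometric growth R^{|l|}. -/
theorem exists_summable_bound {r : ℕ} (hb : QGeneric q b) (hq1 : ‖q‖ < 1) (a : Fin r → ℂ)
    {R : ℝ} (hR : 0 ≤ R) :
    ∃ u : (Fin M → ℕ) → ℝ, Summable u ∧
      ∀ l, ‖multiCoeff q (hypWeight' a) b l‖ * R ^ multiDeg l ≤ u l := by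
  obtain ⟨K, hK0, hK⟩ := exists_norm_multiCoeff_le hb hq1 a
  have hs := summable_prod_pi (f := fun (i : Fin M) (n : ℕ) =>
      (R * ‖b i‖) ^ n * ‖q‖ ^ n.choose 2) (fun i n => by positivity) fun i =>
        summable_pow_mul_pow_choose (by positivity) (norm_nonneg q) hq1
  refine ⟨fun l => K * ∏ i, ((R * ‖b i‖) ^ l i * ‖q‖ ^ (l i).choose 2), hs.mul_left K,
    fun l => ?_⟩
  have h1 : ‖∏ i, b i ^ l i * q ^ (l i).choose 2‖ * R ^ multiDeg l
      = ∏ i, (R * ‖b i‖) ^ l i * ‖q‖ ^ (l i).choose 2 := by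
    rw [norm_prod, ← prod_pow_multiDeg, ← Finset.prod_mul_distrib]
    refine Finset.prod_congr rfl fun i _ => ?_
    rw [norm_mul, norm_pow, norm_pow]
    ring
  rw [multiCoeff_hypWeight', norm_mul, mul_right_comm, h1]
  change _ ≤ K * _
  rw [mul_comm K]
  exact mul_le_mul_of_nonneg_left (hK l) (Finset.prod_nonneg fun i _ => by positivity)

theorem thirdTerm_eq (a : Fin (M + 1) → ℂ) (ha : ∀ j, a j ≠ 0) (b : Fin M → ℂ) (x : ℂ)
    (l : Fin M → ℕ) :
    thirdTerm q a b x l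
      = multiCoeff q (hypWeight' fun j : Fin M => a j.castSucc) b l
        * (-((∏ j : Fin M, a j.castSucc) / (∏ j, b j)) * x) ^ multiDeg l
        * (qPoch q (a (Fin.last M)) (multiDeg l)
          / qPoch q (a (Fin.last M) * x) (multiDeg l)) := by
  have h1 : -((∏ j, a j) * x / (a (Fin.last M) * ∏ j, b j))
      = -((∏ j : Fin M, a j.castSucc) / (∏ j, b j)) * x := by
    rw [Fin.prod_univ_castSucc]
    have := ha (Fin.last M)
    field_simp
  have h2 : ∏ i, (((∏ j : Fin M, qPoch q (b i / a j.castSucc) (l i)) * b i ^ l i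
          * q ^ ((l i).choose 2)) / ((∏ j : Fin M, qPoch q (q * b i / b j) (l i))
          * qPoch q (b i) (l i)))
      = (∏ i, b i ^ l i * q ^ (l i).choose 2)
        * ∏ i, ((∏ j : Fin M, qPoch q (b i / a j.castSucc) (l i))
        / ((∏ j, qPoch q (q * b i / b j) (l i)) * qPoch q (b i) (l i))) := by
    rw [← Finset.prod_mul_distrib]
    exact Finset.prod_congr rfl fun i _ => by ring
  rw [thirdTerm, h1, h2, multiCoeff_hypWeight', multiCoeff_hypWeight]
  ring

theorem summable_thirdTerm (hb : QGeneric q b) (hq1 : ‖q‖ < 1) (a : Fin (M + 1) → ℂ)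
    (ha : ∀ j, a j ≠ 0) {x : ℂ} (hax : ∀ k : ℕ, a (Fin.last M) * x * q ^ k ≠ 1) :
    Summable (thirdTerm q a b x) := by
  obtain ⟨u, hu, hle⟩ := exists_summable_bound hb hq1 (fun j : Fin M => a j.castSucc)
    (norm_nonneg (-((∏ j : Fin M, a j.castSucc) / (∏ j, b j)) * x))
  obtain ⟨K₁, hK₁, h₁⟩ := exists_norm_qPoch_le hq1 ‖a (Fin.last M)‖
  obtain ⟨K₂, hK₂, h₂⟩ := exists_norm_inv_qPoch_le hq1 hax
  refine Summable.of_norm_bounded (hu.mul_right (K₁ * K₂)) fun l => ?_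
  have h3 := hle l
  have h4 := h₁ _ le_rfl (multiDeg l)
  have h5 := h₂ (multiDeg l)
  have h6 : 0 ≤ u l := le_trans (by positivity) h3
  rw [thirdTerm_eq a ha, norm_mul, div_eq_mul_inv (qPoch _ _ _)]
  refine mul_le_mul ?_ ?_ (norm_nonneg _) h6
  · rwa [norm_mul, norm_pow]
  · rw [norm_mul]
    gcongr

/-- In the double series indexed by (k, m), summation over m is a q-binomial sum with parameter
αq^k, while the diagonals k + m = n are given by `ratio_eq_sum_degSum`. -/
theorem tsum_thirdTerm_eq_basicHyp (hb : QGeneric q b) (hq : q ≠ 0) (hq1 : ‖q‖ < 1)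
    (a : Fin (M + 1) → ℂ) (ha : ∀ j, a j ≠ 0) {x : ℂ} (hx : ‖x‖ < 1)
    (hax : ∀ k : ℕ, a (Fin.last M) * x * q ^ k ≠ 1) :
    qPochInf q (a (Fin.last M) * x) / qPochInf q x * ∑' l, thirdTerm q a b x l
      = basicHyp q a b x := by
  set α := a (Fin.last M) with hα
  set a' : Fin M → ℂ := fun j => a j.castSucc with ha'
  set s := -((∏ j, a' j) / ∏ j, b j) with hs
  set C := degSum q (hypWeight' a') b (fun _ => 1) with hC
  have hα0 : α ≠ 0 := ha _
  -- the double series whose two orders of summation give the two sides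
  set u : ℕ × ℕ → ℂ := fun p => C p.1 * (s * x) ^ p.1
    * (qPoch q α (p.1 + p.2) / qPoch q q p.2 * x ^ p.2) with hu
  have hCs : Summable fun k => ‖C k * (s * x) ^ k‖ := by
    obtain ⟨w, hw, hle⟩ := exists_summable_bound hb hq1 a' (norm_nonneg (s * x))
    have h1 : Summable fun l : Fin M → ℕ =>
        multiCoeff q (hypWeight' a') b l * (s * x) ^ multiDeg l :=
      Summable.of_norm_bounded hw fun l => by
        rw [norm_mul, norm_pow]
        exact hle l
    refine ((hasSum_piAntidiag h1.hasSum).summable.congr fun k => ?_).norm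
    rw [hC, degSum, Finset.sum_mul]
    exact Finset.sum_congr rfl fun l hl => by rw [mem_piAntidiag_univ.mp hl, mul_one]
  have husum : Summable u := by
    obtain ⟨K₁, hK₁, h₁⟩ := exists_norm_qPoch_le hq1 ‖α‖
    obtain ⟨K₂, hK₂, h₂⟩ := exists_norm_inv_qPoch_le hq1 (pow_succ_ne_one hq1)
    have hg : Summable fun m : ℕ => K₁ * K₂ * ‖x‖ ^ m :=
      (summable_geometric_of_lt_one (norm_nonneg x) hx).mul_left _
    refine Summable.of_norm_bounded (hCs.mul_of_nonneg hg (fun _ => norm_nonneg _)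
      fun _ => by positivity) fun p => ?_
    have h4 := h₁ α le_rfl (p.1 + p.2)
    have h5 := h₂ p.2
    have h6 : ‖qPoch q α (p.1 + p.2) / qPoch q q p.2 * x ^ p.2‖ ≤ K₁ * K₂ * ‖x‖ ^ p.2 := by
      rw [norm_mul, div_eq_mul_inv, norm_mul, norm_pow]
      gcongr
    exact (norm_mul_le _ _).trans (mul_le_mul_of_nonneg_left h6 (norm_nonneg _))
  have hsmall : ∀ k : ℕ, HasSum (fun m => u (k, m)) (C k * (s * x) ^ k
      * (qPoch q α k * (qPochInf q (α * x * q ^ k) / qPochInf q x))) := by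
    intro k
    have h := ((hasSum_qBinomial hq hq1 (mul_ne_zero hα0 (pow_ne_zero k hq)) hx).mul_left
      (qPoch q α k)).mul_left (C k * (s * x) ^ k)
    rw [mul_right_comm α] at h
    refine h.congr_fun fun m => ?_
    have hsplit : ∀ m, qPoch q α (k + m) = qPoch q α k * qPoch q (α * q ^ k) m := by
      intro m
      simp only [qPoch, Finset.prod_range_add]
      congr 1
      exact Finset.prod_congr rfl fun i _ => by ring
    simp only [hu, hsplit]
    ring
  have H1 : HasSum (fun k => C k * (s * x) ^ k
      * (qPoch q α k * (qPochInf q (α * x * q ^ k) / qPochInf q x))) (∑' p, u p) :=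
    husum.hasSum.prod_fiberwise hsmall
  have H2 : HasSum (fun n => hypCoeff q a b n * x ^ n) (∑' p, u p) := by
    have h := (Finset.HasAntidiagonal.sigmaAntidiagonalEquivProd.hasSum_iff.mpr husum.hasSum).sigma
      (fun n => hasSum_fintype _)
    refine h.congr_fun fun n => ?_
    have h1 : ∑ c : Finset.HasAntidiagonal.antidiagonal n, (u ∘ Finset.HasAntidiagonal.sigmaAntidiagonalEquivProd) ⟨n, c⟩
        = ∑ p ∈ Finset.HasAntidiagonal.antidiagonal n, u p :=
      Finset.sum_coe_sort (Finset.HasAntidiagonal.antidiagonal n) u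
    have h2 := ratio_eq_sum_degSum hq hq1 (a := a') (fun j => ha _) n hb
    rw [h1, Finset.Nat.sum_antidiagonal_eq_sum_range_succ_mk]
    have h3 : hypCoeff q a b n = (∏ j, qPoch q (a' j) n) / (∏ j, qPoch q (b j) n)
        * (qPoch q α n / qPoch q q n) := by
      rw [hypCoeff, Fin.prod_univ_castSucc]
      simp only [ha', hα]
      rw [div_mul_div_comm, mul_comm (qPoch q q n)]
    rw [h3, h2, Finset.sum_mul, Finset.sum_mul]
    refine Finset.sum_congr rfl fun k hk => ?_
    have hkn : k ≤ n := Nat.lt_succ_iff.mp (Finset.mem_range.mp hk)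
    obtain ⟨m, rfl⟩ := Nat.exists_eq_add_of_le' hkn
    have h4 := qFalling_add (q := q) m k
    have h5 : qPoch q q m ≠ 0 := qPoch_ne_zero (pow_succ_ne_one hq1) m
    have h6 : qPoch q q (m + k) ≠ 0 := qPoch_ne_zero (pow_succ_ne_one hq1) (m + k)
    -- The falling product cancels the part of (q)_{m+k} beyond (q)_m, which is why the double
    -- series carries 1/(q)_m.
    have h7 : qFalling q (m + k) k / qPoch q q (m + k) = 1 / qPoch q q m := by
      rw [div_eq_div_iff h6 h5, h4, one_mul]
    simp only [hu, Nat.add_sub_cancel, add_comm k m]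
    rw [← hs, ← hC, mul_pow, pow_add]
    linear_combination s ^ k * C k * qPoch q α (m + k) * x ^ m * x ^ k * h7
  have H3 : HasSum (fun k => C k * (s * x) ^ k
      * (qPoch q α k * (qPochInf q (α * x * q ^ k) / qPochInf q x)))
      (qPochInf q (α * x) / qPochInf q x * ∑' l, thirdTerm q a b x l) := by
    have h := (hasSum_piAntidiag (summable_thirdTerm hb hq1 a ha hax).hasSum).mul_left
      (qPochInf q (α * x) / qPochInf q x)
    refine h.congr_fun fun k => ?_
    have h1 : ∑ l ∈ Finset.piAntidiag Finset.univ k, thirdTerm q a b x l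
        = C k * (s * x) ^ k * (qPoch q α k / qPoch q (α * x) k) := by
      rw [hC, degSum, Finset.sum_mul, Finset.sum_mul]
      refine Finset.sum_congr rfl fun l hl => ?_
      rw [thirdTerm_eq a ha, mem_piAntidiag_univ.mp hl, mul_one]
    have h2 := qPoch_mul_qPochInf hq1 (α * x) k
    have h3 : qPoch q (α * x) k ≠ 0 := qPoch_ne_zero hax k
    have h4 := mul_div_cancel₀ (qPoch q α k) h3
    rw [h1, ← h2]
    linear_combination -(C k * (s * x) ^ k * (qPochInf q (α * x * q ^ k) / qPochInf q x)) * h4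
  rw [H3.unique H1, ← H2.unique (hasSum_basicHyp hb hq1 a hx)]

end JacksonTransformation

/-! ### The partial fraction expansion behind the well-poised series. -/

section WellPoised

open Polynomial

variable {q : ℂ} {M : ℕ} {b : Fin M → ℂ} {a : Fin (M + 1) → ℂ}

/-- The product `∏_j (1 - y_j X / q)`. -/
noncomputable def poisedProd (q X : ℂ) {M : ℕ} (y : Fin M → ℂ) : ℂ := ∏ j, (1 - y j * X / q)

/-- The summands of the partial fraction expansion `poised_eq_sum`. -/
noncomputable def poisedPart (q X : ℂ) {M : ℕ} (b y : Fin M → ℂ) (i : Fin M) : ℂ :=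
  q * ((∏ j, y j) / ∏ j, b j) * ((1 - y i / q) / y i ^ 2) * (∏ j, (y i - b j))
    / (∏ j ∈ Finset.univ.erase i, (y i - y j)) * ∏ j ∈ Finset.univ.erase i, (1 - y j * X / q)

/-- Residues of (1 - z/q) ∏ (z - b_j) / (z² (z - q/X) ∏ (z - y_j)). The degrees leave nothing at
infinity; the double pole at 0 produces the reciprocal sums and the pole at q/X the term with
`poisedProd q X b`. -/
theorem poised_eq_sum (hq : q ≠ 0) {X : ℂ} (hX : X ≠ 0) {b y : Fin M → ℂ} (hb : ∀ j, b j ≠ 0)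
    (hy : Function.Injective y) (hy0 : ∀ j, y j ≠ 0) (hyX : ∀ j, 1 - y j * X / q ≠ 0) :
    ((1 - X) - q * (∑ j, (y j)⁻¹ - ∑ j, (b j)⁻¹)) * poisedProd q X y
        - (∏ j, y j) / (∏ j, b j) * (1 - X) * poisedProd q X b
      = ∑ i, poisedPart q X b y i := by
  have hqX : q / X ≠ 0 := div_ne_zero hq hX
  have hne : ∀ i, y i - q / X ≠ 0 := fun i h => hyX i (by
    rw [sub_eq_zero.mp h]
    field_simp
    ring)
  have hv : Function.Injective (fun o : Option (Fin M) => o.elim (q / X) y) := by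
    rintro (_ | i) (_ | j) h
    · rfl
    · exact absurd (sub_eq_zero.mpr h.symm) (hne j)
    · exact absurd (sub_eq_zero.mpr h) (hne i)
    · exact congrArg some (hy h)
  have hv0 : ∀ o : Option (Fin M), o.elim (q / X) y ≠ 0 := by
    rintro (_ | i)
    exacts [hqX, hy0 i]
  set P : ℂ[X] := (1 - C q⁻¹ * Polynomial.X) * ∏ j, (Polynomial.X - C (b j)) with hP
  have hdeg : P.natDegree ≤ Fintype.card (Option (Fin M)) := by
    rw [Fintype.card_option, Fintype.card_fin, hP, add_comm]
    refine natDegree_mul_le.trans (add_le_add ?_ (natDegree_prod_X_sub b).le)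
    exact (natDegree_sub_le _ _).trans
      (max_le (by simp) ((natDegree_C_mul_le _ _).trans natDegree_X_le))
  have hPe : ∀ z, P.eval z = (1 - z / q) * ∏ j, (z - b j) := by
    intro z
    rw [hP, eval_mul, eval_prod]
    simp [div_eq_inv_mul]
  have hP0 : P.coeff 0 = ∏ j, (-b j) := by
    rw [hP, mul_coeff_zero, coeff_zero_prod_X_sub]
    simp
  have hP1 : P.coeff 1 = -(∏ j, (-b j)) * (∑ j, (b j)⁻¹ + q⁻¹) := by
    rw [hP, mul_coeff_one, coeff_zero_prod_X_sub, coeff_one_prod_X_sub b hb]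
    simp [coeff_one]
    ring
  have key := sum_residues_double _ hv hv0 hdeg
  simp only [Fintype.sum_option, Fintype.prod_option, prod_erase_none, prod_erase_some,
    Option.elim, hPe, hP0, hP1] at key
  have hBy : ∏ j, y j ≠ 0 := Finset.prod_ne_zero_iff.mpr fun j _ => hy0 j
  have hBb : ∏ j, b j ≠ 0 := Finset.prod_ne_zero_iff.mpr fun j _ => hb j
  have hBy' : ∏ j, (-y j) ≠ 0 := Finset.prod_ne_zero_iff.mpr fun j _ => neg_ne_zero.mpr (hy0 j)
  have hΦ : poisedProd q X y ≠ 0 := Finset.prod_ne_zero_iff.mpr fun j _ => hyX j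
  have hprod : ∀ v : Fin M → ℂ, ∏ j, (q / X - v j) = (q / X) ^ M * poisedProd q X v := by
    intro v
    have : (q / X) ^ M = ∏ _j : Fin M, q / X := by
      rw [Finset.prod_const, Finset.card_univ, Fintype.card_fin]
    rw [this, poisedProd, ← Finset.prod_mul_distrib]
    refine Finset.prod_congr rfl fun j _ => ?_
    field_simp
  have hr := prod_neg_div y b
  have hr' : (∏ j, y j) / (∏ j, b j) * (∏ j, (-b j)) / ∏ j, (-y j) = 1 := by
    rw [← hr]
    have : ∏ j, (-b j) ≠ 0 := Finset.prod_ne_zero_iff.mpr fun j _ => neg_ne_zero.mpr (hb j)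
    field_simp
  set ρ := (∏ j, y j) / ∏ j, b j with hρ
  rw [hprod, hprod] at key
  -- The residue relation is multiplied by a common factor: `e1` treats the pole at q/X, `e2` the
  -- poles at y_i, and `e3` the double pole at 0.
  have e1 : (-(q / X)) * (q * ρ * poisedProd q X y) * ((1 - q / X / q)
        * ((q / X) ^ M * poisedProd q X b)
        / ((q / X) ^ 2 * ((q / X) ^ M * poisedProd q X y))) = (1 - X) * ρ * poisedProd q X b := by
    have : (q / X) ^ M ≠ 0 := pow_ne_zero _ hqX
    rw [mul_left_comm ((q / X) ^ 2), mul_left_comm (1 - q / X / q), mul_div_mul_left _ _ this]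
    field_simp
    ring
  have e2 : (-(q / X)) * (q * ρ * poisedProd q X y) * ∑ i, (1 - y i / q) * (∏ j, (y i - b j))
        / (y i ^ 2 * ((y i - q / X) * ∏ j ∈ Finset.univ.erase i, (y i - y j)))
      = ∑ i, poisedPart q X b y i := by
    rw [Finset.mul_sum]
    refine Finset.sum_congr rfl fun i _ => ?_
    have h1 : ∏ j ∈ Finset.univ.erase i, (y i - y j) ≠ 0 :=
      Finset.prod_ne_zero_iff.mpr fun j hj =>
        sub_ne_zero.mpr (hy.ne (Finset.ne_of_mem_erase hj).symm)
    have h2 := hy0 i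
    have h3 := hne i
    have h4 : poisedProd q X y = (1 - y i * X / q)
        * ∏ j ∈ Finset.univ.erase i, (1 - y j * X / q) :=
      (Finset.mul_prod_erase _ (fun j => 1 - y j * X / q) (Finset.mem_univ i)).symm
    have h5 : 1 - y i * X / q = (y i - q / X) / (-(q / X)) := by
      field_simp
      ring
    rw [poisedPart, h4, h5, ← hρ]
    generalize (∏ j ∈ Finset.univ.erase i, (1 - y j * X / q)) = E1 at *
    generalize (∏ j ∈ Finset.univ.erase i, (y i - y j)) = E2 at *
    have h6 : -(q / X) ≠ 0 := neg_ne_zero.mpr hqX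
    generalize y i - q / X = E3 at *
    generalize -(q / X) = E4 at *
    field_simp
  have e3 : (-(q / X)) * (q * ρ * poisedProd q X y) * ((-(∏ j, (-b j)) * (∑ j, (b j)⁻¹ + q⁻¹)
        + (∏ j, (-b j)) * ((q / X)⁻¹ + ∑ j, (y j)⁻¹)) / (-(q / X) * ∏ j, (-y j)))
      = -(((1 - X) - q * (∑ j, (y j)⁻¹ - ∑ j, (b j)⁻¹)) * poisedProd q X y) := by
    have h6 : -(q / X) ≠ 0 := neg_ne_zero.mpr hqX
    have h7 : q * (-(∑ j, (b j)⁻¹ + q⁻¹) + ((q / X)⁻¹ + ∑ j, (y j)⁻¹))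
        = -((1 - X) - q * (∑ j, (y j)⁻¹ - ∑ j, (b j)⁻¹)) := by
      field_simp
      ring
    calc _ = (ρ * (∏ j, (-b j)) / ∏ j, (-y j)) * (q * (-(∑ j, (b j)⁻¹ + q⁻¹)
          + ((q / X)⁻¹ + ∑ j, (y j)⁻¹))) * poisedProd q X y := by
          generalize -(q / X) = E4 at *
          field_simp
      _ = _ := by rw [hr', h7]; ring
  have := congrArg (fun t => (-(q / X)) * (q * ρ * poisedProd q X y) * t) key
  simp only [mul_add, mul_zero] at this e3
  rw [e1, e2, e3] at this
  linear_combination -this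

end WellPoised

/-! ### The contiguous relation between consecutive degrees. -/

section WellPoisedRecurrence

variable {q : ℂ} {M : ℕ} {b : Fin M → ℂ} {a : Fin (M + 1) → ℂ}

/-- The part omits exactly the factor of `poisedProd` that moves with l_i. After cancellation
against `multiCoeff_add_single`, what remains is a summand of `sum_upperPoly_div` at the points b_j
q^{l_j} with Q = X/q. -/
theorem multiCoeff_mul_poisedPart (hb : QGeneric q b) (hq : q ≠ 0) (hq1 : ‖q‖ < 1) {X : ℂ}
    (hbX : ∀ j, ∀ k : ℕ, b j * q ^ k * (X / q) ≠ 1) (i : Fin M) (l : Fin M → ℕ) :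
    multiCoeff q (hypWeight' a) b (l + Pi.single i 1)
        * poisedPart q X b (fun j => b j * q ^ (l + Pi.single i 1 : Fin M → ℕ) j) i
      = -(multiCoeff q (hypWeight' a) b l * poisedProd q X (fun j => b j * q ^ l j)
        * ((∏ j, (1 - b i * q ^ l i / a j)) / (1 - b i * q ^ l i * (X / q))
          * ∏ j ∈ Finset.univ.erase i, b j * q ^ l j / (b j * q ^ l j - b i * q ^ l i))) := by
  set y : Fin M → ℂ := fun j => b j * q ^ l j with hy
  have hyinj : Function.Injective y := hb.mul_pow_injective hq l
  have hy0 : ∀ j, y j ≠ 0 := fun j => mul_ne_zero (hb.ne_zero j) (pow_ne_zero _ hq)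
  have hy' : (fun j => b j * q ^ (l + Pi.single i 1 : Fin M → ℕ) j)
      = Function.update y i (q * y i) := by
    funext j
    rcases eq_or_ne j i with rfl | h
    · simp [hy, pow_succ]; ring
    · simp [hy, h]
  have hE : ∀ f : ℂ → ℂ, ∏ j ∈ Finset.univ.erase i, f (Function.update y i (q * y i) j)
      = ∏ j ∈ Finset.univ.erase i, f (y j) := fun f =>
    Finset.prod_congr rfl fun j hj => by rw [Function.update_of_ne (Finset.ne_of_mem_erase hj)]
  have hprod : ∏ j, Function.update y i (q * y i) j = q * ∏ j, y j := prod_qShift y i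
  have hBy : ∏ j, y j ≠ 0 := Finset.prod_ne_zero_iff.mpr fun j _ => hy0 j
  have hBb : ∏ j, b j ≠ 0 := Finset.prod_ne_zero_iff.mpr fun j _ => hb.ne_zero j
  have h1 : ∏ j ∈ Finset.univ.erase i, (y i - y j) ≠ 0 :=
    Finset.prod_ne_zero_iff.mpr fun j hj =>
      sub_ne_zero.mpr (hyinj.ne (Finset.ne_of_mem_erase hj).symm)
  have h2 : ∏ j ∈ Finset.univ.erase i, (q * y i - y j) ≠ 0 := by
    refine Finset.prod_ne_zero_iff.mpr fun j hj => sub_ne_zero.mpr ?_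
    have hinj := hb.mul_pow_injective hq (l + Pi.single i 1)
    rw [hy'] at hinj
    have := hinj.ne (Finset.ne_of_mem_erase hj).symm
    rwa [Function.update_self, Function.update_of_ne (Finset.ne_of_mem_erase hj)] at this
  have h3 : ∏ j, (q * y i - b j) ≠ 0 := by
    refine Finset.prod_ne_zero_iff.mpr fun j _ => sub_ne_zero.mpr fun h => ?_
    rcases eq_or_ne i j with rfl | hij
    · refine pow_succ_ne_one hq1 (l i) (mul_left_cancel₀ (hb.ne_zero i) ?_)
      rw [mul_one]
      conv_rhs => rw [← h]
      simp only [hy]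
      ring
    · refine hb.mul_pow_ne i j hij (l i + 1) ?_
      rw [← h]
      simp only [hy]
      ring
  have h4 : 1 - y i ≠ 0 := sub_ne_zero.mpr (hb.mul_pow_ne_one i (l i)).symm
  have h5 : 1 - y i * (X / q) ≠ 0 := sub_ne_zero.mpr (hbX i (l i)).symm
  have hΦ : poisedProd q X y = (1 - y i * (X / q))
      * ∏ j ∈ Finset.univ.erase i, (1 - y j * X / q) := by
    rw [poisedProd, ← Finset.mul_prod_erase _ _ (Finset.mem_univ i), mul_div_assoc]
  have h6 : ∏ j, b j / (b j - q * y i) = (∏ j, (-b j)) / ∏ j, (q * y i - b j) := by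
    rw [← Finset.prod_div_distrib]
    exact Finset.prod_congr rfl fun j _ => by rw [← neg_div_neg_eq, neg_sub]
  have h7 : (∏ j, y j) / (∏ j, b j) * ∏ j, (-b j) = ∏ j, (-y j) := by
    have := prod_neg_div y b
    rw [← this, div_mul_cancel₀]
    exact Finset.prod_ne_zero_iff.mpr fun j _ => neg_ne_zero.mpr (hb.ne_zero j)
  have h8 := prod_erase_div_sub y hyinj hy0 i
  have hmul := multiCoeff_add_single hb hq (hypWeight' a) i l
  change multiCoeff q (hypWeight' a) b (l + Pi.single i 1) = multiCoeff q (hypWeight' a) b l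
    * hypWeight' a (y i) * (∏ j ∈ Finset.univ.erase i, (q * y i - y j) / (y i - y j))
    * ∏ j, b j / (b j - q * y i) at hmul
  have hyi := hy0 i
  rw [hy', hmul, poisedPart, hprod, Function.update_self, hE (fun z => q * y i - z),
    hE (fun z => 1 - z * X / q), Finset.prod_div_distrib, h6, hypWeight', hypWeight, hΦ]
  change _ = -(multiCoeff q (hypWeight' a) b l * _ * ((∏ j, (1 - y i / a j)) / (1 - y i * (X / q))
    * ∏ j ∈ Finset.univ.erase i, y j / (y j - y i)))
  rw [h8, ← h7]
  generalize (∏ j, (q * y i - b j)) = E1 at *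
  generalize (∏ j ∈ Finset.univ.erase i, (q * y i - y j)) = E2 at *
  generalize (∏ j ∈ Finset.univ.erase i, (y i - y j)) = E3 at *
  generalize (∏ j ∈ Finset.univ.erase i, (1 - y j * X / q)) = E4 at *
  generalize (∏ j, (1 - y i / a j)) = E5 at *
  generalize (∏ j, (-b j)) = E6 at *
  generalize 1 - y i * (X / q) = E7 at *
  rw [mul_div_cancel_left₀ _ hq]
  field_simp

/-- The contiguous relation between the sums over `|l| = n + 1` and over `|l| = n` of the
well-poised series. -/
theorem poised_recurrence (hb : QGeneric q b) (hq : q ≠ 0) (hq1 : ‖q‖ < 1) (ha : ∀ j, a j ≠ 0)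
    {X : ℂ} (hX : X ≠ 0) (hbX : ∀ j, ∀ k : ℕ, b j * q ^ k * (X / q) ≠ 1) (n : ℕ) :
    (1 - X) * degSum q (hypWeight' a) b (poisedProd q X) (n + 1)
        + (1 - (∏ j, b j) * q ^ (n + 1) / ((∏ j, a j) * X))
          * degSum q (hypWeight' a) b (poisedProd q X) n
        - q * degSum q (hypWeight' a) b
          (fun y => (∑ j, (y j)⁻¹ - ∑ j, (b j)⁻¹) * poisedProd q X y) (n + 1)
      = q ^ (n + 1) * degSum q (hypWeight' a) b (fun _ => 1) (n + 1)
          * ((1 - X) * poisedProd q X b)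
        - (∏ j, b j) * q ^ (n + 1) / ((∏ j, a j) * X)
          * degSum q (hypWeight' a) b (fun _ => 1) n * ∏ j, (1 - a j * (X / q)) := by
  have hXq : X / q ≠ 0 := div_ne_zero hX hq
  have hyX : ∀ (l : Fin M → ℕ) j, 1 - b j * q ^ l j * X / q ≠ 0 := fun l j => by
    rw [mul_div_assoc]
    exact sub_ne_zero.mpr (hbX j (l j)).symm
  have hA : (1 - X) * degSum q (hypWeight' a) b (poisedProd q X) (n + 1)
      - q * degSum q (hypWeight' a) b
        (fun y => (∑ j, (y j)⁻¹ - ∑ j, (b j)⁻¹) * poisedProd q X y) (n + 1)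
      - q ^ (n + 1) * degSum q (hypWeight' a) b (fun _ => 1) (n + 1)
        * ((1 - X) * poisedProd q X b)
      = ∑ l ∈ Finset.piAntidiag Finset.univ (n + 1), ∑ i, multiCoeff q (hypWeight' a) b l
        * poisedPart q X b (fun j => b j * q ^ l j) i := by
    simp only [degSum, Finset.mul_sum, Finset.sum_mul]
    rw [← Finset.sum_sub_distrib, ← Finset.sum_sub_distrib]
    refine Finset.sum_congr rfl fun l hl => ?_
    have h := poised_eq_sum hq hX hb.ne_zero (hb.mul_pow_injective hq l)
      (fun j => mul_ne_zero (hb.ne_zero j) (pow_ne_zero _ hq)) (hyX l)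
    rw [prod_mul_pow_div hb, mem_piAntidiag_univ.mp hl] at h
    rw [← Finset.mul_sum, ← h]
    ring
  rw [sum_piAntidiag_succ (fun l i => multiCoeff q (hypWeight' a) b l
        * poisedPart q X b (fun j => b j * q ^ l j) i)] at hA
  swap
  · intro l i h
    -- The terms with l_i = 0 vanish since y_i = b_i is then a zero of the numerator.
    have : ∏ j, (b i * q ^ l i - b j) = 0 :=
      Finset.prod_eq_zero (Finset.mem_univ i) (by simp [h])
    simp [poisedPart, this]
  have hB : ∑ l ∈ Finset.piAntidiag Finset.univ n, ∑ i,
        multiCoeff q (hypWeight' a) b (l + Pi.single i 1)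
        * poisedPart q X b (fun j => b j * q ^ (l + Pi.single i 1 : Fin M → ℕ) j) i
      = -((1 - (∏ j, b j) * q ^ (n + 1) / ((∏ j, a j) * X))
          * degSum q (hypWeight' a) b (poisedProd q X) n
        + (∏ j, b j) * q ^ (n + 1) / ((∏ j, a j) * X)
          * degSum q (hypWeight' a) b (fun _ => 1) n * ∏ j, (1 - a j * (X / q))) := by
    simp only [multiCoeff_mul_poisedPart hb hq hq1 hbX, degSum, Finset.mul_sum, Finset.sum_mul]
    rw [← Finset.sum_add_distrib, ← Finset.sum_neg_distrib]
    refine Finset.sum_congr rfl fun l hl => ?_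
    have h := sum_upperPoly_div ha (hb.mul_pow_injective hq l)
      (fun j => mul_ne_zero (hb.ne_zero j) (pow_ne_zero _ hq)) hXq (fun i => hbX i (l i))
    rw [Finset.sum_neg_distrib, ← Finset.mul_sum, h]
    have hΦ : ∏ j, (1 - b j * q ^ l j * (X / q)) = poisedProd q X fun j => b j * q ^ l j :=
      Finset.prod_congr rfl fun j _ => by rw [mul_div_assoc]
    have hΦ0 : (poisedProd q X fun j => b j * q ^ l j) ≠ 0 :=
      Finset.prod_ne_zero_iff.mpr fun j _ => hyX l j
    have hBb : ∏ j, b j ≠ 0 := Finset.prod_ne_zero_iff.mpr fun j _ => hb.ne_zero j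
    have hp : ∏ j, b j * q ^ l j = (∏ j, b j) * q ^ n := by
      rw [← mem_piAntidiag_univ.mp hl, ← prod_mul_pow_div hb, mul_div_cancel₀ _ hBb]
    rw [hΦ, hp, pow_succ]
    have hAa : ∏ j, a j ≠ 0 := Finset.prod_ne_zero_iff.mpr fun j _ => ha j
    generalize (∏ j, (1 - a j * (X / q))) = E1 at *
    field_simp
    ring
  rw [hB] at hA
  linear_combination hA

end WellPoisedRecurrence

/-! ### The relation for the degree parts, up to a telescoping difference. -/

section WellPoisedSeries

variable {q : ℂ} {M : ℕ} {b : Fin M → ℂ} {a : Fin (M + 1) → ℂ}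

/-- The `q`-factorials of the well-poised series that depend only on the total degree. -/
noncomputable def poisedWeight (q : ℂ) {M : ℕ} (a : Fin (M + 1) → ℂ) (b : Fin M → ℂ) (X : ℂ) : ℂ :=
  (∏ j, qPochInf q (a j * X)) / (qPochInf q X * ∏ i, qPochInf q (b i * X / q))

/-- The denominator of `poisedWeight`. -/
noncomputable def poisedDenom (q : ℂ) {M : ℕ} (b : Fin M → ℂ) (x : ℂ) : ℂ :=
  qPochInf q x * ∏ i, qPochInf q (b i * x / q)

/-- The terms of the well-poised series, multiplied by `poisedDenom`. -/
noncomputable def poisedTerm (q : ℂ) {M : ℕ} (a : Fin (M + 1) → ℂ) (b : Fin M → ℂ) (x : ℂ)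
    (l : Fin M → ℕ) : ℂ :=
  qPoch q x (multiDeg l) * (∏ i, qPoch q (b i * x / q) (multiDeg l))
    * (∏ j, qPochInf q (a j * x * q ^ multiDeg l))
    * (((∏ j, a j) / (∏ j, b j) * x) ^ multiDeg l * q ^ (multiDeg l).choose 2)
    * multiCoeff q (hypWeight' a) b l
    * poisedProd q (x * q ^ multiDeg l) fun j => b j * q ^ l j

/-- The part of degree `n` of the well-poised series. -/
noncomputable def poisedDegTerm (q : ℂ) {M : ℕ} (a : Fin (M + 1) → ℂ) (b : Fin M → ℂ) (x : ℂ)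
    (n : ℕ) : ℂ :=
  ((∏ j, a j) / (∏ j, b j) * x) ^ n * q ^ n.choose 2 * poisedWeight q a b (x * q ^ n)
    * degSum q (hypWeight' a) b (poisedProd q (x * q ^ n)) n

/-- The sequence whose differences appear in the relation for the well-poised series. -/
noncomputable def poisedTail (q : ℂ) {M : ℕ} (a : Fin (M + 1) → ℂ) (b : Fin M → ℂ) (x : ℂ)
    (n : ℕ) : ℂ :=
  poisedWeight q a b (x * q ^ n) * ((1 - x * q ^ n) * poisedProd q (x * q ^ n) b)
    * (((∏ j, a j) / (∏ j, b j) * x) ^ n * q ^ n.choose 2 * q ^ n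
      * degSum q (hypWeight' a) b (fun _ => 1) n)

/-- A neighbourhood of the origin on which `poisedDenom` has no zeros. -/
def poisedDomain (q : ℂ) {M : ℕ} (b : Fin M → ℂ) : Set ℂ := {x | ‖x‖ < 1 ∧ ∀ j, ‖b j * x / q‖ < 1}

theorem isOpen_poisedDomain (q : ℂ) (b : Fin M → ℂ) : IsOpen (poisedDomain q b) := by
  have h1 : Continuous fun x : ℂ => ‖x‖ := by fun_prop
  refine (isOpen_lt h1 continuous_const).and ?_
  simp only [Set.ofPred_forall]
  refine isOpen_iInter_of_finite fun j => ?_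
  have h2 : Continuous fun x : ℂ => ‖b j * x / q‖ := by fun_prop
  exact isOpen_lt h2 continuous_const

theorem zero_mem_poisedDomain (q : ℂ) (b : Fin M → ℂ) : (0 : ℂ) ∈ poisedDomain q b := by
  simp [poisedDomain]

theorem mul_mem_poisedDomain (hq1 : ‖q‖ < 1) {x : ℂ} (hx : x ∈ poisedDomain q b) :
    q * x ∈ poisedDomain q b := by
  have h : ∀ z : ℂ, ‖z‖ < 1 → ‖q * z‖ < 1 := fun z hz => by
    rw [norm_mul]
    exact mul_lt_one_of_nonneg_of_lt_one_left (norm_nonneg q) hq1 hz.le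
  refine ⟨h x hx.1, fun j => ?_⟩
  rw [mul_left_comm, mul_div_assoc]
  exact h _ (hx.2 j)

theorem mul_pow_mem_poisedDomain (hq1 : ‖q‖ < 1) {x : ℂ} (hx : x ∈ poisedDomain q b) (n : ℕ) :
    x * q ^ n ∈ poisedDomain q b := by
  induction n with
  | zero => simpa using hx
  | succ n ih =>
    have := mul_mem_poisedDomain hq1 ih
    rwa [pow_succ, ← mul_assoc, mul_comm]

theorem mul_mem_poisedDomain_qShift (hq1 : ‖q‖ < 1) {x : ℂ} (hx : x ∈ poisedDomain q b)
    (i : Fin M) : q * x ∈ poisedDomain q (qShift q b i) := by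
  have h : ∀ z : ℂ, ‖z‖ < 1 → ‖q * z‖ < 1 := fun z hz => by
    rw [norm_mul]
    exact mul_lt_one_of_nonneg_of_lt_one_left (norm_nonneg q) hq1 hz.le
  refine ⟨h x hx.1, fun j => ?_⟩
  rcases eq_or_ne j i with rfl | hj
  · have : qShift q b j j * (q * x) / q = q * (q * (b j * x / q)) := by
      rw [qShift_self]; ring
    rw [this]
    exact h _ (h _ (hx.2 j))
  · rw [qShift_of_ne b hj, mul_left_comm, mul_div_assoc]
    exact h _ (hx.2 j)

theorem poisedDenom_ne_zero (hq1 : ‖q‖ < 1) {x : ℂ} (hx : x ∈ poisedDomain q b) :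
    poisedDenom q b x ≠ 0 :=
  mul_ne_zero (qPochInf_ne_zero hq1 (mul_pow_ne_one hq1 hx.1))
    (Finset.prod_ne_zero_iff.mpr fun i _ => qPochInf_ne_zero hq1 (mul_pow_ne_one hq1 (hx.2 i)))

theorem poisedWeight_mul (hq1 : ‖q‖ < 1) {X : ℂ} (hX : X ∈ poisedDomain q b) :
    poisedWeight q a b (q * X) * ∏ j, (1 - a j * X)
      = poisedWeight q a b X * ((1 - X) * poisedProd q X b) := by
  have h1 := poisedDenom_ne_zero hq1 hX
  have h2 := poisedDenom_ne_zero hq1 (mul_mem_poisedDomain hq1 hX)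
  have e1 : (∏ j, qPochInf q (a j * X))
      = (∏ j, (1 - a j * X)) * ∏ j, qPochInf q (a j * (q * X)) := by
    rw [← Finset.prod_mul_distrib]
    refine Finset.prod_congr rfl fun j _ => ?_
    rw [qPochInf_eq_one_sub_mul hq1, mul_left_comm]
  have e2 : poisedDenom q b X = ((1 - X) * poisedProd q X b) * poisedDenom q b (q * X) := by
    have : (∏ i, qPochInf q (b i * X / q))
        = poisedProd q X b * ∏ i, qPochInf q (b i * (q * X) / q) := by
      rw [poisedProd, ← Finset.prod_mul_distrib]
      refine Finset.prod_congr rfl fun j _ => ?_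
      rw [qPochInf_eq_one_sub_mul hq1, mul_left_comm (b j), mul_div_assoc q]
    rw [poisedDenom, poisedDenom, this, qPochInf_eq_one_sub_mul hq1 X]
    ring
  change (∏ j, qPochInf q (a j * (q * X))) / poisedDenom q b (q * X) * _
    = (∏ j, qPochInf q (a j * X)) / poisedDenom q b X * _
  have h3 : (1 - X) * poisedProd q X b ≠ 0 := fun h => h1 (by rw [e2, h, zero_mul])
  rw [e1, e2, mul_comm (∏ j, (1 - a j * X)), mul_comm _ (poisedDenom q b (q * X)),
    div_mul_eq_mul_div, div_mul_eq_mul_div, mul_div_mul_right _ _ h3]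

/-- The denominator factor (b_i X/q)_∞ loses its first factor under the shift. -/
theorem poisedWeight_qShift (hq1 : ‖q‖ < 1) {X : ℂ} (hX : X ∈ poisedDomain q b)
    (i : Fin M) :
    poisedWeight q a (qShift q b i) X = poisedWeight q a b X * (1 - b i * X / q) := by
  have h1 := poisedDenom_ne_zero hq1 hX
  have e2 : poisedDenom q b X = (1 - b i * X / q) * poisedDenom q (qShift q b i) X := by
    rw [poisedDenom, poisedDenom, ← Finset.mul_prod_erase _ _ (Finset.mem_univ i),
      ← Finset.mul_prod_erase _ (fun j => qPochInf q (qShift q b i j * X / q)) (Finset.mem_univ i),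
      qShift_self, qPochInf_eq_one_sub_mul hq1 (b i * X / q)]
    have h : ∏ j ∈ Finset.univ.erase i, qPochInf q (qShift q b i j * X / q)
        = ∏ j ∈ Finset.univ.erase i, qPochInf q (b j * X / q) :=
      Finset.prod_congr rfl fun j hj => by rw [qShift_of_ne b (Finset.ne_of_mem_erase hj)]
    rw [h, mul_assoc q, mul_div_assoc q]
    ring
  change _ / poisedDenom q (qShift q b i) X = _ / poisedDenom q b X * _
  have h3 : (1 - b i * X / q) ≠ 0 := fun h => h1 (by rw [e2, h, zero_mul])
  have h4 : poisedDenom q (qShift q b i) X ≠ 0 := fun h => h1 (by rw [e2, h, mul_zero])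
  rw [e2, div_mul_eq_mul_div, mul_comm (1 - _), mul_div_mul_right _ _ h3]

theorem lowerCoeff_hypWeight' (hb : QGeneric q b) (i : Fin M) :
    lowerCoeff (hypWeight' a) b i / b i = lowerCoeff (hypWeight a) b i := by
  rw [lowerCoeff, lowerCoeff, hypWeight', mul_assoc, mul_div_cancel_left₀ _ (hb.ne_zero i)]

/-- Degree n + 1 at x is paired with degree n at qx, so that all terms share X = x q^{n+1}. The two
lowering identities rewrite the shifted sums, `poised_recurrence` reduces them to unweighted degree
sums, and `poisedWeight_mul` identifies these as two consecutive tails. -/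
theorem poisedDegTerm_relation (hb : QGeneric q b) (hq : q ≠ 0) (hq1 : ‖q‖ < 1)
    (ha : ∀ j, a j ≠ 0) {x : ℂ} (hx : x ∈ poisedDomain q b) (hx0 : x ≠ 0) (n : ℕ) :
    (1 - x) * poisedDegTerm q a b x (n + 1)
        - (1 - (∏ j, a j) / (∏ j, b j) * x) * poisedDegTerm q a b (q * x) n
        - (∏ j, a j) / (∏ j, b j) * x
          * ∑ i, lowerCoeff (hypWeight a) b i * poisedDegTerm q a (qShift q b i) (q * x) n
      = poisedTail q a b x (n + 1) - poisedTail q a b x n := by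
  have hXn := mul_pow_mem_poisedDomain hq1 hx n
  have hX := mul_pow_mem_poisedDomain hq1 hx (n + 1)
  have hAa : ∏ j, a j ≠ 0 := Finset.prod_ne_zero_iff.mpr fun j _ => ha j
  have hBb : ∏ j, b j ≠ 0 := Finset.prod_ne_zero_iff.mpr fun j _ => hb.ne_zero j
  have hW := poisedWeight_mul (a := a) hq1 hXn
  have eX : q * (x * q ^ n) = x * q ^ (n + 1) := by ring
  have eX' : q * x * q ^ n = x * q ^ (n + 1) := by ring
  have eXq : x * q ^ (n + 1) / q = x * q ^ n := by rw [← eX, mul_div_cancel_left₀ _ hq]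
  have hX0 : x * q ^ (n + 1) ≠ 0 := mul_ne_zero hx0 (pow_ne_zero _ hq)
  have hrec := poised_recurrence hb hq hq1 ha hX0 (fun j k => by
    have := mul_pow_ne_one hq1 (hX.2 j) k
    rwa [mul_div_assoc, mul_right_comm] at this) n
  have hlow := one_sub_mul_degSum hb hq hq1 (hypWeight' a) (poisedProd q (x * q ^ (n + 1))) n
  have hlow' := sum_lowerCoeff_div_mul_degSum hb hq hq1 (hypWeight' a)
    (poisedProd q (x * q ^ (n + 1))) n
  rw [eXq] at hrec
  rw [eX] at hW
  set y := (∏ j, a j) / (∏ j, b j) * x with hy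
  have hy0 : y ≠ 0 := mul_ne_zero (div_ne_zero hAa hBb) hx0
  have ht : (∏ j, b j) * q ^ (n + 1) / ((∏ j, a j) * (x * q ^ (n + 1))) = 1 / y := by
    have := pow_ne_zero (n + 1) hq
    rw [hy]
    field_simp
  rw [ht] at hrec
  have eyq : (∏ j, a j) / (∏ j, b j) * (q * x) = q * y := by rw [hy]; ring
  have eyi : ∀ i, (∏ j, a j) / (∏ j, qShift q b i j) * (q * x) = y := fun i => by
    rw [prod_qShift, hy]
    field_simp
  set W := poisedWeight q a b (x * q ^ (n + 1)) with hWdef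
  set I := degSum q (hypWeight' a) b (poisedProd q (x * q ^ (n + 1)))
  -- The shifted weight brings 1 - b_i x q^n, while δ_i is the coefficient for `hypWeight'` divided
  -- by b_i. The product splits into one sum with 1/b_i and one without, matching the two lowering
  -- identities.
  have hsum : ∑ i, lowerCoeff (hypWeight a) b i * poisedDegTerm q a (qShift q b i) (q * x) n
      = y ^ n * q ^ n.choose 2 * W * ((∑ i, lowerCoeff (hypWeight' a) b i / b i
          * degSum q (hypWeight' a) (qShift q b i) (poisedProd q (x * q ^ (n + 1))) n)
        - x * q ^ n * ∑ i, lowerCoeff (hypWeight' a) b i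
          * degSum q (hypWeight' a) (qShift q b i) (poisedProd q (x * q ^ (n + 1))) n) := by
    rw [Finset.mul_sum, ← Finset.sum_sub_distrib, Finset.mul_sum]
    refine Finset.sum_congr rfl fun i _ => ?_
    rw [poisedDegTerm, eyi, eX', poisedWeight_qShift hq1 hX, ← lowerCoeff_hypWeight' hb,
      mul_div_assoc (b i), eXq, ← hWdef]
    have := hb.ne_zero i
    field_simp
  rw [hsum, ← hlow, hlow']
  simp only [poisedDegTerm, poisedTail, ← hy, eyq, eX', ← hWdef]
  rw [← hW, Nat.choose_succ_succ' n 1, Nat.choose_one_right]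
  set S := degSum q (hypWeight' a) b (fun _ => 1)
  set J := degSum q (hypWeight' a) b
    (fun z => (∑ j, (z j)⁻¹ - ∑ j, (b j)⁻¹) * poisedProd q (x * q ^ (n + 1)) z) (n + 1)
  have h1 : y * (1 / y) = 1 := mul_one_div_cancel hy0
  generalize 1 / y = t at *
  rw [pow_add q n, pow_succ y, mul_pow q y]
  linear_combination (W * y ^ n * q ^ n.choose 2 * q ^ n * y) * hrec
    + (W * y ^ n * q ^ n.choose 2 * q ^ n * (I n - S n * ∏ j, (1 - a j * (x * q ^ n)))) * h1

end WellPoisedSeries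

/-! ### Summing the well-poised series. -/

section WellPoisedSum

variable {q : ℂ} {M : ℕ} {b : Fin M → ℂ} {a : Fin (M + 1) → ℂ}

/-- With `poisedDenom` multiplied in, no denominator depends on x, so one majorant serves the whole
unit disc. -/
theorem exists_norm_poisedTerm_le (hb : QGeneric q b) (hq1 : ‖q‖ < 1) (a : Fin (M + 1) → ℂ) :
    ∃ u : (Fin M → ℕ) → ℝ, Summable u ∧ ∀ l, ∀ x : ℂ, ‖x‖ < 1 → ‖poisedTerm q a b x l‖ ≤ u l := by
  obtain ⟨u, hu, hle⟩ := exists_summable_bound hb hq1 a (norm_nonneg ((∏ j, a j) / ∏ j, b j))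
  obtain ⟨K₁, hK₁, h₁⟩ := exists_norm_qPoch_le hq1 1
  choose K₂ hK₂ h₂ using fun i => exists_norm_qPoch_le hq1 ‖b i / q‖
  choose K₃ hK₃ h₃ using fun j => exists_norm_qPochInf_le hq1 ‖a j‖
  refine ⟨fun l => K₁ * (∏ i, K₂ i) * (∏ j, K₃ j) * (∏ j, (1 + ‖b j / q‖)) * u l, hu.mul_left _,
    fun l x hx => ?_⟩
  have hpow : ∀ n : ℕ, ‖q ^ n‖ ≤ 1 := fun n => by
    rw [norm_pow]
    exact pow_le_one₀ (norm_nonneg q) hq1.le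
  have e1 : ‖∏ i, qPoch q (b i * x / q) (multiDeg l)‖ ≤ ∏ i, K₂ i := by
    rw [norm_prod]
    refine Finset.prod_le_prod (fun _ _ => norm_nonneg _) fun i _ => h₂ i _ ?_ _
    rw [mul_div_right_comm, norm_mul]
    exact mul_le_of_le_one_right (norm_nonneg _) hx.le
  have e2 : ‖∏ j, qPochInf q (a j * x * q ^ multiDeg l)‖ ≤ ∏ j, K₃ j := by
    rw [norm_prod]
    refine Finset.prod_le_prod (fun _ _ => norm_nonneg _) fun j _ => h₃ j _ ?_
    rw [mul_assoc, norm_mul, norm_mul]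
    exact mul_le_of_le_one_right (norm_nonneg _)
      (mul_le_one₀ hx.le (norm_nonneg _) (hpow _))
  have e3 : ‖poisedProd q (x * q ^ multiDeg l) fun j => b j * q ^ l j‖
      ≤ ∏ j, (1 + ‖b j / q‖) := by
    rw [poisedProd, norm_prod]
    refine Finset.prod_le_prod (fun _ _ => norm_nonneg _) fun j _ => ?_
    refine (norm_sub_le _ _).trans ?_
    rw [norm_one]
    have : b j * q ^ l j * (x * q ^ multiDeg l) / q
        = b j / q * (q ^ l j * (x * q ^ multiDeg l)) := by ring
    rw [this, norm_mul, norm_mul, norm_mul]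
    gcongr
    exact mul_le_of_le_one_right (norm_nonneg _)
      (mul_le_one₀ (hpow _) (by positivity) (mul_le_one₀ hx.le (norm_nonneg _) (hpow _)))
  have e4 : ‖((∏ j, a j) / (∏ j, b j) * x) ^ multiDeg l * q ^ (multiDeg l).choose 2‖
      ≤ ‖(∏ j, a j) / ∏ j, b j‖ ^ multiDeg l := by
    rw [norm_mul, norm_pow, norm_mul]
    refine (mul_le_of_le_one_right (by positivity) (hpow _)).trans ?_
    gcongr
    exact mul_le_of_le_one_right (norm_nonneg _) hx.le
  have e5 := hle l
  rw [poisedTerm]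
  simp only [norm_mul _ (multiCoeff _ _ _ _), norm_mul _ (poisedProd _ _ _),
    norm_mul _ (_ * q ^ (multiDeg l).choose 2), norm_mul _ (∏ j, qPochInf q (a j * x * _)),
    norm_mul _ (∏ i, qPoch _ _ _)]
  calc _ ≤ K₁ * (∏ i, K₂ i) * (∏ j, K₃ j) * ‖(∏ j, a j) / ∏ j, b j‖ ^ multiDeg l
        * ‖multiCoeff q (hypWeight' a) b l‖ * ∏ j, (1 + ‖b j / q‖) := by
        have := h₁ x hx.le (multiDeg l)
        have := Finset.prod_nonneg fun i (_ : i ∈ Finset.univ) => (hK₂ i).le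
        have := Finset.prod_nonneg fun i (_ : i ∈ Finset.univ) => (hK₃ i).le
        gcongr
    _ = K₁ * (∏ i, K₂ i) * (∏ j, K₃ j) * (∏ j, (1 + ‖b j / q‖))
        * (‖multiCoeff q (hypWeight' a) b l‖ * ‖(∏ j, a j) / ∏ j, b j‖ ^ multiDeg l) := by ring
    _ ≤ _ := by
        have := Finset.prod_nonneg fun i (_ : i ∈ Finset.univ) => (hK₂ i).le
        have := Finset.prod_nonneg fun i (_ : i ∈ Finset.univ) => (hK₃ i).le
        gcongr

theorem summable_poisedTerm (hb : QGeneric q b) (hq1 : ‖q‖ < 1) (a : Fin (M + 1) → ℂ) {x : ℂ}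
    (hx : ‖x‖ < 1) : Summable (poisedTerm q a b x) := by
  obtain ⟨u, hu, hle⟩ := exists_norm_poisedTerm_le hb hq1 a
  exact Summable.of_norm_bounded hu fun l => hle l x hx

theorem differentiable_poisedTerm (hq1 : ‖q‖ < 1) (a : Fin (M + 1) → ℂ) (b : Fin M → ℂ)
    (l : Fin M → ℕ) : Differentiable ℂ fun x => poisedTerm q a b x l := by
  have hP : ∀ c d : ℂ, Differentiable ℂ fun x => qPochInf q (c * x * d) := fun c d =>
    (differentiable_qPochInf hq1).comp
      (by fun_prop : Differentiable ℂ fun x : ℂ => c * x * d)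
  have h1 : Differentiable ℂ fun x : ℂ => ∏ j, qPochInf q (a j * x * q ^ multiDeg l) := by
    have := Differentiable.fun_finsetProd (𝕜 := ℂ) (u := Finset.univ)
      (f := fun j x => qPochInf q (a j * x * q ^ multiDeg l)) fun j _ => hP (a j) (q ^ multiDeg l)
    exact this
  unfold poisedTerm qPoch poisedProd
  simp only [div_eq_mul_inv]
  fun_prop

theorem differentiableOn_tsum_poisedTerm (hb : QGeneric q b) (hq1 : ‖q‖ < 1)
    (a : Fin (M + 1) → ℂ) :
    DifferentiableOn ℂ (fun x => ∑' l, poisedTerm q a b x l) (Metric.ball 0 1) := by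
  obtain ⟨u, hu, hle⟩ := exists_norm_poisedTerm_le hb hq1 a
  exact Complex.differentiableOn_tsum_of_summable_norm hu
    (fun l => (differentiable_poisedTerm hq1 a b l).differentiableOn) Metric.isOpen_ball
    fun l x hx => hle l x (mem_ball_zero_iff.mp hx)

theorem differentiable_poisedDenom (hq1 : ‖q‖ < 1) (b : Fin M → ℂ) :
    Differentiable ℂ (poisedDenom q b) := by
  have hP := differentiable_qPochInf hq1
  refine hP.mul ?_
  have := Differentiable.fun_finsetProd (𝕜 := ℂ) (u := Finset.univ)
    (f := fun i x => qPochInf q (b i * x / q)) fun i _ =>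
      hP.comp (by fun_prop : Differentiable ℂ fun x : ℂ => b i * x / q)
  exact this

theorem poisedDenom_eq (hq1 : ‖q‖ < 1) (b : Fin M → ℂ) (x : ℂ) (n : ℕ) :
    poisedDenom q b x
      = qPoch q x n * (∏ i, qPoch q (b i * x / q) n) * poisedDenom q b (x * q ^ n) := by
  have : ∏ i, qPochInf q (b i * x / q)
      = (∏ i, qPoch q (b i * x / q) n) * ∏ i, qPochInf q (b i * (x * q ^ n) / q) := by
    rw [← Finset.prod_mul_distrib]
    refine Finset.prod_congr rfl fun i _ => ?_
    rw [← qPoch_mul_qPochInf hq1 _ n, ← mul_assoc, mul_div_right_comm (b i * x)]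
  rw [poisedDenom, poisedDenom, this, ← qPoch_mul_qPochInf hq1 x n]
  ring

theorem hasSum_poisedDegTerm (hb : QGeneric q b) (hq1 : ‖q‖ < 1) (a : Fin (M + 1) → ℂ) {x : ℂ}
    (hx : x ∈ poisedDomain q b) :
    HasSum (poisedDegTerm q a b x) ((∑' l, poisedTerm q a b x l) / poisedDenom q b x) := by
  refine ((hasSum_piAntidiag (summable_poisedTerm hb hq1 a hx.1).hasSum).div_const
    (poisedDenom q b x)).congr_fun fun n => ?_
  have h0 := poisedDenom_ne_zero hq1 hx
  rw [poisedDegTerm, degSum, Finset.mul_sum, Finset.sum_div]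
  refine Finset.sum_congr rfl fun l hl => ?_
  rw [mem_piAntidiag_univ] at hl
  have hd := poisedDenom_eq hq1 b x n
  rw [hd] at h0
  have h1 := right_ne_zero_of_mul h0
  have h2 := left_ne_zero_of_mul h0
  rw [poisedTerm, hl, hd]
  change _ * ((∏ j, qPochInf q (a j * (x * q ^ n))) / poisedDenom q b (x * q ^ n)) * _ = _
  simp only [mul_assoc (a _) x]
  generalize (∏ j, qPochInf q (a j * (x * q ^ n))) = E1 at *
  generalize (∏ i, qPoch q (b i * x / q) n) = E2 at *
  generalize poisedProd q (x * q ^ n) _ = E3 at *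
  generalize ((∏ j, a j) / (∏ j, b j) * x) ^ n = E4 at *
  rw [mul_ne_zero_iff] at h2
  obtain ⟨h3, h4⟩ := h2
  field_simp

theorem degSum_zero (hb : QGeneric q b) (κ : ℂ → ℂ) (Φ : (Fin M → ℂ) → ℂ) :
    degSum q κ b Φ 0 = Φ b := by
  simp [degSum, multiCoeff_zero hb]

/-- The weight converges to its finite value at 0, and the other factor is dominated by the terms of
a convergent series. -/
theorem tendsto_poisedTail (hb : QGeneric q b) (hq1 : ‖q‖ < 1) (a : Fin (M + 1) → ℂ) (x : ℂ) :
    Tendsto (poisedTail q a b x) atTop (𝓝 0) := by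
  have hpow : ∀ n : ℕ, ‖q ^ n‖ ≤ 1 := fun n => by
    rw [norm_pow]
    exact pow_le_one₀ (norm_nonneg q) hq1.le
  have hX : Tendsto (fun n : ℕ => x * q ^ n) atTop (𝓝 0) := by
    simpa using (tendsto_pow_atTop_nhds_zero_of_norm_lt_one hq1).const_mul x
  have h1 : Tendsto (fun n : ℕ => poisedWeight q a b (x * q ^ n)
      * ((1 - x * q ^ n) * poisedProd q (x * q ^ n) b)) atTop
      (𝓝 (poisedWeight q a b 0 * ((1 - 0) * poisedProd q 0 b))) := by
    have hc : ContinuousAt (fun X => poisedWeight q a b X * ((1 - X) * poisedProd q X b)) 0 := by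
      have hP := (differentiable_qPochInf hq1).continuous
      have h2 : ContinuousAt (poisedWeight q a b) 0 := by
        refine ContinuousAt.div ?_ (differentiable_poisedDenom hq1 b).continuous.continuousAt
          (poisedDenom_ne_zero hq1 (zero_mem_poisedDomain q b))
        exact Continuous.continuousAt (continuous_finsetProd _ fun j _ =>
          hP.comp (continuous_const_mul (a j)))
      refine h2.mul (Continuous.continuousAt ?_)
      unfold poisedProd
      simp only [div_eq_mul_inv]
      fun_prop
    exact hc.tendsto.comp hX
  have h2 : Tendsto (fun n : ℕ => ((∏ j, a j) / (∏ j, b j) * x) ^ n * q ^ n.choose 2 * q ^ n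
      * degSum q (hypWeight' a) b (fun _ => 1) n) atTop (𝓝 0) := by
    set y := (∏ j, a j) / (∏ j, b j) * x
    obtain ⟨u, hu, hle⟩ := exists_summable_bound hb hq1 a (norm_nonneg y)
    have hs : Summable fun l : Fin M → ℕ => multiCoeff q (hypWeight' a) b l * y ^ multiDeg l :=
      Summable.of_norm_bounded hu fun l => by
        rw [norm_mul, norm_pow]
        exact hle l
    have ht := (hasSum_piAntidiag hs.hasSum).summable.tendsto_atTop_zero
    refine squeeze_zero_norm (fun n => ?_) (tendsto_zero_iff_norm_tendsto_zero.mp ht)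
    have e : ∑ l ∈ Finset.piAntidiag Finset.univ n, multiCoeff q (hypWeight' a) b l * y ^ multiDeg l
        = degSum q (hypWeight' a) b (fun _ => 1) n * y ^ n := by
      rw [degSum, Finset.sum_mul]
      exact Finset.sum_congr rfl fun l hl => by rw [mem_piAntidiag_univ.mp hl, mul_one]
    have e' : y ^ n * q ^ n.choose 2 * q ^ n * degSum q (hypWeight' a) b (fun _ => 1) n
        = degSum q (hypWeight' a) b (fun _ => 1) n * y ^ n * (q ^ n.choose 2 * q ^ n) := by ring
    rw [e, e', norm_mul _ (_ * q ^ n), norm_mul _ (q ^ n)]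
    exact mul_le_of_le_one_right (norm_nonneg _) (mul_le_one₀ (hpow _) (norm_nonneg _) (hpow _))
  have h3 := h1.mul h2
  rwa [mul_zero] at h3

theorem poisedSum_relation (hb : QGeneric q b) (hq : q ≠ 0) (hq1 : ‖q‖ < 1)
    (ha : ∀ j, a j ≠ 0) {x : ℂ} (hx : x ∈ poisedDomain q b) (hx0 : x ≠ 0) :
    (1 - x) * ((∑' l, poisedTerm q a b x l) / poisedDenom q b x)
        - (1 - (∏ j, a j) / (∏ j, b j) * x)
          * ((∑' l, poisedTerm q a b (q * x) l) / poisedDenom q b (q * x))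
      = (∏ j, a j) / (∏ j, b j) * x * ∑ i, lowerCoeff (hypWeight a) b i
          * ((∑' l, poisedTerm q a (qShift q b i) (q * x) l)
            / poisedDenom q (qShift q b i) (q * x)) := by
  have s1 := hasSum_poisedDegTerm hb hq1 a hx
  rw [← hasSum_nat_add_iff' 1, Finset.sum_range_one] at s1
  have s2 := hasSum_poisedDegTerm hb hq1 a (mul_mem_poisedDomain hq1 hx)
  have s3 := hasSum_sum fun i (_ : i ∈ Finset.univ) =>
    (hasSum_poisedDegTerm (hb.shift hq i) hq1 a
      (mul_mem_poisedDomain_qShift hq1 hx i)).mul_left (lowerCoeff (hypWeight a) b i)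
  have s := ((s1.mul_left (1 - x)).sub (s2.mul_left (1 - (∏ j, a j) / (∏ j, b j) * x))).sub
    (s3.mul_left ((∏ j, a j) / (∏ j, b j) * x))
  simp only [poisedDegTerm_relation hb hq hq1 ha hx hx0] at s
  -- The partial sums telescope, so the combined sum equals minus the initial tail; this is (1 - x)
  -- times the degree-0 part that was split off from the first series.
  have t := s.tendsto_sum_nat
  simp only [Finset.sum_range_sub] at t
  have h := tendsto_nhds_unique t ((tendsto_poisedTail hb hq1 a x).sub_const _)
  have h0 : poisedTail q a b x 0 = (1 - x) * poisedDegTerm q a b x 0 := by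
    simp only [poisedTail, poisedDegTerm, degSum_zero hb, pow_zero, mul_one, Nat.choose_zero_succ]
    ring
  rw [h0] at h
  linear_combination h

theorem tsum_poisedTerm_zero (hb : QGeneric q b) (a : Fin (M + 1) → ℂ) :
    ∑' l, poisedTerm q a b 0 l = 1 := by
  rw [tsum_eq_single 0 fun l hl => by
    simp [poisedTerm, multiDeg_eq_zero, hl]]
  simp [poisedTerm, multiDeg, multiCoeff_zero hb, qPoch_zero, qPochInf_zero, poisedProd]

/-- Uniqueness is applied to the quotient by `poisedDenom` near 0. The cleared form is analytic on
the unit disc, so it continues across zeros of the denominator. -/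
theorem tsum_poisedTerm_eq (hb : QGeneric q b) (hq : q ≠ 0) (hq1 : ‖q‖ < 1)
    (ha : ∀ j, a j ≠ 0) {x : ℂ} (hx : ‖x‖ < 1) :
    ∑' l, poisedTerm q a b x l = poisedDenom q b x * basicHyp q a b x := by
  have hsub : ∀ b : Fin M → ℂ, poisedDomain q b ⊆ Metric.ball 0 1 := fun b x hx =>
    mem_ball_zero_iff.mpr hx.1
  have hdiff : ∀ b, QGeneric q b → DifferentiableOn ℂ
      (fun x => (∑' l, poisedTerm q a b x l) / poisedDenom q b x - basicHyp q a b x)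
      (poisedDomain q b) := fun b hb =>
    (((differentiableOn_tsum_poisedTerm hb hq1 a).mono (hsub b)).div
      (differentiable_poisedDenom hq1 b).differentiableOn
        fun x hx => poisedDenom_ne_zero hq1 hx).sub
      ((differentiableOn_basicHyp hb hq1 a).mono (hsub b))
  have hnhds : ∀ b : Fin M → ℂ, poisedDomain q b ∈ 𝓝 (0 : ℂ) := fun b =>
    (isOpen_poisedDomain q b).mem_nhds (zero_mem_poisedDomain q b)
  have hzero := eventually_eq_zero_of_relation hq hq1
    (fun b x => (∑' l, poisedTerm q a b x l) / poisedDenom q b x - basicHyp q a b x)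
    (fun b => (∏ j, a j) / ∏ j, b j) (fun b => lowerCoeff (hypWeight a) b)
    (fun b hb => (hdiff b hb).analyticAt (hnhds b))
    (fun b hb => by
      simp [tsum_poisedTerm_zero hb, basicHyp_zero, poisedDenom, qPochInf_zero])
    (fun b hb => by
      filter_upwards [mem_nhdsWithin_of_mem_nhds (hnhds b), self_mem_nhdsWithin] with x hx hx0
      have h1 := poisedSum_relation hb hq hq1 ha hx hx0
      have h2 := basicHyp_relation hb hq hq1 ha hx.1
      rw [mul_div_right_comm] at h2
      simp only [mul_sub, Finset.sum_sub_distrib]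
      linear_combination h1 - h2) hb
  have hD : DifferentiableOn ℂ
      (fun x => ∑' l, poisedTerm q a b x l - poisedDenom q b x * basicHyp q a b x)
      (Metric.ball 0 1) :=
    (differentiableOn_tsum_poisedTerm hb hq1 a).sub
      ((differentiable_poisedDenom hq1 b).differentiableOn.mul (differentiableOn_basicHyp hb hq1 a))
  have hev : ∀ᶠ x in 𝓝 (0 : ℂ),
      ∑' l, poisedTerm q a b x l - poisedDenom q b x * basicHyp q a b x = 0 := by
    filter_upwards [hzero, hnhds b] with x h1 h2
    rw [sub_eq_zero, div_eq_iff (poisedDenom_ne_zero hq1 h2)] at h1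
    rw [h1]
    ring
  have := (hD.analyticOnNhd Metric.isOpen_ball).eqOn_zero_of_preconnected_of_eventuallyEq_zero
    (convex_ball (0 : ℂ) 1).isPreconnected (Metric.mem_ball_self one_pos) hev
    (mem_ball_zero_iff.mpr hx)
  exact sub_eq_zero.mp this

end WellPoisedSum

/-! ### Translation back to the stated series. -/

section MultipleTransformations

variable {q : ℂ} {M : ℕ} {b : Fin M → ℂ} {a : Fin (M + 1) → ℂ}

theorem firstTerm_eq (a : Fin (M + 1) → ℂ) (b : Fin M → ℂ) (x : ℂ) (l : Fin M → ℕ) :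
    firstTerm q a b x l
      = qPoch q x (multiDeg l) * (∏ i, qPoch q (b i * x / q) (multiDeg l))
        * (((∏ j, a j) / (∏ j, b j) * x) ^ multiDeg l * q ^ (multiDeg l).choose 2)
        * multiCoeff q (hypWeight' a) b l
        * (poisedProd q (x * q ^ multiDeg l) fun j => b j * q ^ l j)
        / ((∏ i, (1 - b i * x / q)) * ∏ j, qPoch q (a j * x) (multiDeg l)) := by
  have hpow : ((∏ j, a j) / (∏ j, b j) * x) ^ multiDeg l
      = ∏ i, ((∏ j, a j) / (∏ j, b j) * x) ^ l i := (Finset.prod_pow_eq_pow_sum _ _ _).symm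
  have hprod : ∏ i, ((1 - b i * x * q ^ (multiDeg l + l i) / q) / (1 - b i * x / q)
        * ((qPoch q (b i * x / q) (multiDeg l) * (∏ j : Fin (M + 1), qPoch q (b i / a j) (l i))
              * ((∏ j, a j) * b i * x / ∏ j, b j) ^ l i * q ^ ((l i).choose 2))
            / (qPoch q (a i.castSucc * x) (multiDeg l)
              * (∏ j : Fin M, qPoch q (q * b i / b j) (l i)) * qPoch q (b i) (l i))))
      = (poisedProd q (x * q ^ multiDeg l) fun j => b j * q ^ l j)
        * (∏ i, (1 - b i * x / q))⁻¹ * (∏ i, qPoch q (b i * x / q) (multiDeg l))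
        * (∏ i : Fin M, qPoch q (a i.castSucc * x) (multiDeg l))⁻¹
        * (∏ i, ((∏ j, a j) / (∏ j, b j) * x) ^ l i)
        * (∏ i, b i ^ l i * q ^ (l i).choose 2)
        * ∏ i, ((∏ j, qPoch q (b i / a j) (l i))
          / ((∏ j, qPoch q (q * b i / b j) (l i)) * qPoch q (b i) (l i))) := by
    rw [poisedProd]
    simp only [← Finset.prod_inv_distrib]
    simp only [← Finset.prod_mul_distrib]
    refine Finset.prod_congr rfl fun i _ => ?_
    have h1 : (∏ j, a j) * b i * x / ∏ j, b j = (∏ j, a j) / (∏ j, b j) * x * b i := by ring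
    have h2 : b i * x * q ^ (multiDeg l + l i) / q
        = b i * q ^ l i * (x * q ^ multiDeg l) / q := by ring
    rw [h1, h2, mul_pow _ (b i)]
    simp only [div_eq_mul_inv, mul_inv]
    ring
  rw [firstTerm, hprod, hpow, multiCoeff_hypWeight', multiCoeff_hypWeight,
    Fin.prod_univ_castSucc (fun j => qPoch q (a j * x) (multiDeg l))]
  simp only [div_eq_mul_inv, mul_inv]
  ring

/-- The prefactor combines with the finite factorials through (b_i x/q)_∞ = (1 - b_i x/q)(b_i x)_∞
and (a_j x)_∞ = (a_j x)_n (a_j x q^n)_∞, where n = |l|. The nonvanishing hypotheses are needed only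
to undo the clearing of denominators. -/
theorem poisedTerm_eq (hq : q ≠ 0) (hq1 : ‖q‖ < 1) {x : ℂ} (hx : ‖x‖ < 1)
    (hax : ∀ i, ∀ k : ℕ, a i * x * q ^ k ≠ 1) (hbx : ∀ i, b i * x ≠ q)
    (hbxq : ∀ i, ∀ k : ℕ, b i * x * q ^ k ≠ 1) (l : Fin M → ℕ) :
    poisedTerm q a b x l = poisedDenom q b x * (1 / qPochInf q x * (∏ i, qPochInf q (a i * x))
      * (∏ i, 1 / qPochInf q (b i * x))) * firstTerm q a b x l := by
  have hx0 := qPochInf_ne_zero hq1 (mul_pow_ne_one hq1 hx)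
  have hb0 : ∏ i, qPochInf q (b i * x) ≠ 0 :=
    Finset.prod_ne_zero_iff.mpr fun i _ => qPochInf_ne_zero hq1 (hbxq i)
  have hd0 : ∏ i, (1 - b i * x / q) ≠ 0 := Finset.prod_ne_zero_iff.mpr fun i _ h =>
    hbx i ((div_eq_one_iff_eq hq).mp (sub_eq_zero.mp h).symm)
  have ha0 : ∏ j, qPoch q (a j * x) (multiDeg l) ≠ 0 :=
    Finset.prod_ne_zero_iff.mpr fun j _ => qPoch_ne_zero (hax j) _
  have hd : poisedDenom q b x
      = qPochInf q x * ((∏ i, (1 - b i * x / q)) * ∏ i, qPochInf q (b i * x)) := by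
    rw [poisedDenom, ← Finset.prod_mul_distrib]
    congr 1
    refine Finset.prod_congr rfl fun i _ => ?_
    rw [qPochInf_eq_one_sub_mul hq1, mul_div_cancel₀ _ hq]
  have ha' : ∏ i, qPochInf q (a i * x) = (∏ j, qPoch q (a j * x) (multiDeg l))
      * ∏ j, qPochInf q (a j * x * q ^ multiDeg l) := by
    rw [← Finset.prod_mul_distrib]
    exact Finset.prod_congr rfl fun j _ => (qPoch_mul_qPochInf hq1 _ _).symm
  have hb' : ∏ i, 1 / qPochInf q (b i * x) = 1 / ∏ i, qPochInf q (b i * x) := by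
    simp only [one_div, Finset.prod_inv_distrib]
  rw [firstTerm_eq, hd, ha', hb', poisedTerm]
  generalize (∏ j, qPoch q (a j * x) (multiDeg l)) = E1 at *
  generalize (∏ i, (1 - b i * x / q)) = E2 at *
  generalize (∏ i, qPochInf q (b i * x)) = E3 at *
  generalize (∏ j, qPochInf q (a j * x * q ^ multiDeg l)) = E4 at *
  generalize (∏ i, qPoch q (b i * x / q) (multiDeg l)) = E5 at *
  generalize (poisedProd q (x * q ^ multiDeg l) fun j => b j * q ^ l j) = E6 at *
  generalize ((∏ j, a j) / (∏ j, b j) * x) ^ multiDeg l = E7 at *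
  field_simp

theorem summable_firstTerm_and_tsum_eq (hb : QGeneric q b) (hq : q ≠ 0) (hq1 : ‖q‖ < 1)
    (ha : ∀ j, a j ≠ 0) {x : ℂ} (hx : ‖x‖ < 1)
    (hax : ∀ i, ∀ k : ℕ, a i * x * q ^ k ≠ 1) (hbx : ∀ i, b i * x ≠ q)
    (hbxq : ∀ i, ∀ k : ℕ, b i * x * q ^ k ≠ 1) :
    Summable (firstTerm q a b x) ∧
      1 / qPochInf q x * (∏ i, qPochInf q (a i * x)) * (∏ i, 1 / qPochInf q (b i * x))
        * ∑' l : Fin M → ℕ, firstTerm q a b x l = basicHyp q a b x := by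
  have hD : poisedDenom q b x ≠ 0 := by
    refine mul_ne_zero (qPochInf_ne_zero hq1 (mul_pow_ne_one hq1 hx))
      (Finset.prod_ne_zero_iff.mpr fun i _ => ?_)
    rw [qPochInf_eq_one_sub_mul hq1, mul_div_cancel₀ _ hq]
    refine mul_ne_zero (fun h => ?_) (qPochInf_ne_zero hq1 (hbxq i))
    exact hbx i ((div_eq_one_iff_eq hq).mp (sub_eq_zero.mp h).symm)
  have hp : 1 / qPochInf q x * (∏ i, qPochInf q (a i * x)) * (∏ i, 1 / qPochInf q (b i * x)) ≠ 0 :=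
    mul_ne_zero (mul_ne_zero
      (one_div_ne_zero (qPochInf_ne_zero hq1 (mul_pow_ne_one hq1 hx)))
      (Finset.prod_ne_zero_iff.mpr fun i _ => qPochInf_ne_zero hq1 (hax i)))
      (Finset.prod_ne_zero_iff.mpr fun i _ => one_div_ne_zero (qPochInf_ne_zero hq1 (hbxq i)))
  have hterm := poisedTerm_eq (a := a) (b := b) hq hq1 hx hax hbx hbxq
  have hs := summable_poisedTerm hb hq1 a hx
  have hsum := tsum_poisedTerm_eq hb hq hq1 ha hx
  simp only [hterm, tsum_mul_left] at hsum
  refine ⟨(summable_mul_left_iff (mul_ne_zero hD hp)).mp (hs.congr hterm), ?_⟩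
  rw [mul_assoc (poisedDenom q b x)] at hsum
  exact mul_left_cancel₀ hD hsum

theorem summable_secondTerm_and_tsum_eq (hb : QGeneric q b) (hq : q ≠ 0) (hq1 : ‖q‖ < 1)
    (ha : ∀ j, a j ≠ 0) {x : ℂ} (hx : ‖x‖ < 1) (hy : ‖(∏ j, a j) * x / ∏ j, b j‖ < 1) :
    Summable (secondTerm q a b x) ∧
      qPochInf q ((∏ j, a j) * x / ∏ j, b j) / qPochInf q x
        * ∑' l : Fin M → ℕ, secondTerm q a b x l = basicHyp q a b x := by
  rw [mul_div_right_comm] at hy ⊢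
  have hterm := secondTerm_eq (q := q) a b x
  refine ⟨(summable_eulerSum hb hq1 a hy).congr fun l => (hterm l).symm, ?_⟩
  rw [tsum_congr hterm]
  exact eulerSide_eq_basicHyp hb hq hq1 ha hx hy

end MultipleTransformations

theorem mainTheorem10 (q : ℂ) (hq0 : 0 < ‖q‖) (hq1 : ‖q‖ < 1) (M : ℕ) (hM : 1 ≤ M)
    (a : Fin (M + 1) → ℂ) (b : Fin M → ℂ) (x : ℂ) (hx : ‖x‖ < 1)
    (ha : ∀ i, a i ≠ 0) (hb : ∀ i, b i ≠ 0)
    (hbq : ∀ i, ∀ k : ℕ, b i * q ^ k ≠ 1)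
    (hbb : ∀ i j, i ≠ j → ∀ k : ℕ, b i * q ^ k ≠ b j) :
    Summable (basicHypTerm q a b x) ∧
    ((∀ i, ∀ k : ℕ, a i * x * q ^ k ≠ 1) →
      (∀ i, b i * x ≠ q) → (∀ i, ∀ k : ℕ, b i * x * q ^ k ≠ 1) →
        Summable (firstTerm q a b x) ∧
        1 / qPochInf q x * (∏ i, qPochInf q (a i * x)) * (∏ i, 1 / qPochInf q (b i * x))
            * ∑' l : Fin M → ℕ, firstTerm q a b x l
          = basicHyp q a b x) ∧
    (‖(∏ j, a j) * x / ∏ j, b j‖ < 1 →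
        Summable (secondTerm q a b x) ∧
        qPochInf q ((∏ j, a j) * x / ∏ j, b j) / qPochInf q x
            * ∑' l : Fin M → ℕ, secondTerm q a b x l
          = basicHyp q a b x) ∧
    ((∀ k : ℕ, a (Fin.last M) * x * q ^ k ≠ 1) →
        Summable (thirdTerm q a b x) ∧
        qPochInf q (a (Fin.last M) * x) / qPochInf q x
            * ∑' l : Fin M → ℕ, thirdTerm q a b x l
          = basicHyp q a b x) := by
  have hq : q ≠ 0 := norm_pos_iff.mp hq0
  have hG : QGeneric q b := ⟨hb, hbq, hbb⟩
  refine ⟨?_, ?_, ?_, ?_⟩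
  · exact (summable_hypCoeff hG hq1 a hx).congr fun n => (basicHypTerm_eq a b x n).symm
  · intro hax hbx hbxq
    exact summable_firstTerm_and_tsum_eq hG hq hq1 ha hx hax hbx hbxq
  · intro hy
    exact summable_secondTerm_and_tsum_eq hG hq hq1 ha hx hy
  · intro hax
    exact ⟨summable_thirdTerm hG hq1 a ha hax, tsum_thirdTerm_eq_basicHyp hG hq hq1 a ha hx hax⟩
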